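/- **Setting.** Let $d\ge 1$. A dyadic cube is $I=\prod_{i=1}^d[2^k m_i,2^k(m_i+1))$ with $k,m_i\in\mathbb Z$; $\ell(I)=2^k$ is its side length and $|I|$ its Lebesgue measure. For $N\in\mathbb N$, a family of Schwartz functions $\phi_I:\mathbb R^d\to\mathbb C$ indexed by a collection $\mathcal I$ of dyadic cubes is called ($L^2$-normalized) *lacunary of order $N$ with constant $A$* if $\int\phi_I=0$ and $$|\partial^{j}\phi_I(x)|\le A\,|I|^{-1/2}\,\ell(I)^{-j}\Big(1+\frac{\mathrm{dist}(x,I)}{\ell(I)}\Big)^{-N}\qquad(x\in\mathbb R^d,\ 0\le j\le 10)$$ for all $I\in\mathcal I$, where $|\partial^j\phi|$ is the norm of the $j$-th total derivative. Put $\langle f,\phi\rangle=\int f\overline{\phi}$ and, for $M\in\mathbb N$, $\tilde\chi_{Q}(x)=\big(1+\mathrm{dist}(x,Q)/\ell(Q)\big)^{-M}$. A collection $\mathcal S$ of dyadic cubes is *sparse* if there are pairwise disjoint measurable sets $E(Q)\subseteq Q$, $Q\in\mathcal S$, with $|Q|<2|E(Q)|$. **Theorem.** Let $0<p<\infty$,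 $0<p_1<\infty$, $M\in\mathbb N$, and let $\epsilon_p>0$, or $\epsilon_p=0$ if $p\le 1$. There is an $N=N(d,p,p_1,\epsilon_p,M)$ such that for every $A$ there is a constant $C=C(d,p,p_1,\epsilon_p,M,A)<\infty$ with the following property. Let $\mathcal I$ be a (finite or infinite) collection of dyadic cubes in $\mathbb R^d$, let $(\phi^1_I)_{I\in\mathcal I}$ and $(\phi^2_I)_{I\in\mathcal I}$ be lacunary of order $N$ with constant $A$, let $w$ be a positive, locally integrable function on $\mathbb R^d$ and $f$ a Schwartz function. Then $\sum_{I\in\mathcal I}\langle f,\phi_I^1\rangle\phi_I^2(x)$ converges absolutely for every $x$, and there is a sparse collection $\mathcal S$ of dyadic cubes such that $$\Big\|\Big(\sum_{I\in\mathcal I}\langle f,\phi^1_I\rangle\,\phi^2_I\Big)w^{1/p}\Big\|_p^p\le C\sum_{Q\in\mathcal S}\Big(\frac1{|Q|^{1/p_1}}\Big\|\Big(\sum_{I\in\mathcal I,\,I\subseteq Q}\frac{|\langle f,\phi_I^1\rangle|^2}{|I|}\mathbf 1_I\Big)^{1/2}\Big\|_{p_1}\Big)^p\Big(\frac1{|Q|}\int_{\mathbb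 R^d}w^{1+\epsilon_p}\,\tilde\chi_Q\,dx\Big)^{\frac1{1+\epsilon_p}}|Q| .$$ Both sides are elements of $[0,\infty]$, with $0\cdot\infty=0$ on the right. -/

import Mathlib

open MeasureTheory
open scoped ENNReal NNReal SchwartzMap ComplexConjugate

noncomputable section

namespace SparseSquare

/-- Index of a dyadic cube in `ℝ^d`: `2^k` is the side length, `2^k • m` the lower corner. -/
structure DyadicCube (d : ℕ) where
  k : ℤ
  m : Fin d → ℤ

namespace DyadicCube

variable {d : ℕ}

/-- Side length `ℓ(Q) = 2^k`. -/
def side (Q : DyadicCube d) : ℝ := (2 : ℝ) ^ Q.k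

/-- The (half-open) dyadic cube `∏ᵢ [2^k mᵢ, 2^k (mᵢ + 1))` as a subset of `ℝ^d`. -/
def toSet (Q : DyadicCube d) : Set (EuclideanSpace ℝ (Fin d)) :=
  {x | ∀ i, Q.side * (Q.m i : ℝ) ≤ x i ∧ x i < Q.side * ((Q.m i : ℝ) + 1)}

/-- The distance of `x` to `Q` in units of the side length, plus one:
`1 + dist(x, Q) / ℓ(Q)`. -/
def relDist (Q : DyadicCube d) (x : EuclideanSpace ℝ (Fin d)) : ℝ :=
  1 + Metric.infDist x Q.toSet / Q.side

/-- The tail weight `χ̃_Q(x) = (1 + dist(x, Q) / ℓ(Q))^{-M}`. -/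
def tail (M : ℕ) (Q : DyadicCube d) (x : EuclideanSpace ℝ (Fin d)) : ℝ :=
  (Q.relDist x ^ M)⁻¹

end DyadicCube

/-- `(φ_I)_{I ∈ 𝓘}` is an `L²`-normalized lacunary family with decay of order `N` and
implicit constant `A`: for all `I ∈ 𝓘`, all derivatives of order `j ≤ 10` satisfy
`|∂^j φ_I(x)| ≤ A |I|^{-1/2} ℓ(I)^{-j} (1 + dist(x, I) / ℓ(I))^{-N}`, and `∫ φ_I = 0`. -/
def IsLacunary {d : ℕ} (N : ℕ) (A : ℝ) (𝓘 : Set (DyadicCube d))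
    (φ : DyadicCube d → 𝓢(EuclideanSpace ℝ (Fin d), ℂ)) : Prop :=
  ∀ I ∈ 𝓘,
    (∀ j : ℕ, j ≤ 10 → ∀ x : EuclideanSpace ℝ (Fin d),
      ‖iteratedFDeriv ℝ j (φ I) x‖ ≤
        A * (Real.sqrt (volume.real I.toSet))⁻¹ * (I.side ^ j)⁻¹ * (I.relDist x ^ N)⁻¹) ∧
    ∫ x, φ I x = 0

/-- The pairing `⟨f, φ⟩ = ∫ f \overline{φ}`. -/
def pairing {d : ℕ} (f φ : 𝓢(EuclideanSpace ℝ (Fin d), ℂ)) : ℂ :=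
  ∫ x, f x * conj (φ x)

/-- The square function localized to `Q`:
`(∑_{I ∈ 𝓘, I ⊆ Q} |⟨f, φ_I⟩|² / |I| · 1_I(x))^{1/2}`, with values in `[0, ∞]`. -/
def localSquare {d : ℕ} (𝓘 : Set (DyadicCube d))
    (φ : DyadicCube d → 𝓢(EuclideanSpace ℝ (Fin d), ℂ))
    (f : 𝓢(EuclideanSpace ℝ (Fin d), ℂ)) (Q : DyadicCube d)
    (x : EuclideanSpace ℝ (Fin d)) : ℝ≥0∞ :=
  (∑' I : {I : DyadicCube d // I ∈ 𝓘 ∧ I.toSet ⊆ Q.toSet},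
    I.1.toSet.indicator
      (fun _ => ‖pairing f (φ I.1)‖ₑ ^ 2 / volume I.1.toSet) x) ^ (1 / 2 : ℝ)

/-- The `L^{p₁}` average `|Q|^{-1/p₁} ‖S_Q f‖_{p₁}` of the square function localized to `Q`. -/
def squareAverage {d : ℕ} (p₁ : ℝ) (𝓘 : Set (DyadicCube d))
    (φ : DyadicCube d → 𝓢(EuclideanSpace ℝ (Fin d), ℂ))
    (f : 𝓢(EuclideanSpace ℝ (Fin d), ℂ)) (Q : DyadicCube d) : ℝ≥0∞ :=
  eLpNorm (localSquare 𝓘 φ f Q) (ENNReal.ofReal p₁) volume / volume Q.toSet ^ (1 / p₁)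

/-- The `L^r` tail average `(|Q|⁻¹ ∫ w^r χ̃_Q)^{1/r}` of the weight `w`, with values in `[0, ∞]`. -/
def weightAverage {d : ℕ} (M : ℕ) (r : ℝ) (w : EuclideanSpace ℝ (Fin d) → ℝ)
    (Q : DyadicCube d) : ℝ≥0∞ :=
  ((∫⁻ x, ENNReal.ofReal (w x ^ r * Q.tail M x)) / volume Q.toSet) ^ (1 / r)

/-- A collection of dyadic cubes is sparse if one can choose pairwise disjoint measurable sets
`E(Q) ⊆ Q` with `|Q| < 2 |E(Q)|`. -/
def IsSparse {d : ℕ} (S : Set (DyadicCube d)) : Prop :=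
  ∃ E : DyadicCube d → Set (EuclideanSpace ℝ (Fin d)),
    (∀ Q ∈ S, MeasurableSet (E Q) ∧ E Q ⊆ Q.toSet ∧ volume Q.toSet < 2 * volume (E Q)) ∧
    S.PairwiseDisjoint E

end SparseSquare

end

noncomputable section

namespace SparseSquare

/-! ### Dyadic cubes -/

section

namespace DyadicCube

variable {d : ℕ}

theorem ext_km {Q R : DyadicCube d} (hk : Q.k = R.k) (hm : ∀ i, Q.m i = R.m i) : Q = R := by
  cases Q; cases R; simp only [mk.injEq] at *; exact ⟨hk, funext hm⟩

theorem side_pos (Q : DyadicCube d) : 0 < Q.side := zpow_pos (by norm_num) _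

instance : Countable (DyadicCube d) := by
  have : Function.Injective (fun Q : DyadicCube d => (Q.k, Q.m)) := by
    rintro ⟨k, m⟩ ⟨k', m'⟩ h; simpa using h
  exact this.countable

/-- The dyadic cube of side length `2^k` that contains `x`. -/
def cubeAt (k : ℤ) (x : EuclideanSpace ℝ (Fin d)) : DyadicCube d :=
  ⟨k, fun i => ⌊x i / (2 : ℝ) ^ k⌋⟩

@[simp] theorem cubeAt_k (k : ℤ) (x : EuclideanSpace ℝ (Fin d)) : (cubeAt k x).k = k := rfl

theorem mem_iff {Q : DyadicCube d} {x : EuclideanSpace ℝ (Fin d)} :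
    x ∈ Q.toSet ↔ cubeAt Q.k x = Q := by
  have hs : (0 : ℝ) < 2 ^ Q.k := zpow_pos (by norm_num) _
  simp only [toSet, side, Set.mem_ofPred_eq]
  constructor
  · intro h
    refine ext_km rfl fun i => ?_
    obtain ⟨h1, h2⟩ := h i
    refine Int.floor_eq_iff.2 ⟨?_, ?_⟩
    · rw [le_div_iff₀ hs]; linarith
    · rw [div_lt_iff₀ hs]; linarith
  · intro h i
    have hi : ⌊x i / (2 : ℝ) ^ Q.k⌋ = Q.m i := congrFun (congrArg DyadicCube.m h) i
    obtain ⟨h1, h2⟩ := Int.floor_eq_iff.1 hi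
    rw [le_div_iff₀ hs] at h1
    rw [div_lt_iff₀ hs] at h2
    constructor <;> linarith

theorem mem_cubeAt (k : ℤ) (x : EuclideanSpace ℝ (Fin d)) : x ∈ (cubeAt k x).toSet :=
  mem_iff.2 rfl

/-- The lower corner of a dyadic cube. -/
def corner (Q : DyadicCube d) : EuclideanSpace ℝ (Fin d) :=
  WithLp.toLp 2 fun i => Q.side * Q.m i

theorem corner_mem (Q : DyadicCube d) : Q.corner ∈ Q.toSet := fun i => by
  have := Q.side_pos
  simp only [corner]
  constructor <;> nlinarith

theorem nonempty (Q : DyadicCube d) : Q.toSet.Nonempty := ⟨_, Q.corner_mem⟩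

/-- The dyadic cube of side length `2^k` that contains the corner of `Q`. -/
def up (Q : DyadicCube d) (k : ℤ) : DyadicCube d := cubeAt k Q.corner

@[simp] theorem up_k (Q : DyadicCube d) (k : ℤ) : (Q.up k).k = k := rfl

theorem floor_zpow (a : ℝ) {k l : ℤ} (h : k ≤ l) :
    ⌊a / (2 : ℝ) ^ l⌋ = ⌊a / (2 : ℝ) ^ k⌋ / (2 ^ (l - k).toNat : ℕ) := by
  have h2 : (2 : ℝ) ^ l = 2 ^ k * ((2 ^ (l - k).toNat : ℕ) : ℝ) := by
    push_cast
    rw [← zpow_natCast, ← zpow_add₀ (by norm_num)]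
    congr 1; omega
  rw [h2, ← div_div, Int.floor_div_natCast]

theorem cubeAt_up (x : EuclideanSpace ℝ (Fin d)) {k l : ℤ} (h : k ≤ l) :
    (cubeAt k x).up l = cubeAt l x := by
  have h1 := mem_iff.1 (cubeAt k x).corner_mem
  refine ext_km rfl fun i => ?_
  have hi := congrFun (congrArg DyadicCube.m h1) i
  simp only [cubeAt, up] at hi ⊢
  rw [floor_zpow _ h, floor_zpow _ h, hi]

theorem cubeAt_eq_up {Q : DyadicCube d} {x : EuclideanSpace ℝ (Fin d)} (hx : x ∈ Q.toSet) {k : ℤ}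
    (h : Q.k ≤ k) : cubeAt k x = Q.up k := by
  rw [← cubeAt_up x h, mem_iff.1 hx]

@[simp] theorem up_self (Q : DyadicCube d) : Q.up Q.k = Q := mem_iff.1 Q.corner_mem

theorem subset_up (Q : DyadicCube d) {k : ℤ} (h : Q.k ≤ k) : Q.toSet ⊆ (Q.up k).toSet :=
  fun x hx => by rw [← cubeAt_eq_up hx h]; exact mem_cubeAt _ _

theorem up_up (Q : DyadicCube d) {k l : ℤ} (h : Q.k ≤ k) (h' : k ≤ l) :
    (Q.up k).up l = Q.up l :=
  (cubeAt_eq_up (Q := Q.up k) (Q.subset_up h Q.corner_mem) h').symm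

theorem up_eq_of_mem {Q R : DyadicCube d} {x : EuclideanSpace ℝ (Fin d)} (hQ : x ∈ Q.toSet)
    (hR : x ∈ R.toSet) (h : Q.k ≤ R.k) : Q.up R.k = R := by
  rw [← cubeAt_eq_up hQ h, mem_iff.1 hR]

theorem up_m (Q : DyadicCube d) {k : ℤ} (h : Q.k ≤ k) (i : Fin d) :
    (Q.up k).m i = Q.m i / (2 ^ (k - Q.k).toNat : ℕ) := by
  have h1 := mem_iff.1 Q.corner_mem
  have hi := congrFun (congrArg DyadicCube.m h1) i
  simp only [cubeAt, up] at hi ⊢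
  rw [floor_zpow _ h, hi]

theorem toSet_eq_preimage (Q : DyadicCube d) :
    Q.toSet = (MeasurableEquiv.toLp 2 (Fin d → ℝ)).symm ⁻¹'
      (Set.univ.pi fun i => Set.Ico (Q.side * (Q.m i : ℝ)) (Q.side * ((Q.m i : ℝ) + 1))) := by
  ext x
  simp [toSet, Set.mem_pi]

theorem measurableSet (Q : DyadicCube d) : MeasurableSet Q.toSet := by
  rw [toSet_eq_preimage]
  exact (MeasurableEquiv.measurable _) (MeasurableSet.univ_pi fun i => measurableSet_Ico)

theorem volume_eq (Q : DyadicCube d) : volume Q.toSet = ENNReal.ofReal (Q.side ^ d) := by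
  rw [toSet_eq_preimage,
    (EuclideanSpace.volume_preserving_symm_measurableEquiv_toLp (Fin d)).measure_preimage_equiv,
    Real.volume_pi_Ico]
  have : ∀ i, Q.side * ((Q.m i : ℝ) + 1) - Q.side * (Q.m i : ℝ) = Q.side := fun i => by ring
  simp [this, ENNReal.ofReal_pow Q.side_pos.le]

theorem volume_ne_top (Q : DyadicCube d) : volume Q.toSet ≠ ∞ := by simp [volume_eq]

theorem volume_ne_zero (Q : DyadicCube d) : volume Q.toSet ≠ 0 := by
  have := pow_pos Q.side_pos d
  simp [volume_eq, this]

theorem side_le_side {Q R : DyadicCube d} (h : Q.k ≤ R.k) : Q.side ≤ R.side :=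
  zpow_le_zpow_right₀ (by norm_num) h

theorem volume_eq_of_k {Q R : DyadicCube d} (h : Q.k = R.k) : volume Q.toSet = volume R.toSet := by
  simp [volume_eq, side, h]

theorem k_le_of_volume [NeZero d] {Q R : DyadicCube d} (h : volume Q.toSet ≤ volume R.toSet) :
    Q.k ≤ R.k := by
  by_contra! hlt
  rw [volume_eq, volume_eq, ENNReal.ofReal_le_ofReal_iff (pow_nonneg R.side_pos.le d)] at h
  have h1 : R.side < Q.side := zpow_lt_zpow_right₀ (by norm_num) hlt
  exact absurd h (not_le.2 (pow_lt_pow_left₀ h1 R.side_pos.le (NeZero.ne d)))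

theorem k_le_of_subset [NeZero d] {Q R : DyadicCube d} (h : Q.toSet ⊆ R.toSet) : Q.k ≤ R.k :=
  k_le_of_volume (measure_mono h)

theorem subset_iff [NeZero d] {Q R : DyadicCube d} :
    Q.toSet ⊆ R.toSet ↔ Q.k ≤ R.k ∧ Q.up R.k = R := by
  constructor
  · intro h
    exact ⟨k_le_of_subset h, up_eq_of_mem Q.corner_mem (h Q.corner_mem) (k_le_of_subset h)⟩
  · rintro ⟨h, h'⟩
    rw [← h']; exact Q.subset_up h

theorem toSet_injective [NeZero d] {Q R : DyadicCube d} (h : Q.toSet = R.toSet) : Q = R := by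
  have h1 := subset_iff.1 h.subset
  have h2 := k_le_of_subset h.superset
  rw [← h1.2, ← le_antisymm h1.1 h2, up_self]

theorem subset_of_mem {Q R : DyadicCube d} {x : EuclideanSpace ℝ (Fin d)} (hQ : x ∈ Q.toSet)
    (hR : x ∈ R.toSet) (h : Q.k ≤ R.k) : Q.toSet ⊆ R.toSet := by
  rw [← up_eq_of_mem hQ hR h]; exact Q.subset_up h

theorem eq_of_subset_of_k [NeZero d] {Q R : DyadicCube d} (h : Q.toSet ⊆ R.toSet) (hk : Q.k = R.k) :
    Q = R := by
  rw [← (subset_iff.1 h).2, ← hk, up_self]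

theorem eq_of_mem_of_k {Q R : DyadicCube d} {x : EuclideanSpace ℝ (Fin d)} (hQ : x ∈ Q.toSet)
    (hR : x ∈ R.toSet) (h : Q.k = R.k) : Q = R := by
  rw [← mem_iff.1 hQ, ← mem_iff.1 hR, h]

theorem disjoint_of_ne_of_k {Q R : DyadicCube d} (hne : Q ≠ R) (h : Q.k = R.k) :
    Disjoint Q.toSet R.toSet :=
  Set.disjoint_left.2 fun _ hx hy => hne (eq_of_mem_of_k hx hy h)

/-- The `j`-th dyadic ancestor. -/
def anc (Q : DyadicCube d) (j : ℕ) : DyadicCube d := Q.up (Q.k + j)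

@[simp] theorem anc_k (Q : DyadicCube d) (j : ℕ) : (Q.anc j).k = Q.k + j := rfl

@[simp] theorem anc_zero (Q : DyadicCube d) : Q.anc 0 = Q := by simp [anc]

theorem anc_anc (Q : DyadicCube d) (i j : ℕ) : (Q.anc i).anc j = Q.anc (i + j) := by
  simp only [anc, up_k]
  rw [up_up _ (by omega) (by omega)]
  congr 1; push_cast; ring

theorem subset_anc (Q : DyadicCube d) (j : ℕ) : Q.toSet ⊆ (Q.anc j).toSet :=
  Q.subset_up (by omega)

theorem side_anc (Q : DyadicCube d) (j : ℕ) : (Q.anc j).side = 2 ^ j * Q.side := by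
  simp only [side, anc_k]
  rw [zpow_add₀ (by norm_num), zpow_natCast, mul_comm]

/-- Two cubes of the same side length are near if they are equal or adjacent. -/
def Near (Q R : DyadicCube d) : Prop := R.k = Q.k ∧ ∀ i, |R.m i - Q.m i| ≤ 1

/-- The `3^d` translates of `Q` that are near `Q`. -/
def shift (Q : DyadicCube d) (v : Fin d → Fin 3) : DyadicCube d :=
  ⟨Q.k, fun i => Q.m i + ((v i : ℕ) : ℤ) - 1⟩

@[simp] theorem shift_k (Q : DyadicCube d) (v : Fin d → Fin 3) : (Q.shift v).k = Q.k := rfl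

theorem near_iff {Q R : DyadicCube d} : Near Q R ↔ ∃ v, R = Q.shift v := by
  constructor
  · rintro ⟨hk, hm⟩
    refine ⟨fun i => ⟨(R.m i - Q.m i + 1).toNat, ?_⟩, ext_km hk fun i => ?_⟩
    · have := abs_le.1 (hm i); omega
    · have := abs_le.1 (hm i); simp only [shift]; omega
  · rintro ⟨v, rfl⟩
    refine ⟨rfl, fun i => ?_⟩
    have := (v i).2
    simp only [shift]; rw [abs_le]; omega

theorem near_shift (Q : DyadicCube d) (v : Fin d → Fin 3) : Near Q (Q.shift v) :=
  near_iff.2 ⟨v, rfl⟩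

theorem Near.symm {Q R : DyadicCube d} (h : Near Q R) : Near R Q :=
  ⟨h.1.symm, fun i => by rw [abs_sub_comm]; exact h.2 i⟩

theorem shift_left_injective (v : Fin d → Fin 3) :
    Function.Injective (fun Q : DyadicCube d => Q.shift v) := by
  intro Q R h
  change Q.shift v = R.shift v at h
  refine ext_km (show (Q.shift v).k = (R.shift v).k by rw [h]) fun i => ?_
  have := congrFun (congrArg DyadicCube.m h) i
  simp only [shift] at this
  omega

theorem ediv_le_ediv_add_one {a b : ℤ} (h : b ≤ a + 1) (n : ℕ) :
    b / (2 ^ n : ℕ) ≤ a / (2 ^ n : ℕ) + 1 := by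
  have hp : (0 : ℤ) < (2 ^ n : ℕ) := by positivity
  calc b / (2 ^ n : ℕ) ≤ (a + (2 ^ n : ℕ)) / (2 ^ n : ℕ) :=
        Int.ediv_le_ediv hp (by omega)
    _ = _ := by rw [Int.add_ediv_of_dvd_right (dvd_refl _), Int.ediv_self hp.ne']

theorem Near.up {Q R : DyadicCube d} (h : Near Q R) {k : ℤ} (hk : Q.k ≤ k) :
    Near (Q.up k) (R.up k) := by
  refine ⟨rfl, fun i => ?_⟩
  have hi := abs_le.1 (h.2 i)
  rw [up_m _ hk, up_m _ (h.1.trans_le hk), h.1, abs_le]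
  have h1 := ediv_le_ediv_add_one (show R.m i ≤ Q.m i + 1 by omega) (k - Q.k).toNat
  have h2 := ediv_le_ediv_add_one (show Q.m i ≤ R.m i + 1 by omega) (k - Q.k).toNat
  omega

theorem norm_le_sum (x : EuclideanSpace ℝ (Fin d)) : ‖x‖ ≤ ∑ i, |x i| := by
  rw [EuclideanSpace.norm_eq]
  refine Real.sqrt_le_iff.2 ⟨Finset.sum_nonneg fun i _ => abs_nonneg _, ?_⟩
  have := Finset.sum_sq_le_sq_sum_of_nonneg (s := Finset.univ) (f := fun i => |x i|)
    (fun i _ => abs_nonneg _)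
  simpa using this

theorem norm_sub_le_of_near {Q R : DyadicCube d} (h : Near Q R) {x y : EuclideanSpace ℝ (Fin d)}
    (hx : x ∈ Q.toSet) (hy : y ∈ R.toSet) : ‖x - y‖ ≤ 2 * d * Q.side := by
  refine (norm_le_sum _).trans ?_
  have : ∀ i ∈ Finset.univ, |(x - y) i| ≤ 2 * Q.side := fun i _ => by
    obtain ⟨h1, h2⟩ := hx i
    obtain ⟨h3, h4⟩ := hy i
    have hs : R.side = Q.side := by simp [side, h.1]
    rw [hs] at h3 h4
    have hm := abs_le.1 (h.2 i)
    have hm1 : (R.m i : ℝ) ≤ Q.m i + 1 := by exact_mod_cast (by omega : R.m i ≤ Q.m i + 1)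
    have hm2 : (Q.m i : ℝ) ≤ R.m i + 1 := by exact_mod_cast (by omega : Q.m i ≤ R.m i + 1)
    have hp := Q.side_pos
    simp only [PiLp.sub_apply]
    rw [abs_le]
    constructor <;> nlinarith
  refine (Finset.sum_le_sum this).trans ?_
  simp; linarith

theorem norm_sub_le {Q : DyadicCube d} {x y : EuclideanSpace ℝ (Fin d)}
    (hx : x ∈ Q.toSet) (hy : y ∈ Q.toSet) : ‖x - y‖ ≤ d * Q.side := by
  refine (norm_le_sum _).trans ?_
  have : ∀ i ∈ Finset.univ, |(x - y) i| ≤ Q.side := fun i _ => by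
    obtain ⟨h1, h2⟩ := hx i
    obtain ⟨h3, h4⟩ := hy i
    simp only [PiLp.sub_apply]
    rw [abs_le]
    constructor <;> nlinarith
  refine (Finset.sum_le_sum this).trans ?_
  simp

theorem side_le_norm_sub {Q R : DyadicCube d} (hk : R.k = Q.k) (h : ¬ Near Q R)
    {x y : EuclideanSpace ℝ (Fin d)} (hx : x ∈ Q.toSet) (hy : y ∈ R.toSet) :
    Q.side ≤ ‖x - y‖ := by
  have hs : R.side = Q.side := by simp [side, hk]
  have hp := Q.side_pos
  simp only [Near, hk, true_and, not_forall, not_le] at h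
  obtain ⟨i, hi⟩ := h
  refine le_trans ?_ (PiLp.norm_apply_le (x - y) i)
  obtain ⟨h1, h2⟩ := hx i
  obtain ⟨h3, h4⟩ := hy i
  rw [hs] at h3 h4
  simp only [PiLp.sub_apply, Real.norm_eq_abs]
  rcases lt_abs.1 hi with h | h
  · have : (Q.m i : ℝ) + 2 ≤ R.m i := by exact_mod_cast (by omega : Q.m i + 2 ≤ R.m i)
    rw [abs_sub_comm]
    refine le_trans ?_ (le_abs_self _)
    nlinarith
  · have : (R.m i : ℝ) + 2 ≤ Q.m i := by exact_mod_cast (by omega : R.m i + 2 ≤ Q.m i)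
    refine le_trans ?_ (le_abs_self _)
    nlinarith

theorem near_cubeAt {x y : EuclideanSpace ℝ (Fin d)} {k : ℤ} (h : ‖x - y‖ < 2 ^ k) :
    Near (cubeAt k x) (cubeAt k y) := by
  by_contra hn
  exact absurd (side_le_norm_sub (Q := cubeAt k x) (R := cubeAt k y) rfl hn
    (mem_cubeAt k x) (mem_cubeAt k y)) (not_le.2 h)

/-- `I` is contained in the union `3Q` of the cubes near `Q`. -/
def In3 (I Q : DyadicCube d) : Prop := I.k ≤ Q.k ∧ Near Q (I.up Q.k)

theorem exists_in3_anc (I Q : DyadicCube d) : ∃ j, In3 I (Q.anc j) := by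
  obtain ⟨n, hn⟩ := pow_unbounded_of_one_lt (‖Q.corner - I.corner‖ / 2 ^ Q.k)
    (by norm_num : (1 : ℝ) < 2)
  have hq : (0 : ℝ) < 2 ^ Q.k := zpow_pos (by norm_num) _
  refine ⟨n + (I.k - Q.k).toNat, by simp; omega, ?_⟩
  simp only [anc_k]
  refine near_cubeAt ?_
  rw [div_lt_iff₀ hq] at hn
  refine hn.trans_le ?_
  rw [zpow_add₀ (by norm_num), zpow_natCast, mul_comm]
  gcongr
  · norm_num
  · omega

theorem In3.norm_lower {I Q : DyadicCube d} (hk : I.k ≤ Q.k) (h : ¬ In3 I Q)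
    {x y : EuclideanSpace ℝ (Fin d)} (hx : x ∈ Q.toSet) (hy : y ∈ I.toSet) : Q.side ≤ ‖x - y‖ :=
  side_le_norm_sub (Q := Q) (R := I.up Q.k) rfl (fun hn => h ⟨hk, hn⟩) hx (I.subset_up hk hy)

/-- The maximal elements of a collection of cubes. -/
def maximals (𝓔 : Set (DyadicCube d)) : Set (DyadicCube d) :=
  {R | R ∈ 𝓔 ∧ ∀ R' ∈ 𝓔, R.toSet ⊆ R'.toSet → R' = R}

theorem exists_maximals [NeZero d] {𝓔 : Set (DyadicCube d)} {K : ℤ} (hK : ∀ R ∈ 𝓔, R.k ≤ K)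
    {R : DyadicCube d} (hR : R ∈ 𝓔) : ∃ R' ∈ maximals 𝓔, R.toSet ⊆ R'.toSet := by
  obtain ⟨k, hk, hmax⟩ := Int.exists_greatest_of_bdd (P := fun k => R.k ≤ k ∧ R.up k ∈ 𝓔)
    ⟨K, fun k hk => hK _ hk.2⟩ ⟨R.k, le_rfl, by simpa using hR⟩
  refine ⟨R.up k, ⟨hk.2, fun R' hR' hsub => ?_⟩, R.subset_up hk.1⟩
  obtain ⟨h1, h2⟩ := subset_iff.1 hsub
  rw [up_k] at h1
  rw [up_up _ hk.1 h1] at h2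
  have h3 := hmax R'.k ⟨hk.1.trans h1, by rw [h2]; exact hR'⟩
  rw [← h2, le_antisymm h3 h1]

theorem maximals_pairwiseDisjoint (𝓔 : Set (DyadicCube d)) :
    (maximals 𝓔).PairwiseDisjoint toSet := by
  intro Q hQ R hR hne
  refine Set.disjoint_left.2 fun x hx hy => hne ?_
  rcases le_total Q.k R.k with h | h
  · exact (hQ.2 R hR.1 (subset_of_mem hx hy h)).symm
  · exact hR.2 Q hQ.1 (subset_of_mem hy hx h)

theorem tsum_volume_le {𝓔 : Set (DyadicCube d)} (h : 𝓔.PairwiseDisjoint toSet)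
    {s : Set (EuclideanSpace ℝ (Fin d))} (hs : ∀ Q ∈ 𝓔, Q.toSet ⊆ s) :
    ∑' Q : 𝓔, volume Q.1.toSet ≤ volume s := by
  rw [← measure_biUnion (Set.to_countable 𝓔) h fun Q _ => Q.measurableSet]
  exact measure_mono (Set.iUnion₂_subset hs)

end DyadicCube

end

/-! ### Decay kernels -/

section

namespace DyadicCube

variable {d : ℕ}

/-- The distance of `x` to the corner of `I` in units of the side length, plus one. -/
def rho (I : DyadicCube d) (x : EuclideanSpace ℝ (Fin d)) : ℝ := 1 + ‖x - I.corner‖ / I.side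

/-- The decay `ρ_I(x)^{-n}`. -/
def ker (n : ℕ) (I : DyadicCube d) (x : EuclideanSpace ℝ (Fin d)) : ℝ≥0∞ :=
  ENNReal.ofReal ((I.rho x ^ n)⁻¹)

theorem one_le_rho (I : DyadicCube d) (x : EuclideanSpace ℝ (Fin d)) : 1 ≤ I.rho x := by
  have := I.side_pos
  unfold rho
  have : 0 ≤ ‖x - I.corner‖ / I.side := by positivity
  linarith

theorem rho_pos (I : DyadicCube d) (x : EuclideanSpace ℝ (Fin d)) : 0 < I.rho x :=
  one_pos.trans_le (I.one_le_rho x)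

theorem rho_le_mul (I : DyadicCube d) (x y : EuclideanSpace ℝ (Fin d)) :
    I.rho y ≤ I.rho x * (1 + ‖x - y‖ / I.side) := by
  have hs := I.side_pos
  have h1 : ‖y - I.corner‖ ≤ ‖x - I.corner‖ + ‖x - y‖ := by
    have := _root_.norm_sub_le (x - I.corner) (x - y)
    rwa [sub_sub_sub_cancel_left] at this
  have h2 : ‖y - I.corner‖ / I.side ≤ ‖x - I.corner‖ / I.side + ‖x - y‖ / I.side := by
    rw [← add_div]; gcongr
  have h3 : 0 ≤ ‖x - I.corner‖ / I.side * (‖x - y‖ / I.side) := by positivity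
  unfold rho; nlinarith

theorem rho_le_of_norm_le {I : DyadicCube d} {x y : EuclideanSpace ℝ (Fin d)} {t : ℝ}
    (h : ‖x - y‖ ≤ t * I.side) : I.rho y ≤ I.rho x * (1 + t) := by
  refine (I.rho_le_mul x y).trans (mul_le_mul_of_nonneg_left ?_ (I.rho_pos x).le)
  have := (div_le_iff₀ I.side_pos).2 h
  linarith

theorem inv_pow_le_inv_pow {a b t : ℝ} (ha : 0 < a) (hb : 0 < b) (h : b ≤ a * t) (n : ℕ) :
    (a ^ n)⁻¹ ≤ t ^ n * (b ^ n)⁻¹ := by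
  have ht : 0 < t := by
    by_contra! hn
    nlinarith
  rw [← div_eq_mul_inv, le_div_iff₀ (by positivity), ← div_eq_inv_mul, div_le_iff₀ (by positivity)]
  calc b ^ n ≤ (a * t) ^ n := by gcongr
    _ = _ := by ring

theorem ker_le_of_rho_le {I J : DyadicCube d} {x y : EuclideanSpace ℝ (Fin d)} {t : ℝ}
    (h : J.rho y ≤ I.rho x * t) (n : ℕ) : I.ker n x ≤ ENNReal.ofReal (t ^ n) * J.ker n y := by
  unfold ker
  have ht : 0 ≤ t := by
    by_contra! hn
    nlinarith [I.rho_pos x, J.rho_pos y]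
  rw [← ENNReal.ofReal_mul (by positivity)]
  exact ENNReal.ofReal_le_ofReal (inv_pow_le_inv_pow (I.rho_pos x) (J.rho_pos y) h n)

theorem ker_le_of_norm_le {I : DyadicCube d} {x y : EuclideanSpace ℝ (Fin d)} {t : ℝ}
    (h : ‖x - y‖ ≤ t * I.side) (n : ℕ) : I.ker n x ≤ ENNReal.ofReal ((1 + t) ^ n) * I.ker n y :=
  ker_le_of_rho_le (rho_le_of_norm_le h) n

theorem ker_le_one (n : ℕ) (I : DyadicCube d) (x : EuclideanSpace ℝ (Fin d)) : I.ker n x ≤ 1 := by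
  unfold ker
  rw [ENNReal.ofReal_le_one]
  exact inv_le_one_of_one_le₀ (one_le_pow₀ (I.one_le_rho x))

theorem ker_anti {m n : ℕ} (h : m ≤ n) (I : DyadicCube d) (x : EuclideanSpace ℝ (Fin d)) :
    I.ker n x ≤ I.ker m x := by
  unfold ker
  refine ENNReal.ofReal_le_ofReal ?_
  have := I.rho_pos x
  gcongr
  exact I.one_le_rho x

theorem ker_add (m n : ℕ) (I : DyadicCube d) (x : EuclideanSpace ℝ (Fin d)) :
    I.ker (m + n) x = I.ker m x * I.ker n x := by
  unfold ker
  have := I.rho_pos x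
  rw [← ENNReal.ofReal_mul (by positivity), pow_add, mul_inv]

theorem measurable_rho (I : DyadicCube d) : Measurable I.rho := by
  unfold rho; fun_prop

theorem measurable_ker (n : ℕ) (I : DyadicCube d) : Measurable (I.ker n) := by
  unfold ker
  exact ENNReal.measurable_ofReal.comp ((I.measurable_rho.pow_const n).inv)

/-- The integral of `(1 + |x|)^{-(d+1)}` over `ℝ^d`. -/
def kerMass (d : ℕ) : ℝ≥0∞ :=
  ∫⁻ x : EuclideanSpace ℝ (Fin d), ENNReal.ofReal (((1 + ‖x‖) ^ (d + 1))⁻¹)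

theorem kerMass_ne_top (d : ℕ) : kerMass d ≠ ∞ := by
  have := finite_integral_one_add_norm (E := EuclideanSpace ℝ (Fin d)) (μ := volume)
    (r := ((d + 1 : ℕ) : ℝ)) (by simp)
  refine ne_of_lt (lt_of_eq_of_lt (lintegral_congr fun x => ?_) this)
  rw [Real.rpow_neg (by positivity), Real.rpow_natCast]

theorem lintegral_scaled (z : EuclideanSpace ℝ (Fin d)) {s : ℝ} (hs : 0 < s) :
    ∫⁻ x, ENNReal.ofReal (((1 + ‖x - z‖ / s) ^ (d + 1))⁻¹) =
      ENNReal.ofReal (s ^ d) * kerMass d := by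
  rw [lintegral_sub_right_eq_self (fun x : EuclideanSpace ℝ (Fin d) =>
    ENNReal.ofReal (((1 + ‖x‖ / s) ^ (d + 1))⁻¹)) z]
  have h1 : ∀ x : EuclideanSpace ℝ (Fin d), ‖x‖ / s = ‖s⁻¹ • x‖ := fun x => by
    rw [norm_smul, Real.norm_of_nonneg (by positivity)]; ring
  simp only [h1]
  have h2 : Measurable fun x : EuclideanSpace ℝ (Fin d) =>
      ENNReal.ofReal (((1 + ‖x‖) ^ (d + 1))⁻¹) := by fun_prop
  rw [← lintegral_map (f := fun x : EuclideanSpace ℝ (Fin d) =>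
    ENNReal.ofReal (((1 + ‖x‖) ^ (d + 1))⁻¹)) (g := fun x => s⁻¹ • x) h2
    (measurable_const_smul _), Measure.map_addHaar_smul _ (by positivity),
    lintegral_smul_measure]
  simp [kerMass, abs_of_pos hs]

theorem lintegral_ker (I : DyadicCube d) :
    ∫⁻ x, I.ker (d + 1) x = volume I.toSet * kerMass d := by
  unfold ker rho
  rw [lintegral_scaled _ I.side_pos, volume_eq]

/-- The dyadic cubes of side length `2^k`. -/
def level (k : ℤ) : Set (DyadicCube d) := {I | I.k = k}

theorem level_pairwiseDisjoint (k : ℤ) : (level k : Set (DyadicCube d)).PairwiseDisjoint toSet :=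
  fun _ hI _ hJ hne => disjoint_of_ne_of_k hne (hI.trans (Eq.symm hJ))

theorem tsum_level_lintegral (k : ℤ) (f : EuclideanSpace ℝ (Fin d) → ℝ≥0∞) :
    ∑' I : (level k : Set (DyadicCube d)), ∫⁻ x in I.1.toSet, f x = ∫⁻ x, f x := by
  rw [← lintegral_iUnion (fun I : (level k : Set (DyadicCube d)) => I.1.measurableSet)]
  · have : (⋃ I : (level k : Set (DyadicCube d)), I.1.toSet) = Set.univ := by
      refine Set.eq_univ_of_forall fun x => Set.mem_iUnion.2 ⟨⟨cubeAt k x, rfl⟩, mem_cubeAt k x⟩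
    rw [this, setLIntegral_univ]
  · intro I J hne
    exact level_pairwiseDisjoint k I.2 J.2 (fun h => hne (Subtype.ext h))

theorem tsum_level_le_of_le (k : ℤ) {g : DyadicCube d → ℝ≥0∞}
    {f : EuclideanSpace ℝ (Fin d) → ℝ≥0∞}
    (h : ∀ I : DyadicCube d, I.k = k → ∀ y ∈ I.toSet, g I ≤ f y) :
    ∑' I : (level k : Set (DyadicCube d)), volume I.1.toSet * g I ≤ ∫⁻ x, f x := by
  rw [← tsum_level_lintegral k f]
  refine ENNReal.tsum_le_tsum fun I => ?_
  calc volume I.1.toSet * g I = ∫⁻ _ in I.1.toSet, g I := by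
        rw [setLIntegral_const, mul_comm]
    _ ≤ _ := setLIntegral_mono' I.1.measurableSet fun y hy => h I I.2 y hy

/-- The constant in the sums of `ρ_I^{-(d+1)}` over a level. -/
def kerConst (d : ℕ) : ℝ≥0∞ := ENNReal.ofReal ((1 + d : ℝ) ^ (d + 1)) * kerMass d

theorem kerConst_ne_top (d : ℕ) : kerConst d ≠ ∞ :=
  ENNReal.mul_ne_top ENNReal.ofReal_ne_top (kerMass_ne_top d)

theorem tsum_level_ker_le (k : ℤ) (x : EuclideanSpace ℝ (Fin d)) :
    ∑' I : (level k : Set (DyadicCube d)), I.1.ker (d + 1) x ≤ kerConst d := by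
  have hs : (0 : ℝ) < 2 ^ k := zpow_pos (by norm_num) _
  have h0 : ENNReal.ofReal (((2 : ℝ) ^ k) ^ d) ≠ 0 := by
    simp only [ne_eq, ENNReal.ofReal_eq_zero, not_le]; positivity
  have key := tsum_level_le_of_le k (g := fun I : DyadicCube d => I.ker (d + 1) x)
    (f := fun y => ENNReal.ofReal ((1 + d : ℝ) ^ (d + 1)) *
      ENNReal.ofReal (((1 + ‖y - x‖ / 2 ^ k) ^ (d + 1))⁻¹)) (fun I hI y hy => by
      rw [← ENNReal.ofReal_mul (by positivity)]
      refine ENNReal.ofReal_le_ofReal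
        (inv_pow_le_inv_pow (I.rho_pos x) (by positivity) ?_ _)
      have h1 := I.norm_sub_le hy I.corner_mem
      have hside : I.side = 2 ^ k := by rw [side, hI]
      rw [hside] at h1
      have h2 : ‖y - x‖ ≤ ‖y - I.corner‖ + ‖x - I.corner‖ := by
        have := _root_.norm_sub_le (y - I.corner) (x - I.corner)
        rwa [sub_sub_sub_cancel_right] at this
      unfold rho
      rw [hside]
      have h3 : ‖y - x‖ / 2 ^ k ≤ d + ‖x - I.corner‖ / 2 ^ k := by
        rw [div_le_iff₀ hs, add_mul, div_mul_cancel₀ _ hs.ne']; linarith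
      have h4 : 0 ≤ ‖x - I.corner‖ / 2 ^ k * d := by positivity
      nlinarith)
  rw [lintegral_const_mul' _ _ ENNReal.ofReal_ne_top, lintegral_scaled x hs] at key
  have hv : ∀ I : (level k : Set (DyadicCube d)),
      volume I.1.toSet * I.1.ker (d + 1) x =
        ENNReal.ofReal (((2 : ℝ) ^ k) ^ d) * I.1.ker (d + 1) x := fun I => by
    have : I.1.k = k := I.2
    rw [volume_eq, side, this]
  simp only [hv] at key
  rw [ENNReal.tsum_mul_left, mul_left_comm] at key
  exact (ENNReal.mul_le_mul_iff_right h0 ENNReal.ofReal_ne_top).1 key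

theorem tsum_level_volume_mul_ker_le {Q : DyadicCube d} {k : ℤ} (hk : k ≤ Q.k) :
    ∑' I : (level k : Set (DyadicCube d)), volume I.1.toSet * Q.ker (d + 1) I.1.corner ≤
      kerConst d * volume Q.toSet := by
  refine (tsum_level_le_of_le k (g := fun I : DyadicCube d => Q.ker (d + 1) I.corner)
    (f := fun y => ENNReal.ofReal ((1 + d : ℝ) ^ (d + 1)) * Q.ker (d + 1) y)
    (fun I hI y hy => ?_)).trans_eq ?_
  · refine ker_le_of_norm_le ((I.norm_sub_le I.corner_mem hy).trans ?_) _
    have := side_le_side (hI.trans_le hk : I.k ≤ Q.k)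
    gcongr
  · rw [lintegral_const_mul' _ _ ENNReal.ofReal_ne_top, lintegral_ker, kerConst]
    ring

theorem ker_le_inv_two_pow {I : DyadicCube d} {x : EuclideanSpace ℝ (Fin d)} {i : ℕ}
    (h : 2 ^ i * I.side ≤ ‖x - I.corner‖) (n : ℕ) : I.ker n x ≤ (2⁻¹ : ℝ≥0∞) ^ (i * n) := by
  have h1 : (2 : ℝ) ^ i ≤ I.rho x := by
    have := (le_div_iff₀ I.side_pos).2 h
    unfold rho; linarith
  have h2 : ((I.rho x) ^ n)⁻¹ ≤ ((2 : ℝ)⁻¹) ^ (i * n) := by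
    rw [inv_pow, pow_mul]
    gcongr
  refine (ENNReal.ofReal_le_ofReal h2).trans_eq ?_
  rw [ENNReal.ofReal_pow (by norm_num), ENNReal.ofReal_inv_of_pos (by norm_num)]
  simp

end DyadicCube

end

/-! ### Carleson families and thin families -/

section

open DyadicCube

variable {d : ℕ}

/-- The Carleson packing condition. -/
def IsCarleson (Λ : ℝ≥0∞) (𝓕 : Set (DyadicCube d)) : Prop :=
  ∀ R : DyadicCube d, ∑' Q : {Q | Q ∈ 𝓕 ∧ Q.toSet ⊆ R.toSet}, volume Q.1.toSet ≤
    Λ * volume R.toSet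

/-- The cubes of `𝓕` strictly inside `Q`. -/
def below (𝓕 : Set (DyadicCube d)) (Q : DyadicCube d) : Set (DyadicCube d) :=
  {R | R ∈ 𝓕 ∧ R.toSet ⊆ Q.toSet ∧ R ≠ Q}

/-- The union of the cubes of `𝓕` strictly inside any `Q ∈ 𝓕` has at most a third of its
measure. -/
def IsThin (𝓕 : Set (DyadicCube d)) : Prop :=
  ∀ Q ∈ 𝓕, 3 * volume (⋃ R ∈ below 𝓕 Q, R.toSet) ≤ volume Q.toSet

theorem below_subset (𝓕 : Set (DyadicCube d)) (Q : DyadicCube d) :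
    ⋃ R ∈ below 𝓕 Q, R.toSet ⊆ Q.toSet := Set.iUnion₂_subset fun _ h => h.2.1

theorem measurableSet_biUnion_toSet (𝓔 : Set (DyadicCube d)) :
    MeasurableSet (⋃ R ∈ 𝓔, R.toSet) :=
  MeasurableSet.biUnion (Set.to_countable _) fun R _ => R.measurableSet

theorem k_lt_of_ssubset [NeZero d] {Q R : DyadicCube d} (h : R.toSet ⊆ Q.toSet) (hne : R ≠ Q) :
    R.k < Q.k :=
  lt_of_le_of_ne (k_le_of_subset h) fun hk => hne (eq_of_subset_of_k h hk)

theorem IsThin.isSparse {𝓕 : Set (DyadicCube d)} (h : IsThin 𝓕) : IsSparse 𝓕 := by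
  refine ⟨fun Q => Q.toSet \ ⋃ R ∈ below 𝓕 Q, R.toSet, fun Q hQ => ⟨?_, Set.sdiff_subset, ?_⟩, ?_⟩
  · exact Q.measurableSet.diff (measurableSet_biUnion_toSet _)
  · set u := volume (⋃ R ∈ below 𝓕 Q, R.toSet)
    have h1 : 3 * u ≤ volume Q.toSet := h Q hQ
    have h2 : volume Q.toSet ≤ volume (Q.toSet \ ⋃ R ∈ below 𝓕 Q, R.toSet) + u :=
      (measure_mono (by rw [Set.sdiff_union_self]; exact Set.subset_union_left)).trans
        (measure_union_le _ _)
    have hv0 := Q.volume_ne_zero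
    have hv := Q.volume_ne_top
    have hu : u ≠ ∞ := ne_top_of_le_ne_top hv (measure_mono (below_subset 𝓕 Q))
    have he : volume (Q.toSet \ ⋃ R ∈ below 𝓕 Q, R.toSet) ≠ ∞ :=
      ne_top_of_le_ne_top hv (measure_mono Set.sdiff_subset)
    lift volume (Q.toSet \ ⋃ R ∈ below 𝓕 Q, R.toSet) to ℝ≥0 using he with e
    lift u to ℝ≥0 using hu with u'
    lift volume Q.toSet to ℝ≥0 using hv with v
    norm_cast at *
    have hv0' : 0 < v := pos_iff_ne_zero.2 hv0
    have h1' : 3 * (u' : ℝ) ≤ v := by exact_mod_cast h1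
    have h2' : (v : ℝ) ≤ e + u' := by exact_mod_cast h2
    have h3' : (0 : ℝ) < v := by exact_mod_cast hv0'
    have : (v : ℝ) < 2 * e := by linarith
    exact_mod_cast this
  · intro Q hQ R hR hne
    refine Set.disjoint_left.2 fun x hx hy => ?_
    rcases le_total Q.k R.k with hk | hk
    · exact hy.2 (Set.mem_biUnion ⟨hQ, subset_of_mem hx.1 hy.1 hk, hne⟩ hx.1)
    · exact hx.2 (Set.mem_biUnion ⟨hR, subset_of_mem hy.1 hx.1 hk, hne.symm⟩ hy.1)

/-- The dyadic cubes that touch the origin. -/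
def originCubes : Set (DyadicCube d) := {Q | ∀ i, Q.m i = 0 ∨ Q.m i = -1}

theorem up_m_of_mem_originCubes {Q : DyadicCube d} (hQ : Q ∈ originCubes) {k : ℤ} (hk : Q.k ≤ k)
    (i : Fin d) : (Q.up k).m i = Q.m i := by
  rw [up_m _ hk]
  have hp : (0 : ℤ) < (2 ^ (k - Q.k).toNat : ℕ) := by positivity
  rcases hQ i with h | h <;> rw [h]
  · simp
  · rw [Int.neg_one_ediv, Int.sign_eq_one_of_pos hp]

theorem up_mem_originCubes {Q : DyadicCube d} (hQ : Q ∈ originCubes) {k : ℤ} (hk : Q.k ≤ k) :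
    Q.up k ∈ originCubes := fun i => by
  rw [up_m_of_mem_originCubes hQ hk]; exact hQ i

theorem exists_up_mem_originCubes (Q : DyadicCube d) :
    ∃ K : ℤ, ∀ k, K ≤ k → Q.up k ∈ originCubes := by
  obtain ⟨n, hn⟩ := pow_unbounded_of_one_lt ‖Q.corner‖ (by norm_num : (1 : ℝ) < 2)
  refine ⟨n, fun k hk i => ?_⟩
  have hs : (0 : ℝ) < 2 ^ k := zpow_pos (by norm_num) _
  have h1 : |Q.corner i| < 2 ^ k := by
    refine ((PiLp.norm_apply_le Q.corner i).trans_lt hn).trans_le ?_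
    rw [← zpow_natCast]
    exact zpow_le_zpow_right₀ (by norm_num) hk
  obtain ⟨h2, h3⟩ := abs_lt.1 h1
  have h4 : ⌊Q.corner i / (2 : ℝ) ^ k⌋ < 1 := by
    rw [Int.floor_lt]; rw [div_lt_iff₀ hs]; simpa using h3
  have h5 : -1 ≤ ⌊Q.corner i / (2 : ℝ) ^ k⌋ := by
    rw [Int.le_floor, le_div_iff₀ hs]; push_cast; linarith
  simp only [up, cubeAt]
  omega

theorem up_injOn [NeZero d] (Q : DyadicCube d) : Function.Injective (fun k => Q.up k) :=
  fun _ _ h => congrArg DyadicCube.k h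

theorem isThin_originCubes_class [NeZero d] (a : Fin 2) :
    IsThin {Q : DyadicCube d | Q ∈ originCubes ∧ Q.k % 2 = (a : ℕ)} := by
  rintro Q ⟨hQ, hQa⟩
  let P : DyadicCube d := ⟨Q.k - 2, Q.m⟩
  have hsub : ⋃ R ∈ below {Q : DyadicCube d | Q ∈ originCubes ∧ Q.k % 2 = (a : ℕ)} Q,
      R.toSet ⊆ P.toSet := by
    refine Set.iUnion₂_subset fun R hR => ?_
    obtain ⟨⟨hR0, hRa⟩, hRQ, hne⟩ := hR
    have hk := k_lt_of_ssubset hRQ hne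
    have hk2 : R.k ≤ Q.k - 2 := by omega
    refine subset_iff.2 ⟨hk2, ext_km rfl fun i => ?_⟩
    change (R.up (Q.k - 2)).m i = Q.m i
    rw [up_m_of_mem_originCubes hR0 hk2, ← (subset_iff.1 hRQ).2,
      up_m_of_mem_originCubes hR0 hk.le]
  refine (mul_le_mul_right (measure_mono hsub) 3).trans ?_
  have h1 : Q.side = 4 * P.side := by
    simp only [side, P]
    rw [zpow_sub₀ (by norm_num)]; norm_num; ring
  rw [volume_eq, volume_eq, h1, mul_pow, ENNReal.ofReal_mul (by positivity)]
  refine mul_le_mul_left ?_ _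
  rw [← ENNReal.ofReal_ofNat]
  refine ENNReal.ofReal_le_ofReal ?_
  calc (3 : ℝ) ≤ 4 ^ 1 := by norm_num
    _ ≤ 4 ^ d := pow_le_pow_right₀ (by norm_num) (Nat.one_le_iff_ne_zero.2 (NeZero.ne d))

/-- The side lengths of the members of `𝓕` strictly above `Q`. -/
def above (𝓕 : Set (DyadicCube d)) (Q : DyadicCube d) : Set ℤ := {k | Q.k < k ∧ Q.up k ∈ 𝓕}

theorem above_finite {𝓕 : Set (DyadicCube d)} (h : ∀ Q ∈ 𝓕, Q ∉ originCubes)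
    (Q : DyadicCube d) : (above 𝓕 Q).Finite := by
  obtain ⟨K, hK⟩ := exists_up_mem_originCubes Q
  refine (Set.finite_Ioo Q.k K).subset fun k hk => ⟨hk.1, ?_⟩
  by_contra! hn
  exact h _ hk.2 (hK k hn)

theorem above_union_subset [NeZero d] {𝓕 : Set (DyadicCube d)} {Q R : DyadicCube d}
    (hR : R ∈ below 𝓕 Q) (hQ : Q ∈ 𝓕) : insert Q.k (above 𝓕 Q) ⊆ above 𝓕 R := by
  have hk := k_lt_of_ssubset hR.2.1 hR.2.2
  have hup := (subset_iff.1 hR.2.1).2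
  rintro k (rfl | hk')
  · exact ⟨hk, by rw [hup]; exact hQ⟩
  · refine ⟨hk.trans hk'.1, ?_⟩
    rw [← up_up R hk.le hk'.1.le, hup]; exact hk'.2

theorem isThin_generation_class [NeZero d] {Λ : ℝ≥0∞} {𝓕 : Set (DyadicCube d)}
    (hΛ : IsCarleson Λ 𝓕) (h0 : ∀ Q ∈ 𝓕, Q ∉ originCubes) {K : ℕ} (hK : 3 * Λ ≤ K) (a : ℕ) :
    IsThin {Q | Q ∈ 𝓕 ∧ (above 𝓕 Q).ncard % K = a} := by
  rintro Q ⟨hQ, hQa⟩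
  set U := ⋃ R ∈ below {Q | Q ∈ 𝓕 ∧ (above 𝓕 Q).ncard % K = a} Q, R.toSet
  let N : EuclideanSpace ℝ (Fin d) → ℝ≥0∞ := fun x =>
    ∑' R : {R | R ∈ 𝓕 ∧ R.toSet ⊆ Q.toSet}, R.1.toSet.indicator 1 x
  have hN : ∀ x ∈ U, (K : ℝ≥0∞) ≤ N x := by
    intro x hx
    obtain ⟨R, hR, hxR⟩ := Set.mem_iUnion₂.1 hx
    have hRb : R ∈ below 𝓕 Q := ⟨hR.1.1, hR.2⟩
    have hsub := above_union_subset hRb hQ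
    have hk := k_lt_of_ssubset hR.2.1 hR.2.2
    have hup := (subset_iff.1 hR.2.1).2
    have hnot : Q.k ∉ above 𝓕 Q := fun h => lt_irrefl _ h.1
    have hfinR := above_finite h0 R
    have hcard : (above 𝓕 Q).ncard + K ≤ (above 𝓕 R).ncard := by
      have h1 := Set.ncard_le_ncard hsub hfinR
      rw [Set.ncard_insert_of_notMem hnot (above_finite h0 Q)] at h1
      have h2 : (above 𝓕 R).ncard % K = (above 𝓕 Q).ncard % K := hR.1.2.trans hQa.symm
      obtain ⟨c, hc⟩ := (Nat.modEq_iff_dvd' (by omega)).1 (show _ ≡ _ [MOD K] from h2.symm)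
      have : c ≠ 0 := by rintro rfl; omega
      have : K ≤ K * c := Nat.le_mul_of_pos_right K (Nat.pos_of_ne_zero this)
      omega
    have hfin : (above 𝓕 R \ above 𝓕 Q).Finite := hfinR.subset Set.sdiff_subset
    have hcard2 : K ≤ hfin.toFinset.card := by
      rw [← Set.ncard_eq_toFinset_card _ hfin, Set.ncard_sdiff
        ((Set.subset_insert _ _).trans hsub) (above_finite h0 Q)]
      omega
    have hmem : ∀ k ∈ hfin.toFinset, R.up k ∈ {R | R ∈ 𝓕 ∧ R.toSet ⊆ Q.toSet} ∧
        x ∈ (R.up k).toSet := by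
      intro k hk'
      obtain ⟨⟨h1, h2⟩, h3⟩ := hfin.mem_toFinset.1 hk'
      have hkQ : k ≤ Q.k := by
        by_contra! hlt
        refine h3 ⟨hlt, ?_⟩
        rw [← hup, up_up R hk.le hlt.le]; exact h2
      refine ⟨⟨h2, subset_iff.2 ⟨hkQ, ?_⟩⟩, R.subset_up h1.le hxR⟩
      rw [up_up R h1.le hkQ, hup]
    calc (K : ℝ≥0∞) ≤ hfin.toFinset.card := by exact_mod_cast hcard2
      _ = ∑ k ∈ hfin.toFinset, 1 := by simp
      _ ≤ ∑ k ∈ hfin.toFinset, ({R | R ∈ 𝓕 ∧ R.toSet ⊆ Q.toSet} : Set _).indicator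
            (fun R => R.toSet.indicator 1 x) (R.up k) := by
          refine Finset.sum_le_sum fun k hk' => ?_
          rw [Set.indicator_of_mem (hmem k hk').1, Set.indicator_of_mem (hmem k hk').2]
          rfl
      _ = ∑ P ∈ hfin.toFinset.map ⟨_, up_injOn R⟩,
            ({R | R ∈ 𝓕 ∧ R.toSet ⊆ Q.toSet} : Set _).indicator
              (fun R => R.toSet.indicator 1 x) P := by rw [Finset.sum_map]; rfl
      _ ≤ ∑' P, ({R | R ∈ 𝓕 ∧ R.toSet ⊆ Q.toSet} : Set _).indicator
              (fun R => R.toSet.indicator 1 x) P := ENNReal.sum_le_tsum _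
      _ = N x := by rw [← tsum_subtype]
  have hint : ∫⁻ x, N x ≤ Λ * volume Q.toSet := by
    refine le_trans (le_of_eq ?_) (hΛ Q)
    rw [lintegral_tsum fun R => (measurable_one.indicator R.1.measurableSet).aemeasurable]
    refine tsum_congr fun R => ?_
    rw [lintegral_indicator_one R.1.measurableSet]
  have hKU : K * volume U ≤ Λ * volume Q.toSet := by
    refine le_trans ?_ hint
    calc (K : ℝ≥0∞) * volume U = ∫⁻ x in U, K := by rw [setLIntegral_const]
      _ ≤ ∫⁻ x in U, N x := setLIntegral_mono' (measurableSet_biUnion_toSet _) hN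
      _ ≤ _ := setLIntegral_le_lintegral _ _
  by_cases hΛ0 : Λ = 0
  · have h := hΛ Q
    rw [hΛ0, zero_mul, nonpos_iff_eq_zero, ENNReal.tsum_eq_zero] at h
    exact absurd (h ⟨Q, hQ, subset_rfl⟩) Q.volume_ne_zero
  have hΛt : Λ ≠ ∞ := by
    rintro rfl
    simp at hK
  refine (ENNReal.mul_le_mul_iff_right hΛ0 hΛt).1 ?_
  calc Λ * (3 * volume U) = (3 * Λ) * volume U := by ring
    _ ≤ K * volume U := mul_le_mul_left hK _
    _ ≤ _ := hKU

/-- A Carleson family is a union of boundedly many thin families. -/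
theorem exists_thin_cover [NeZero d] {Λ : ℝ≥0∞} (hΛ : Λ ≠ ∞) :
    ∃ K : ℕ, ∀ 𝓕 : Set (DyadicCube d), IsCarleson Λ 𝓕 →
      ∃ G : Fin K ⊕ Fin 2 → Set (DyadicCube d), (∀ i, IsThin (G i)) ∧ (∀ i, G i ⊆ 𝓕) ∧
        ∀ Q ∈ 𝓕, ∃ i, Q ∈ G i := by
  obtain ⟨K, hK⟩ := ENNReal.exists_nat_gt (r := 3 * Λ) (ENNReal.mul_ne_top (by norm_num) hΛ)
  have hK0 : 0 < K := by
    rw [pos_iff_ne_zero]; rintro rfl; simp at hK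
  refine ⟨K, fun 𝓕 h => ⟨Sum.elim
    (fun a => {Q | Q ∈ {Q | Q ∈ 𝓕 ∧ Q ∉ originCubes} ∧
      (above {Q | Q ∈ 𝓕 ∧ Q ∉ originCubes} Q).ncard % K = a})
    (fun a => {Q | Q ∈ 𝓕 ∧ Q ∈ originCubes ∧ Q.k % 2 = (a : ℕ)}), ?_, ?_, ?_⟩⟩
  · rintro (a | a)
    · refine isThin_generation_class (Λ := Λ) (fun R => le_trans ?_ (h R)) (fun Q hQ => hQ.2) hK.le _
      exact ENNReal.tsum_mono_subtype (fun Q : DyadicCube d => volume Q.toSet)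
        (fun Q hQ => ⟨hQ.1.1, hQ.2⟩)
    · intro Q hQ
      refine le_trans (mul_le_mul_right (measure_mono ?_) 3) (isThin_originCubes_class a Q hQ.2)
      exact Set.biUnion_subset_biUnion_left fun R hR => ⟨hR.1.2, hR.2⟩
  · rintro (a | a) Q hQ
    · exact hQ.1.1
    · exact hQ.1
  · intro Q hQ
    by_cases h0 : Q ∈ originCubes
    · refine ⟨Sum.inr ⟨(Q.k % 2).toNat, by omega⟩, hQ, h0, ?_⟩
      simp only; omega
    · exact ⟨Sum.inl ⟨_, Nat.mod_lt _ hK0⟩, ⟨hQ, h0⟩, rfl⟩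

end

/-! ### Weighted bounds for sparse sums -/

section

open DyadicCube

variable {d : ℕ}

/-- The points of `Q` that lie below a chain of `j` cubes of `𝓕` strictly inside `Q`. -/
def chainSet (𝓕 : Set (DyadicCube d)) : ℕ → DyadicCube d → Set (EuclideanSpace ℝ (Fin d))
  | 0, Q => Q.toSet
  | j + 1, Q => ⋃ R ∈ below 𝓕 Q, chainSet 𝓕 j R

theorem chainSet_subset (𝓕 : Set (DyadicCube d)) (j : ℕ) (Q : DyadicCube d) :
    chainSet 𝓕 j Q ⊆ Q.toSet := by
  induction j generalizing Q with
  | zero => exact subset_rfl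
  | succ j ih => exact Set.iUnion₂_subset fun R hR => (ih R).trans hR.2.1

theorem measurableSet_chainSet (𝓕 : Set (DyadicCube d)) (j : ℕ) (Q : DyadicCube d) :
    MeasurableSet (chainSet 𝓕 j Q) := by
  induction j generalizing Q with
  | zero => exact Q.measurableSet
  | succ j ih => exact MeasurableSet.biUnion (Set.to_countable _) fun R _ => ih R

theorem below_mono [NeZero d] {𝓕 : Set (DyadicCube d)} {Q R : DyadicCube d}
    (h : Q.toSet ⊆ R.toSet) : below 𝓕 Q ⊆ below 𝓕 R := by
  rintro P ⟨h1, h2, h3⟩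
  refine ⟨h1, h2.trans h, ?_⟩
  rintro rfl
  exact h3 (toSet_injective (h2.antisymm h))

theorem chainSet_mono [NeZero d] {𝓕 : Set (DyadicCube d)} (j : ℕ) {Q R : DyadicCube d}
    (h : Q.toSet ⊆ R.toSet) : chainSet 𝓕 j Q ⊆ chainSet 𝓕 j R := by
  cases j with
  | zero => exact h
  | succ j => exact Set.biUnion_subset_biUnion_left (below_mono h)

theorem IsThin.volume_chainSet_le [NeZero d] {𝓕 : Set (DyadicCube d)} (h : IsThin 𝓕) (j : ℕ)
    {Q : DyadicCube d} (hQ : Q ∈ 𝓕) : 3 ^ j * volume (chainSet 𝓕 j Q) ≤ volume Q.toSet := by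
  induction j generalizing Q with
  | zero => simp [chainSet]
  | succ j ih =>
    have hK : ∀ R ∈ below 𝓕 Q, R.k ≤ Q.k := fun R hR => k_le_of_subset hR.2.1
    have hsub : chainSet 𝓕 (j + 1) Q ⊆ ⋃ R ∈ maximals (below 𝓕 Q), chainSet 𝓕 j R := by
      refine Set.iUnion₂_subset fun R hR => ?_
      obtain ⟨R', hR', hsub⟩ := exists_maximals hK hR
      exact (chainSet_mono j hsub).trans (Set.subset_biUnion_of_mem (u := chainSet 𝓕 j) hR')
    calc 3 ^ (j + 1) * volume (chainSet 𝓕 (j + 1) Q)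
        ≤ 3 ^ (j + 1) * ∑' R : maximals (below 𝓕 Q), volume (chainSet 𝓕 j R) := by
          gcongr
          exact (measure_mono hsub).trans (measure_biUnion_le _ (Set.to_countable _) _)
      _ = 3 * ∑' R : maximals (below 𝓕 Q), 3 ^ j * volume (chainSet 𝓕 j R) := by
          rw [ENNReal.tsum_mul_left, pow_succ]; ring
      _ ≤ 3 * ∑' R : maximals (below 𝓕 Q), volume R.1.toSet := by
          gcongr with R
          exact ih R.2.1.1
      _ ≤ 3 * volume (⋃ R ∈ below 𝓕 Q, R.toSet) := by
          gcongr
          exact tsum_volume_le (maximals_pairwiseDisjoint _) fun R hR =>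
            Set.subset_biUnion_of_mem (u := toSet) hR.1
      _ ≤ volume Q.toSet := h Q hQ

theorem sum_le_of_chain [NeZero d] {𝓕 : Set (DyadicCube d)} {x : EuclideanSpace ℝ (Fin d)}
    {c : DyadicCube d → ℝ≥0∞} {M θ : ℝ≥0∞}
    (h : ∀ Q ∈ 𝓕, ∀ j, x ∈ chainSet 𝓕 j Q → c Q ≤ M * θ ^ j) (s : Finset (DyadicCube d))
    (hs : ∀ Q ∈ s, Q ∈ 𝓕 ∧ x ∈ Q.toSet) :
    ∑ Q ∈ s, c Q ≤ M * ∑ j ∈ Finset.range s.card, θ ^ j := by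
  classical
  suffices H : (∀ Q ∈ 𝓕, x ∈ Q.toSet → (∀ R ∈ s, R.k < Q.k) → x ∈ chainSet 𝓕 s.card Q) ∧
      ∑ Q ∈ s, c Q ≤ M * ∑ j ∈ Finset.range s.card, θ ^ j from H.2
  induction s using Finset.induction_on_max_value (fun Q : DyadicCube d => Q.k) with
  | empty => simp [chainSet]
  | insert P s hP hmax ih =>
    obtain ⟨ih1, ih2⟩ := ih fun Q hQ => hs Q (Finset.mem_insert_of_mem hQ)
    obtain ⟨hP1, hP2⟩ := hs P (Finset.mem_insert_self _ _)
    have hlt : ∀ R ∈ s, R.k < P.k := fun R hR => by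
      refine lt_of_le_of_ne (hmax R hR) fun hk => hP ?_
      rw [← eq_of_mem_of_k (hs R (Finset.mem_insert_of_mem hR)).2 hP2 hk]; exact hR
    have hPx := ih1 P hP1 hP2 hlt
    rw [Finset.card_insert_of_notMem hP]
    constructor
    · intro Q hQ hxQ hall
      have hk := hall P (Finset.mem_insert_self _ _)
      refine Set.mem_biUnion (x := P) ⟨hP1, subset_of_mem hP2 hxQ hk.le, ?_⟩ hPx
      rintro rfl; exact lt_irrefl _ hk
    · rw [Finset.sum_insert hP, Finset.sum_range_succ, mul_add, add_comm]
      exact add_le_add ih2 (h P hP1 _ hPx)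

/-- Average of the weight on `Q`, multiplied by the measure of `Q`. -/
def weightOn (r : ℝ) (w : EuclideanSpace ℝ (Fin d) → ℝ≥0∞) (Q : DyadicCube d) : ℝ≥0∞ :=
  ((∫⁻ x in Q.toSet, w x ^ r) / volume Q.toSet) ^ (1 / r) * volume Q.toSet

/-- The function `∑_{Q ∈ 𝓕} c_Q 1_Q`. -/
def sparseSum (𝓕 : Set (DyadicCube d)) (c : DyadicCube d → ℝ≥0∞)
    (x : EuclideanSpace ℝ (Fin d)) : ℝ≥0∞ :=
  ∑' Q : 𝓕, Q.1.toSet.indicator (fun _ => c Q) x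

theorem measurable_sparseSum (𝓕 : Set (DyadicCube d)) (c : DyadicCube d → ℝ≥0∞) :
    Measurable (sparseSum 𝓕 c) :=
  Measurable.tsum fun Q => measurable_const.indicator Q.1.measurableSet

theorem le_rpow_one_div_iff {a b : ℝ≥0∞} {p : ℝ} (hp : 0 < p) : a ≤ b ^ (1 / p) ↔ a ^ p ≤ b := by
  rw [one_div, ENNReal.le_rpow_inv_iff hp]

theorem tsum_rpow_le {ι : Type*} (a : ι → ℝ≥0∞) {p : ℝ} (hp : 0 < p) (hp1 : p ≤ 1) :
    (∑' i, a i) ^ p ≤ ∑' i, a i ^ p := by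
  have hfin : ∀ s : Finset ι, (∑ i ∈ s, a i) ^ p ≤ ∑ i ∈ s, a i ^ p := by
    classical
    intro s
    induction s using Finset.induction_on with
    | empty => simp [hp]
    | insert i s hi ih =>
      rw [Finset.sum_insert hi, Finset.sum_insert hi]
      exact (ENNReal.rpow_add_le_add_rpow _ _ hp.le hp1).trans (by gcongr)
  have h1 : ∑' i, a i ≤ (∑' i, a i ^ p) ^ (1 / p) := by
    rw [ENNReal.tsum_eq_iSup_sum]
    refine iSup_le fun s => ?_
    rw [le_rpow_one_div_iff hp]
    exact (hfin s).trans (ENNReal.sum_le_tsum s)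
  exact (le_rpow_one_div_iff hp).1 h1

theorem sum_rpow_le_card {ι : Type*} (s : Finset ι) (a : ι → ℝ≥0∞) {p : ℝ} (hp : 0 < p) :
    (∑ i ∈ s, a i) ^ p ≤ (s.card : ℝ≥0∞) ^ p * ∑ i ∈ s, a i ^ p := by
  rcases s.eq_empty_or_nonempty with rfl | hs
  · simp [hp]
  obtain ⟨i, hi, hmax⟩ := s.exists_max_image a hs
  calc (∑ i ∈ s, a i) ^ p ≤ (s.card * a i) ^ p := by
        gcongr
        simpa using Finset.sum_le_card_nsmul s a _ hmax
    _ = (s.card : ℝ≥0∞) ^ p * a i ^ p := ENNReal.mul_rpow_of_nonneg _ _ hp.le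
    _ ≤ _ := by
        gcongr
        exact Finset.single_le_sum (f := fun i => a i ^ p) (fun _ _ => zero_le) hi

theorem lintegral_sparseSum_rpow_le_of_le_one (𝓕 : Set (DyadicCube d)) (c : DyadicCube d → ℝ≥0∞)
    {p : ℝ} (hp : 0 < p) (hp1 : p ≤ 1) {w : EuclideanSpace ℝ (Fin d) → ℝ≥0∞}
    (hw : AEMeasurable w) :
    ∫⁻ x, sparseSum 𝓕 c x ^ p * w x ≤ ∑' Q : 𝓕, c Q ^ p * weightOn 1 w Q := by
  have h1 : ∀ x, sparseSum 𝓕 c x ^ p * w x ≤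
      ∑' Q : 𝓕, c Q ^ p * Q.1.toSet.indicator w x := fun x => by
    refine (mul_le_mul_left (tsum_rpow_le _ hp hp1) _).trans ?_
    rw [← ENNReal.tsum_mul_right]
    refine ENNReal.tsum_le_tsum fun Q => ?_
    by_cases hx : x ∈ Q.1.toSet
    · simp [hx]
    · simp [hx, hp]
  refine (lintegral_mono h1).trans ?_
  rw [lintegral_tsum fun Q => (hw.indicator Q.1.measurableSet).const_mul _]
  refine ENNReal.tsum_le_tsum fun Q => ?_
  rw [lintegral_const_mul'' _ (hw.indicator Q.1.measurableSet), lintegral_indicator Q.1.measurableSet]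
  gcongr
  simp only [weightOn, ENNReal.rpow_one, div_one]
  rw [ENNReal.div_mul_cancel Q.1.volume_ne_zero Q.1.volume_ne_top]

theorem sparseSum_rpow_le [NeZero d] (𝓕 : Set (DyadicCube d)) (c : DyadicCube d → ℝ≥0∞) {p : ℝ}
    (hp : 0 < p) {τ : ℝ≥0∞} (hτ0 : τ ≠ 0) (hτ : τ ≠ ∞) (x : EuclideanSpace ℝ (Fin d)) :
    sparseSum 𝓕 c x ^ p ≤ ((1 - τ⁻¹ ^ (1 / p))⁻¹) ^ p *
      ∑' Q : 𝓕, ∑' j, (chainSet 𝓕 j Q).indicator (fun _ => c Q ^ p * τ ^ j) x := by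
  classical
  set Y := ∑' Q : 𝓕, ∑' j, (chainSet 𝓕 j Q).indicator (fun _ => c Q ^ p * τ ^ j) x
  set θ := τ⁻¹ ^ (1 / p) with hθ
  have hY : ∀ Q ∈ 𝓕, ∀ j, x ∈ chainSet 𝓕 j Q → c Q ≤ Y ^ (1 / p) * θ ^ j := by
    intro Q hQ j hj
    have h1 : c Q ^ p * τ ^ j ≤ Y := by
      refine le_trans ?_ (ENNReal.le_tsum (⟨Q, hQ⟩ : 𝓕))
      refine le_trans ?_ (ENNReal.le_tsum j)
      rw [Set.indicator_of_mem hj]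
    have h2 : c Q ^ p ≤ Y * τ⁻¹ ^ j := by
      rw [← ENNReal.inv_pow, ← div_eq_mul_inv,
        ENNReal.le_div_iff_mul_le (Or.inl (pow_ne_zero _ hτ0)) (Or.inl (ENNReal.pow_ne_top hτ))]
      exact h1
    calc c Q ≤ (Y * τ⁻¹ ^ j) ^ (1 / p) := (le_rpow_one_div_iff hp).2 h2
      _ = Y ^ (1 / p) * θ ^ j := by
        rw [ENNReal.mul_rpow_of_nonneg _ _ (by positivity), hθ, ← ENNReal.rpow_natCast,
          ← ENNReal.rpow_natCast, ← ENNReal.rpow_mul, ← ENNReal.rpow_mul, mul_comm (j : ℝ)]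
  have hsum : sparseSum 𝓕 c x ≤ Y ^ (1 / p) * (1 - θ)⁻¹ := by
    unfold sparseSum
    rw [tsum_subtype 𝓕 (fun Q : DyadicCube d => Q.toSet.indicator (fun _ => c Q) x),
      ENNReal.tsum_eq_iSup_sum]
    refine iSup_le fun s => ?_
    have h1 : ∑ Q ∈ s, 𝓕.indicator (fun Q : DyadicCube d => Q.toSet.indicator (fun _ => c Q) x) Q =
        ∑ Q ∈ s.filter (fun Q => Q ∈ 𝓕 ∧ x ∈ Q.toSet), c Q := by
      rw [Finset.sum_filter]
      refine Finset.sum_congr rfl fun Q _ => ?_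
      by_cases h1 : Q ∈ 𝓕 <;> by_cases h2 : x ∈ Q.toSet <;> simp [h1, h2]
    rw [h1]
    refine (sum_le_of_chain hY _ fun Q hQ => (Finset.mem_filter.1 hQ).2).trans ?_
    gcongr
    rw [← ENNReal.tsum_geometric]
    exact ENNReal.sum_le_tsum _
  calc sparseSum 𝓕 c x ^ p ≤ (Y ^ (1 / p) * (1 - θ)⁻¹) ^ p := by gcongr
    _ = _ := by
      rw [ENNReal.mul_rpow_of_nonneg _ _ hp.le, ← ENNReal.rpow_mul, one_div_mul_cancel hp.ne',
        ENNReal.rpow_one, mul_comm]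

theorem setLIntegral_le_weightOn {r : ℝ} (hr : 1 < r) {w : EuclideanSpace ℝ (Fin d) → ℝ≥0∞}
    (hw : AEMeasurable w) {Q : DyadicCube d} {V : Set (EuclideanSpace ℝ (Fin d))}
    (hV : MeasurableSet V) (hVQ : V ⊆ Q.toSet) {t : ℝ≥0∞}
    (ht : volume V ≤ t * volume Q.toSet) :
    ∫⁻ x in V, w x ≤ t ^ (1 - 1 / r) * weightOn r w Q := by
  have hr0 : 0 < r := one_pos.trans hr
  have hc : r.HolderConjugate (Real.conjExponent r) := Real.HolderConjugate.conjExponent hr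
  have hconj : 1 / Real.conjExponent r = 1 - 1 / r := by
    have := hc.inv_add_inv_eq_one
    rw [one_div, one_div]; linarith
  have hpos : 0 ≤ 1 - 1 / r := by
    rw [← hconj]; exact one_div_nonneg.2 hc.symm.nonneg
  have h0 : ∫⁻ x in V, w x = ∫⁻ x in Q.toSet, w x * V.indicator (fun _ => 1) x := by
    rw [← lintegral_indicator hV, ← lintegral_indicator Q.measurableSet]
    refine lintegral_congr fun x => ?_
    by_cases hx : x ∈ V
    · simp [hx, hVQ hx]
    · by_cases hxQ : x ∈ Q.toSet <;> simp [hx, hxQ]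
  have h1 := ENNReal.lintegral_mul_le_Lp_mul_Lq (volume.restrict Q.toSet) hc
    hw.restrict (measurable_const.indicator hV).aemeasurable (g := V.indicator fun _ => 1)
  have h2 : ∫⁻ x in Q.toSet, V.indicator (fun _ => (1 : ℝ≥0∞)) x ^ Real.conjExponent r ≤ volume V := by
    refine (setLIntegral_le_lintegral _ _).trans ?_
    rw [← lintegral_indicator_one hV]
    refine lintegral_mono fun x => ?_
    by_cases hx : x ∈ V
    · simp [hx]
    · simp [hx, hc.symm.pos]
  have hv0 := Q.volume_ne_zero
  have hvt := Q.volume_ne_top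
  rw [h0]
  refine h1.trans ?_
  rw [hconj]
  calc (∫⁻ x in Q.toSet, w x ^ r) ^ (1 / r) *
        (∫⁻ x in Q.toSet, V.indicator (fun _ => (1 : ℝ≥0∞)) x ^ Real.conjExponent r) ^ (1 - 1 / r)
      ≤ (∫⁻ x in Q.toSet, w x ^ r) ^ (1 / r) * (t * volume Q.toSet) ^ (1 - 1 / r) := by
        gcongr
        exact h2.trans ht
    _ = t ^ (1 - 1 / r) * weightOn r w Q := by
        unfold weightOn
        rw [ENNReal.mul_rpow_of_nonneg _ _ hpos, ENNReal.div_rpow_of_nonneg _ _ (by positivity),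
          sub_eq_add_neg, ENNReal.rpow_add _ _ hv0 hvt, ENNReal.rpow_one, ENNReal.rpow_neg,
          ENNReal.div_eq_inv_mul]
        ring

/-- The constant in the weighted bound for sparse sums over thin families. -/
theorem exists_lintegral_sparseSum_rpow_le_of_thin [NeZero d] {p r : ℝ} (hp : 0 < p) (hr : 1 < r) :
    ∃ C : ℝ≥0∞, C ≠ ∞ ∧ ∀ (𝓕 : Set (DyadicCube d)), IsThin 𝓕 → ∀ (c : DyadicCube d → ℝ≥0∞)
      (w : EuclideanSpace ℝ (Fin d) → ℝ≥0∞), AEMeasurable w →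
      ∫⁻ x, sparseSum 𝓕 c x ^ p * w x ≤ C * ∑' Q : 𝓕, c Q ^ p * weightOn r w Q := by
  have hr0 : 0 < r := one_pos.trans hr
  set s : ℝ := (1 - 1 / r) / 2 with hs
  have hs0 : 0 < s := by
    have : 1 / r < 1 := by rw [div_lt_one hr0]; exact hr
    rw [hs]; linarith
  set τ : ℝ≥0∞ := 3 ^ s with hτ
  have hτ0 : τ ≠ 0 := by simp [hτ]
  have hτt : τ ≠ ∞ := ENNReal.rpow_ne_top_of_nonneg hs0.le (by norm_num)
  have hτ1 : 1 < τ := ENNReal.one_lt_rpow (by norm_num) hs0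
  have hτi : τ⁻¹ < 1 := ENNReal.inv_lt_one.2 hτ1
  have hθ : τ⁻¹ ^ (1 / p) < 1 := ENNReal.rpow_lt_one hτi (by positivity)
  refine ⟨((1 - τ⁻¹ ^ (1 / p))⁻¹) ^ p * (1 - τ⁻¹)⁻¹, ?_, fun 𝓕 hF c w hw => ?_⟩
  · refine ENNReal.mul_ne_top (ENNReal.rpow_ne_top_of_nonneg hp.le ?_) ?_
    · exact ENNReal.inv_ne_top.2 (tsub_pos_of_lt hθ).ne'
    · exact ENNReal.inv_ne_top.2 (tsub_pos_of_lt hτi).ne'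
  have hCt : ((1 - τ⁻¹ ^ (1 / p))⁻¹) ^ p ≠ ∞ := ENNReal.rpow_ne_top_of_nonneg hp.le
    (ENNReal.inv_ne_top.2 (tsub_pos_of_lt hθ).ne')
  have hmeas : ∀ (Q : 𝓕) (j : ℕ), AEMeasurable
      (fun x => c Q ^ p * τ ^ j * (chainSet 𝓕 j Q.1).indicator w x) := fun Q j =>
    (hw.indicator (measurableSet_chainSet 𝓕 j Q)).const_mul _
  have h1 : ∀ x, sparseSum 𝓕 c x ^ p * w x ≤ ((1 - τ⁻¹ ^ (1 / p))⁻¹) ^ p *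
      ∑' Q : 𝓕, ∑' j, c Q ^ p * τ ^ j * (chainSet 𝓕 j Q.1).indicator w x := fun x => by
    refine (mul_le_mul_left (sparseSum_rpow_le 𝓕 c hp hτ0 hτt x) _).trans_eq ?_
    rw [mul_assoc, ← ENNReal.tsum_mul_right]
    congr 1
    refine tsum_congr fun Q => ?_
    rw [← ENNReal.tsum_mul_right]
    refine tsum_congr fun j => ?_
    by_cases hx : x ∈ chainSet 𝓕 j Q.1 <;> simp [hx]
  refine (lintegral_mono h1).trans ?_
  rw [lintegral_const_mul' _ _ hCt, mul_assoc, ← ENNReal.tsum_mul_left,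
    lintegral_tsum fun Q => AEMeasurable.tsum (hmeas Q)]
  gcongr with Q
  rw [lintegral_tsum (hmeas Q)]
  have h2 : ∀ j, ∫⁻ x, c Q ^ p * τ ^ j * (chainSet 𝓕 j Q.1).indicator w x ≤
      c Q ^ p * weightOn r w Q * τ⁻¹ ^ j := fun j => by
    have hv : volume (chainSet 𝓕 j Q.1) ≤ (3 ^ j)⁻¹ * volume Q.1.toSet := by
      rw [mul_comm, ← div_eq_mul_inv, ENNReal.le_div_iff_mul_le (by simp) (by simp), mul_comm]
      exact hF.volume_chainSet_le j Q.2
    rw [lintegral_const_mul'' _ (hw.indicator (measurableSet_chainSet 𝓕 j Q.1)),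
      lintegral_indicator (measurableSet_chainSet 𝓕 j Q.1)]
    refine (mul_le_mul_right (setLIntegral_le_weightOn hr hw (measurableSet_chainSet 𝓕 j Q.1)
      (chainSet_subset 𝓕 j Q.1) hv) _).trans_eq ?_
    have h3 : ((3 ^ j)⁻¹ : ℝ≥0∞) ^ (1 - 1 / r) = τ⁻¹ ^ j * τ⁻¹ ^ j := by
      rw [← mul_pow, ← ENNReal.mul_inv (Or.inl hτ0) (Or.inl hτt), hτ,
        ← ENNReal.rpow_add _ _ (by norm_num) (by norm_num), ← ENNReal.inv_pow,
        ENNReal.inv_rpow, ← ENNReal.rpow_natCast, ← ENNReal.rpow_natCast, ← ENNReal.rpow_mul,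
        ← ENNReal.rpow_mul]
      congr 2; rw [hs]; ring
    have h4 : τ ^ j * τ⁻¹ ^ j = 1 := by
      rw [← mul_pow, ENNReal.mul_inv_cancel hτ0 hτt, one_pow]
    rw [h3]
    calc _ = c Q ^ p * weightOn r w Q * τ⁻¹ ^ j * (τ ^ j * τ⁻¹ ^ j) := by ring
      _ = _ := by rw [h4, mul_one]
  refine (ENNReal.tsum_le_tsum h2).trans_eq ?_
  rw [ENNReal.tsum_mul_left, ENNReal.tsum_geometric, mul_comm]

theorem exists_lintegral_sparseSum_rpow_le [NeZero d] {p ε : ℝ} (hp : 0 < p)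
    (hε : 0 < ε ∨ (ε = 0 ∧ p ≤ 1)) {Λ : ℝ≥0∞} (hΛ : Λ ≠ ∞) :
    ∃ C : ℝ≥0∞, C ≠ ∞ ∧ ∀ (𝓕 : Set (DyadicCube d)), IsCarleson Λ 𝓕 →
      ∀ (c : DyadicCube d → ℝ≥0∞) (w : EuclideanSpace ℝ (Fin d) → ℝ≥0∞), AEMeasurable w →
      ∫⁻ x, sparseSum 𝓕 c x ^ p * w x ≤ C * ∑' Q : 𝓕, c Q ^ p * weightOn (1 + ε) w Q := by
  rcases hε with hε | ⟨rfl, hp1⟩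
  swap
  · refine ⟨1, by simp, fun 𝓕 _ c w hw => ?_⟩
    rw [one_mul, add_zero]
    exact lintegral_sparseSum_rpow_le_of_le_one 𝓕 c hp hp1 hw
  obtain ⟨K, hK⟩ := exists_thin_cover (d := d) hΛ
  obtain ⟨C, hC, hthin⟩ := exists_lintegral_sparseSum_rpow_le_of_thin (d := d) hp
    (show 1 < 1 + ε by linarith)
  set n : ℝ≥0∞ := ((Finset.univ : Finset (Fin K ⊕ Fin 2)).card : ℝ≥0∞) with hn
  have hnt : n ≠ ∞ := ENNReal.natCast_ne_top _
  refine ⟨n ^ p * (C * n), ENNReal.mul_ne_top (ENNReal.rpow_ne_top_of_nonneg hp.le hnt)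
    (ENNReal.mul_ne_top hC hnt), fun 𝓕 hF c w hw => ?_⟩
  obtain ⟨G, hG, hGF, hcov⟩ := hK 𝓕 hF
  have h1 : ∀ x, sparseSum 𝓕 c x ≤ ∑ i, sparseSum (G i) c x := fun x => by
    unfold sparseSum
    simp only [tsum_subtype (G _) (fun Q : DyadicCube d => Q.toSet.indicator (fun _ => c Q) x),
      tsum_subtype 𝓕 (fun Q : DyadicCube d => Q.toSet.indicator (fun _ => c Q) x)]
    rw [← Summable.tsum_finsetSum fun i _ => ENNReal.summable]
    refine ENNReal.tsum_le_tsum fun Q => ?_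
    by_cases hQ : Q ∈ 𝓕
    · obtain ⟨i, hi⟩ := hcov Q hQ
      refine le_trans ?_ (Finset.single_le_sum (fun _ _ => zero_le) (Finset.mem_univ i))
      rw [Set.indicator_of_mem hQ, Set.indicator_of_mem hi]
    · rw [Set.indicator_of_notMem hQ]; exact zero_le
  calc ∫⁻ x, sparseSum 𝓕 c x ^ p * w x
      ≤ ∫⁻ x, n ^ p * ∑ i, sparseSum (G i) c x ^ p * w x := by
        refine lintegral_mono fun x => ?_
        rw [← Finset.sum_mul, ← mul_assoc]
        gcongr
        exact (ENNReal.rpow_le_rpow (h1 x) hp.le).trans (sum_rpow_le_card _ _ hp)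
    _ = n ^ p * ∑ i, ∫⁻ x, sparseSum (G i) c x ^ p * w x := by
        rw [lintegral_const_mul' _ _ (ENNReal.rpow_ne_top_of_nonneg hp.le hnt),
          lintegral_finsetSum' (f := fun i x => sparseSum (G i) c x ^ p * w x) _ fun i _ =>
            ((measurable_sparseSum (G i) c).pow_const p).aemeasurable.mul hw]
    _ ≤ n ^ p * ∑ i : Fin K ⊕ Fin 2, C * ∑' Q : 𝓕, c Q ^ p * weightOn (1 + ε) w Q := by
        gcongr with i
        refine (hthin (G i) (hG i) c w hw).trans ?_
        gcongr
        exact ENNReal.tsum_mono_subtype (fun Q : DyadicCube d => c Q ^ p * weightOn (1 + ε) w Q)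
          (hGF i)
    _ = _ := by
        rw [Finset.sum_const, nsmul_eq_mul, ← hn]; ring

end

/-! ### Averages of square functions -/

section

open DyadicCube

variable {d : ℕ}

/-- A sum over cubes of side length at most `2^K`, dominated level by level. -/
theorem tsum_le_of_level_decay {𝓐 : Set (DyadicCube d)} {K : ℤ} {g : DyadicCube d → ℝ≥0∞}
    {x : EuclideanSpace ℝ (Fin d)} {B : ℝ≥0∞}
    (h : ∀ I ∈ 𝓐, I.k ≤ K ∧ g I ≤ B * 2⁻¹ ^ (K - I.k).toNat * I.ker (d + 1) x) :
    ∑' I : 𝓐, g I ≤ 2 * kerConst d * B := by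
  have hsub : 𝓐 ⊆ ⋃ i : ℕ, (𝓐 ∩ level (K - i)) := fun I hI => by
    have := (h I hI).1
    refine Set.mem_iUnion.2 ⟨(K - I.k).toNat, hI, ?_⟩
    simp only [level, Set.mem_ofPred_eq]; omega
  calc ∑' I : 𝓐, g I ≤ ∑' I : (⋃ i : ℕ, (𝓐 ∩ level (K - i)) : Set (DyadicCube d)), g I :=
        ENNReal.tsum_mono_subtype g hsub
    _ ≤ ∑' i : ℕ, ∑' I : (𝓐 ∩ level (K - i) : Set (DyadicCube d)), g I :=
        ENNReal.tsum_iUnion_le_tsum g _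
    _ ≤ ∑' i : ℕ, B * 2⁻¹ ^ i * kerConst d := by
        refine ENNReal.tsum_le_tsum fun i => ?_
        calc ∑' I : (𝓐 ∩ level (K - i) : Set (DyadicCube d)), g I
            ≤ ∑' I : (𝓐 ∩ level (K - i) : Set (DyadicCube d)),
              B * 2⁻¹ ^ i * I.1.ker (d + 1) x := by
              refine ENNReal.tsum_le_tsum fun I => ?_
              have h1 := (h I.1 I.2.1).2
              have h2 : I.1.k = K - i := I.2.2
              have h3 : (K - I.1.k).toNat = i := by omega
              rwa [h3] at h1
          _ ≤ ∑' I : (level (K - i) : Set (DyadicCube d)), B * 2⁻¹ ^ i * I.1.ker (d + 1) x :=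
              ENNReal.tsum_mono_subtype (fun I : DyadicCube d => B * 2⁻¹ ^ i * I.ker (d + 1) x)
                Set.inter_subset_right
          _ ≤ _ := by
              rw [ENNReal.tsum_mul_left]
              gcongr
              exact tsum_level_ker_le _ x
    _ = _ := by
        rw [ENNReal.tsum_mul_right, ENNReal.tsum_mul_left, ENNReal.tsum_geometric,
          ENNReal.one_sub_inv_two, inv_inv]
        ring

/-- The square function of the sequence `α` localized to `Q`. -/
def lsq (α : DyadicCube d → ℝ≥0∞) (Q : DyadicCube d) (x : EuclideanSpace ℝ (Fin d)) : ℝ≥0∞ :=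
  (∑' I : {I : DyadicCube d | I.toSet ⊆ Q.toSet}, I.1.toSet.indicator (fun _ => α I ^ 2) x) ^
    (1 / 2 : ℝ)

/-- The `L^{p₁}` average of the square function localized to `Q`. -/
def avg (p₁ : ℝ) (α : DyadicCube d → ℝ≥0∞) (Q : DyadicCube d) : ℝ≥0∞ :=
  ((∫⁻ x, lsq α Q x ^ p₁) / volume Q.toSet) ^ (1 / p₁)

theorem measurable_lsq (α : DyadicCube d → ℝ≥0∞) (Q : DyadicCube d) : Measurable (lsq α Q) :=
  (Measurable.tsum fun I : {I : DyadicCube d | I.toSet ⊆ Q.toSet} =>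
    measurable_const.indicator I.1.measurableSet).pow_const _

theorem lsq_mono (α : DyadicCube d → ℝ≥0∞) {Q R : DyadicCube d} (h : Q.toSet ⊆ R.toSet)
    (x : EuclideanSpace ℝ (Fin d)) : lsq α Q x ≤ lsq α R x := by
  unfold lsq
  gcongr
  exact ENNReal.tsum_mono_subtype
    (fun I : DyadicCube d => I.toSet.indicator (fun _ => α I ^ 2) x) (fun I hI => hI.trans h)

theorem sq_rpow_half (a : ℝ≥0∞) : (a ^ 2) ^ (1 / 2 : ℝ) = a := by
  rw [← ENNReal.rpow_natCast, ← ENNReal.rpow_mul]; norm_num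

theorem lsq_eq_zero_of_notMem (α : DyadicCube d → ℝ≥0∞) {Q : DyadicCube d}
    {x : EuclideanSpace ℝ (Fin d)} (hx : x ∉ Q.toSet) : lsq α Q x = 0 := by
  unfold lsq
  have : ∑' I : {I : DyadicCube d | I.toSet ⊆ Q.toSet},
      I.1.toSet.indicator (fun _ => α I ^ 2) x = 0 :=
    ENNReal.tsum_eq_zero.2 fun I => Set.indicator_of_notMem (fun h => hx (I.2 h)) _
  rw [this]; norm_num

theorem finset_sum_le_lsq (α : DyadicCube d → ℝ≥0∞) {Q : DyadicCube d}
    {x : EuclideanSpace ℝ (Fin d)} {s : Finset (DyadicCube d)}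
    (hs : ∀ I ∈ s, I.toSet ⊆ Q.toSet ∧ x ∈ I.toSet) :
    (∑ I ∈ s, α I ^ 2) ^ (1 / 2 : ℝ) ≤ lsq α Q x := by
  unfold lsq
  gcongr
  rw [tsum_subtype {I : DyadicCube d | I.toSet ⊆ Q.toSet}
    (fun I : DyadicCube d => I.toSet.indicator (fun _ => α I ^ 2) x)]
  refine le_trans (Finset.sum_le_sum fun I hI => ?_) (ENNReal.sum_le_tsum s)
  rw [Set.indicator_of_mem (show I ∈ {I : DyadicCube d | I.toSet ⊆ Q.toSet} from (hs I hI).1),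
    Set.indicator_of_mem (hs I hI).2]

theorem avg_rpow_mul_volume {p₁ : ℝ} (hp₁ : 0 < p₁) (α : DyadicCube d → ℝ≥0∞) (Q : DyadicCube d) :
    avg p₁ α Q ^ p₁ * volume Q.toSet = ∫⁻ x, lsq α Q x ^ p₁ := by
  unfold avg
  rw [← ENNReal.rpow_mul, one_div_mul_cancel hp₁.ne', ENNReal.rpow_one,
    ENNReal.div_mul_cancel Q.volume_ne_zero Q.volume_ne_top]

theorem lintegral_lsq_rpow {p₁ : ℝ} (hp₁ : 0 < p₁) (α : DyadicCube d → ℝ≥0∞) (Q : DyadicCube d) :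
    ∫⁻ x, lsq α Q x ^ p₁ = ∫⁻ x in Q.toSet, lsq α Q x ^ p₁ := by
  rw [← lintegral_indicator Q.measurableSet]
  refine lintegral_congr fun x => ?_
  by_cases hx : x ∈ Q.toSet
  · rw [Set.indicator_of_mem hx]
  · rw [Set.indicator_of_notMem hx, lsq_eq_zero_of_notMem α hx, ENNReal.zero_rpow_of_pos hp₁]

theorem le_avg_of_le {p₁ : ℝ} (hp₁ : 0 < p₁) {α : DyadicCube d → ℝ≥0∞} {Q : DyadicCube d}
    {t : ℝ≥0∞} (h : ∀ x ∈ Q.toSet, t ≤ lsq α Q x) : t ≤ avg p₁ α Q := by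
  unfold avg
  rw [le_rpow_one_div_iff hp₁, ENNReal.le_div_iff_mul_le (Or.inl Q.volume_ne_zero)
    (Or.inl Q.volume_ne_top), lintegral_lsq_rpow hp₁, ← setLIntegral_const]
  exact setLIntegral_mono' Q.measurableSet fun x hx => by gcongr; exact h x hx

theorem avg_le_of_le {p₁ : ℝ} (hp₁ : 0 < p₁) {α : DyadicCube d → ℝ≥0∞} {Q : DyadicCube d}
    {t : ℝ≥0∞} (h : ∀ x ∈ Q.toSet, lsq α Q x ≤ t) : avg p₁ α Q ≤ t := by
  unfold avg
  rw [one_div, ENNReal.rpow_inv_le_iff hp₁]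
  refine ENNReal.div_le_of_le_mul ?_
  rw [lintegral_lsq_rpow hp₁, ← setLIntegral_const]
  exact setLIntegral_mono' Q.measurableSet fun x hx => by gcongr; exact h x hx

theorem le_avg {p₁ : ℝ} (hp₁ : 0 < p₁) (α : DyadicCube d → ℝ≥0∞) (I : DyadicCube d) :
    α I ≤ avg p₁ α I :=
  le_avg_of_le hp₁ fun x hx => by
    have := finset_sum_le_lsq α (s := {I}) (Q := I) (x := x) (by simpa using hx)
    rwa [Finset.sum_singleton, sq_rpow_half] at this

theorem volume_eq_pow_mul [NeZero d] {I R : DyadicCube d} (h : I.toSet ⊆ R.toSet) :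
    volume R.toSet = 2 ^ ((R.k - I.k).toNat * d) * volume I.toSet := by
  have hk := k_le_of_subset h
  have h1 : R.side = 2 ^ (R.k - I.k).toNat * I.side := by
    simp only [side]
    rw [← zpow_natCast, ← zpow_add₀ (by norm_num)]
    congr 1; omega
  rw [volume_eq, volume_eq, h1, mul_pow, ENNReal.ofReal_mul (by positivity), ← pow_mul,
    ENNReal.ofReal_pow (by norm_num), ENNReal.ofReal_ofNat]

/-- An integer exponent that dominates `d / p₁`. -/
def growth (d : ℕ) (p₁ : ℝ) : ℕ := ⌈d / p₁⌉₊

theorem avg_le_of_subset [NeZero d] {p₁ : ℝ} (hp₁ : 0 < p₁) (α : DyadicCube d → ℝ≥0∞)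
    {I R : DyadicCube d} (h : I.toSet ⊆ R.toSet) :
    avg p₁ α I ≤ 2 ^ ((R.k - I.k).toNat * growth d p₁) * avg p₁ α R := by
  set n := (R.k - I.k).toNat
  have h1 : (∫⁻ x, lsq α I x ^ p₁) / volume I.toSet ≤
      2 ^ (n * d) * ((∫⁻ x, lsq α R x ^ p₁) / volume R.toSet) := by
    rw [volume_eq_pow_mul h, mul_comm (2 ^ (n * d) : ℝ≥0∞) (volume I.toSet)]
    rw [ENNReal.div_eq_inv_mul, ENNReal.div_eq_inv_mul, ENNReal.mul_inv (Or.inl I.volume_ne_zero)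
      (Or.inl I.volume_ne_top)]
    calc (volume I.toSet)⁻¹ * ∫⁻ x, lsq α I x ^ p₁
        ≤ (volume I.toSet)⁻¹ * ∫⁻ x, lsq α R x ^ p₁ := by
          gcongr with x
          exact lsq_mono α h x
      _ = (2 ^ (n * d) * (2 ^ (n * d))⁻¹) *
            ((volume I.toSet)⁻¹ * ∫⁻ x, lsq α R x ^ p₁) := by
          rw [ENNReal.mul_inv_cancel (by simp) (by simp), one_mul]
      _ = _ := by ring
  calc avg p₁ α I ≤ (2 ^ (n * d) * ((∫⁻ x, lsq α R x ^ p₁) / volume R.toSet)) ^ (1 / p₁) :=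
        ENNReal.rpow_le_rpow h1 (by positivity)
    _ = ((2 : ℝ≥0∞) ^ (n * d)) ^ (1 / p₁) * avg p₁ α R :=
        ENNReal.mul_rpow_of_nonneg _ _ (by positivity)
    _ ≤ _ := by
        gcongr
        rw [← ENNReal.rpow_natCast, ← ENNReal.rpow_mul, ← ENNReal.rpow_natCast]
        refine ENNReal.rpow_le_rpow_of_exponent_le (by norm_num) ?_
        push_cast
        have := Nat.le_ceil (d / p₁)
        calc (n : ℝ) * d * (1 / p₁) = n * (d / p₁) := by ring
          _ ≤ n * (growth d p₁ : ℝ) := by unfold growth; gcongr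

/-- The sum of the averages over the cubes near `Q`. -/
def avg3 (p₁ : ℝ) (α : DyadicCube d → ℝ≥0∞) (Q : DyadicCube d) : ℝ≥0∞ :=
  ∑ v, avg p₁ α (Q.shift v)

theorem avg_le_avg3 (p₁ : ℝ) (α : DyadicCube d → ℝ≥0∞) {Q R : DyadicCube d} (h : Near Q R) :
    avg p₁ α R ≤ avg3 p₁ α Q := by
  obtain ⟨v, rfl⟩ := near_iff.1 h
  exact Finset.single_le_sum (f := fun v => avg p₁ α (Q.shift v)) (fun _ _ => zero_le)
    (Finset.mem_univ v)

theorem le_avg3_of_in3 [NeZero d] {p₁ : ℝ} (hp₁ : 0 < p₁) (α : DyadicCube d → ℝ≥0∞)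
    {I Q : DyadicCube d} (h : In3 I Q) :
    α I ≤ 2 ^ ((Q.k - I.k).toNat * growth d p₁) * avg3 p₁ α Q := by
  refine (le_avg hp₁ α I).trans ((avg_le_of_subset hp₁ α (I.subset_up h.1)).trans ?_)
  rw [up_k]
  gcongr
  exact avg_le_avg3 p₁ α h.2

/-- The averages near the ancestors of `Q`, with geometric weights. -/
def avgStar (p₁ : ℝ) (α : DyadicCube d → ℝ≥0∞) (Q : DyadicCube d) : ℝ≥0∞ :=
  ∑' j : ℕ, 4⁻¹ ^ j * avg3 p₁ α (Q.anc j)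

theorem avgStar_eq (p₁ : ℝ) (α : DyadicCube d → ℝ≥0∞) (Q : DyadicCube d) :
    avgStar p₁ α Q = avg3 p₁ α Q + 4⁻¹ * avgStar p₁ α (Q.anc 1) := by
  unfold avgStar
  rw [tsum_eq_zero_add' ENNReal.summable, ← ENNReal.tsum_mul_left]
  simp only [pow_zero, one_mul, anc_zero, anc_anc]
  congr 1
  refine tsum_congr fun j => ?_
  rw [pow_succ, add_comm 1 j]; ring

theorem avg3_le_avgStar (p₁ : ℝ) (α : DyadicCube d → ℝ≥0∞) (Q : DyadicCube d) :
    avg3 p₁ α Q ≤ avgStar p₁ α Q := by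
  rw [avgStar_eq]; exact le_self_add

theorem avgStar_le_of_not_good {p₁ : ℝ} {α : DyadicCube d → ℝ≥0∞} {Q : DyadicCube d}
    (hfin : avg3 p₁ α Q ≠ ∞) (h : ¬ avgStar p₁ α Q ≤ 2 * avg3 p₁ α Q) :
    2 * avgStar p₁ α Q ≤ avgStar p₁ α (Q.anc 1) := by
  rw [avgStar_eq, two_mul, not_le, ENNReal.add_lt_add_iff_left hfin] at h
  rw [avgStar_eq]
  calc 2 * (avg3 p₁ α Q + 4⁻¹ * avgStar p₁ α (Q.anc 1))
      ≤ 2 * (4⁻¹ * avgStar p₁ α (Q.anc 1) + 4⁻¹ * avgStar p₁ α (Q.anc 1)) := by gcongr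
    _ = (2 * (2 * 4⁻¹)) * avgStar p₁ α (Q.anc 1) := by ring
    _ = avgStar p₁ α (Q.anc 1) := by
        rw [← mul_assoc, show (2 : ℝ≥0∞) * 2 = 4 by norm_num,
          ENNReal.mul_inv_cancel (by norm_num) (by norm_num), one_mul]

/-- The cubes of side length at most that of `Q` which are not near `Q`. -/
def farCubes (Q : DyadicCube d) : Set (DyadicCube d) := {I | I.k ≤ Q.k ∧ ¬ In3 I Q}

theorem mul_ker_le_of_not_in3 [NeZero d] {p₁ : ℝ} (hp₁ : 0 < p₁) (α : DyadicCube d → ℝ≥0∞)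
    {N : ℕ} (hN : (d + 1) + (growth d p₁ + 2) ≤ N) {I Q : DyadicCube d}
    {x : EuclideanSpace ℝ (Fin d)} (hx : x ∈ Q.toSet) (hI : I ∈ farCubes Q) :
    α I * I.ker N x ≤
      2 ^ (growth d p₁ + 2) * avgStar p₁ α Q * 2⁻¹ ^ (Q.k - I.k).toNat * I.ker (d + 1) x := by
  classical
  set D := growth d p₁
  obtain ⟨hk, hfar⟩ := hI
  have hex := exists_in3_anc I Q
  set m := Nat.find hex with hm
  have hm0 : m ≠ 0 := by
    intro h0
    have := Nat.find_spec hex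
    rw [← hm, h0, anc_zero] at this
    exact hfar this
  obtain ⟨j, hj⟩ := Nat.exists_eq_succ_of_ne_zero hm0
  have hin : In3 I (Q.anc (j + 1)) := by
    have := Nat.find_spec hex
    rwa [← hm, hj] at this
  have hnot : ¬ In3 I (Q.anc j) := Nat.find_min hex (by omega)
  set i := (Q.k - I.k).toNat with hi
  have hside : (2 : ℝ) ^ (i + j) * I.side ≤ ‖x - I.corner‖ := by
    refine le_trans (le_of_eq ?_) (In3.norm_lower (by simp; omega) hnot (Q.subset_anc j hx) I.corner_mem)
    rw [side_anc, pow_add, mul_comm ((2 : ℝ) ^ i), mul_assoc]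
    congr 1
    simp only [side]
    rw [← zpow_natCast, ← zpow_add₀ (by norm_num)]
    congr 1; omega
  have h1 : α I ≤ 2 ^ ((i + j + 1) * D) * avg3 p₁ α (Q.anc (j + 1)) := by
    have := le_avg3_of_in3 hp₁ α hin
    rw [anc_k] at this
    have he : (Q.k + ((j + 1 : ℕ) : ℤ) - I.k).toNat = i + j + 1 := by omega
    rwa [he] at this
  have h2 : I.ker N x ≤ I.ker (d + 1) x * 2⁻¹ ^ ((i + j) * (D + 2)) :=
    (ker_anti hN I x).trans (by
      rw [ker_add]
      gcongr
      exact ker_le_inv_two_pow hside _)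
  have h3 : 4⁻¹ ^ (j + 1) * avg3 p₁ α (Q.anc (j + 1)) ≤ avgStar p₁ α Q :=
    ENNReal.le_tsum (f := fun j : ℕ => 4⁻¹ ^ j * avg3 p₁ α (Q.anc j)) (j + 1)
  have h4 : (2 : ℝ≥0∞) ^ ((i + j + 1) * D) * 2⁻¹ ^ ((i + j) * (D + 2)) ≤
      2 ^ (D + 2) * 4⁻¹ ^ (j + 1) * 2⁻¹ ^ i := by
    have e1 : (2 : ℝ≥0∞) ^ ((i + j + 1) * D) = 2 ^ ((i + j) * D) * 2 ^ D := by
      rw [← pow_add]; congr 1; ring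
    have e2 : (2⁻¹ : ℝ≥0∞) ^ ((i + j) * (D + 2)) = 2⁻¹ ^ ((i + j) * D) * 2⁻¹ ^ (2 * i + 2 * j) := by
      rw [← pow_add]; congr 1; ring
    have e3 : (2 : ℝ≥0∞) ^ ((i + j) * D) * 2⁻¹ ^ ((i + j) * D) = 1 := by
      rw [← mul_pow, ENNReal.mul_inv_cancel (by norm_num) (by norm_num), one_pow]
    have e4 : (4⁻¹ : ℝ≥0∞) = 2⁻¹ ^ 2 := by
      rw [← ENNReal.inv_pow]; norm_num
    have e5 : (2 : ℝ≥0∞) ^ 2 * 2⁻¹ ^ 2 = 1 := by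
      rw [← mul_pow, ENNReal.mul_inv_cancel (by norm_num) (by norm_num), one_pow]
    calc (2 : ℝ≥0∞) ^ ((i + j + 1) * D) * 2⁻¹ ^ ((i + j) * (D + 2))
        = (2 ^ ((i + j) * D) * 2⁻¹ ^ ((i + j) * D)) * (2 ^ D * 2⁻¹ ^ (2 * i + 2 * j)) := by
          rw [e1, e2]; ring
      _ = 2 ^ D * (2⁻¹ ^ (2 * j) * 2⁻¹ ^ (2 * i)) := by rw [e3, one_mul, ← pow_add, add_comm]
      _ ≤ 2 ^ D * (2⁻¹ ^ (2 * j) * 2⁻¹ ^ i) := by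
          refine mul_le_mul_right (mul_le_mul_right ?_ _) _
          exact pow_le_pow_right_of_le_one' (by simp) (by omega)
      _ = 2 ^ D * (2 ^ 2 * 2⁻¹ ^ 2) * (2⁻¹ ^ (2 * j) * 2⁻¹ ^ i) := by rw [e5, mul_one]
      _ = _ := by
          rw [e4, ← pow_mul]; ring
  calc α I * I.ker N x
      ≤ (2 ^ ((i + j + 1) * D) * avg3 p₁ α (Q.anc (j + 1))) *
          (I.ker (d + 1) x * 2⁻¹ ^ ((i + j) * (D + 2))) := mul_le_mul' h1 h2
    _ = (2 ^ ((i + j + 1) * D) * 2⁻¹ ^ ((i + j) * (D + 2))) * avg3 p₁ α (Q.anc (j + 1)) *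
          I.ker (d + 1) x := by ring
    _ ≤ (2 ^ (D + 2) * 4⁻¹ ^ (j + 1) * 2⁻¹ ^ i) * avg3 p₁ α (Q.anc (j + 1)) *
          I.ker (d + 1) x := by gcongr
    _ = 2 ^ (D + 2) * (4⁻¹ ^ (j + 1) * avg3 p₁ α (Q.anc (j + 1))) * 2⁻¹ ^ i *
          I.ker (d + 1) x := by ring
    _ ≤ _ := by gcongr

/-- The constant in the bounds by `avgStar`. -/
def starConst (d : ℕ) (p₁ : ℝ) : ℝ≥0∞ := 2 * kerConst d * 2 ^ (growth d p₁ + 2)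

theorem starConst_ne_top (d : ℕ) (p₁ : ℝ) : starConst d p₁ ≠ ∞ :=
  ENNReal.mul_ne_top (ENNReal.mul_ne_top (by norm_num) (kerConst_ne_top d)) (by simp)

theorem tsum_farCubes_le [NeZero d] {p₁ : ℝ} (hp₁ : 0 < p₁) (α : DyadicCube d → ℝ≥0∞)
    {N : ℕ} (hN : (d + 1) + (growth d p₁ + 2) ≤ N) {Q : DyadicCube d}
    {x : EuclideanSpace ℝ (Fin d)} (hx : x ∈ Q.toSet) :
    ∑' I : farCubes Q, α I * I.1.ker N x ≤ starConst d p₁ * avgStar p₁ α Q :=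
  (tsum_le_of_level_decay (g := fun I : DyadicCube d => α I * I.ker N x)
    fun I hI => ⟨hI.1, mul_ker_le_of_not_in3 hp₁ α hN hx hI⟩).trans_eq (by
      unfold starConst; ring)

theorem tsum_level_le [NeZero d] {p₁ : ℝ} (hp₁ : 0 < p₁) (α : DyadicCube d → ℝ≥0∞)
    {N : ℕ} (hN : (d + 1) + (growth d p₁ + 2) ≤ N) {Q : DyadicCube d}
    {x : EuclideanSpace ℝ (Fin d)} (hx : x ∈ Q.toSet) :
    ∑' I : (level Q.k : Set (DyadicCube d)), α I * I.1.ker N x ≤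
      starConst d p₁ * avgStar p₁ α Q := by
  refine (tsum_le_of_level_decay (𝓐 := level Q.k) (K := Q.k)
    (g := fun I : DyadicCube d => α I * I.ker N x) (x := x)
    (B := 2 ^ (growth d p₁ + 2) * avgStar p₁ α Q) fun I hI => ?_).trans_eq (by
      unfold starConst; ring)
  have hk : I.k = Q.k := hI
  refine ⟨hk.le, ?_⟩
  by_cases h : In3 I Q
  · have h1 := le_avg3_of_in3 hp₁ α h
    rw [hk, sub_self] at h1 ⊢
    simp only [Int.toNat_zero, zero_mul, pow_zero, one_mul, mul_one] at h1 ⊢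
    refine mul_le_mul' ?_ (ker_anti (by omega) I x)
    refine h1.trans ((avg3_le_avgStar p₁ α Q).trans ?_)
    exact le_mul_of_one_le_left zero_le (one_le_pow₀ (by norm_num))
  · exact mul_ker_le_of_not_in3 hp₁ α hN hx ⟨hk.le, h⟩

theorem tsum_subset_le [NeZero d] {p₁ : ℝ} (hp₁ : 0 < p₁) (α : DyadicCube d → ℝ≥0∞)
    {N : ℕ} (hN : (d + 1) + (growth d p₁ + 1) + (d + 1) ≤ N) {P : DyadicCube d}
    {x : EuclideanSpace ℝ (Fin d)} (hx : ¬ Near P (cubeAt P.k x)) :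
    ∑' I : {I : DyadicCube d | I.toSet ⊆ P.toSet}, α I * I.1.ker N x ≤
      2 * kerConst d * (ENNReal.ofReal ((2 + d : ℝ) ^ (d + 1)) * (avg p₁ α P * P.ker (d + 1) x)) := by
  refine tsum_le_of_level_decay (K := P.k) (x := x) (g := fun I : DyadicCube d => α I * I.ker N x)
    fun I hI => ⟨k_le_of_subset hI, ?_⟩
  set D := growth d p₁
  set i := (P.k - I.k).toNat with hi
  have hk := k_le_of_subset hI
  have hside : P.side = 2 ^ i * I.side := by
    simp only [side]
    rw [← zpow_natCast, ← zpow_add₀ (by norm_num)]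
    congr 1; omega
  have hfar : P.side ≤ ‖x - I.corner‖ := by
    have := side_le_norm_sub (Q := P) (R := cubeAt P.k x) rfl hx (hI I.corner_mem) (mem_cubeAt _ x)
    rwa [norm_sub_rev] at this
  have hP := P.side_pos
  have hIs := I.side_pos
  have hrho : P.rho x ≤ I.rho x * (2 + d) := by
    have h1 : ‖x - P.corner‖ ≤ ‖x - I.corner‖ + d * P.side := by
      have h2 := P.norm_sub_le (hI I.corner_mem) P.corner_mem
      have h3 := norm_add_le (x - I.corner) (I.corner - P.corner)
      rw [sub_add_sub_cancel] at h3
      linarith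
    have h4 : ‖x - P.corner‖ / P.side ≤ ‖x - I.corner‖ / P.side + d := by
      rw [div_le_iff₀ hP, add_mul, div_mul_cancel₀ _ hP.ne']; exact h1
    have h5 : ‖x - I.corner‖ / P.side ≤ ‖x - I.corner‖ / I.side := by
      gcongr; exact side_le_side hk
    have h6 : 0 ≤ ‖x - I.corner‖ / I.side := by positivity
    have h7 : (0 : ℝ) ≤ d := by positivity
    unfold rho
    nlinarith
  have h1 : α I ≤ 2 ^ (i * D) * avg p₁ α P := (le_avg hp₁ α I).trans (avg_le_of_subset hp₁ α hI)
  have h2 : I.ker N x ≤ I.ker (d + 1) x * 2⁻¹ ^ (i * (D + 1)) *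
      (ENNReal.ofReal ((2 + d : ℝ) ^ (d + 1)) * P.ker (d + 1) x) :=
    (ker_anti hN I x).trans (by
      rw [ker_add, ker_add]
      gcongr
      · exact ker_le_inv_two_pow (by rwa [← hside]) _
      · exact ker_le_of_rho_le hrho _)
  have e : (2 : ℝ≥0∞) ^ (i * D) * 2⁻¹ ^ (i * (D + 1)) = 2⁻¹ ^ i := by
    rw [mul_add, mul_one, pow_add, ← mul_assoc, ← mul_pow,
      ENNReal.mul_inv_cancel (by norm_num) (by norm_num), one_pow, one_mul]
  calc α I * I.ker N x ≤ (2 ^ (i * D) * avg p₁ α P) * (I.ker (d + 1) x * 2⁻¹ ^ (i * (D + 1)) *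
      (ENNReal.ofReal ((2 + d : ℝ) ^ (d + 1)) * P.ker (d + 1) x)) := mul_le_mul' h1 h2
    _ = ENNReal.ofReal ((2 + d : ℝ) ^ (d + 1)) * (avg p₁ α P * P.ker (d + 1) x) *
        (2 ^ (i * D) * 2⁻¹ ^ (i * (D + 1))) * I.ker (d + 1) x := by ring
    _ = _ := by rw [e]

end

/-! ### Atoms and almost orthogonality -/

section

open DyadicCube
open Filter hiding ker

variable {d : ℕ}

/-- Lipschitz smoothness at the scale of `J`, with decay of order `n` away from `J`. -/
def SmoothAt (n : ℕ) (J : DyadicCube d) (a : ℝ≥0∞) (g : EuclideanSpace ℝ (Fin d) → ℂ) : Prop :=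
  ∀ x y, ‖g x - g y‖ₑ ≤
    a * ENNReal.ofReal (‖x - y‖ / J.side * (1 + ‖x - y‖ / J.side) ^ n) * J.ker n x

/-- A mean-zero atom at `I` of size `a` with decay of order `N`. -/
structure IsAtom (N : ℕ) (I : DyadicCube d) (a : ℝ≥0∞) (g : EuclideanSpace ℝ (Fin d) → ℂ) :
    Prop where
  continuous : Continuous g
  size : ∀ x, ‖g x‖ₑ ≤ a * I.ker N x
  smooth : ∀ n ≤ N, SmoothAt n I a g
  mean : ∫ x, g x = 0

theorem IsAtom.lintegral_le {N : ℕ} {I : DyadicCube d} {a : ℝ≥0∞}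
    {g : EuclideanSpace ℝ (Fin d) → ℂ} (h : IsAtom N I a g) (hN : d + 1 ≤ N) :
    ∫⁻ x, ‖g x‖ₑ ≤ a * (volume I.toSet * kerMass d) := by
  rw [← lintegral_ker, ← lintegral_const_mul _ (I.measurable_ker _)]
  exact lintegral_mono fun x => (h.size x).trans (mul_le_mul_right (ker_anti hN I x) _)

theorem IsAtom.integrable {N : ℕ} {I : DyadicCube d} {a : ℝ≥0∞} (ha : a ≠ ∞)
    {g : EuclideanSpace ℝ (Fin d) → ℂ} (h : IsAtom N I a g) (hN : d + 1 ≤ N) : Integrable g :=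
  ⟨h.continuous.aestronglyMeasurable, (h.lintegral_le hN).trans_lt
    (ENNReal.mul_lt_top ha.lt_top (ENNReal.mul_lt_top I.volume_ne_top.lt_top
      (kerMass_ne_top d).lt_top))⟩

theorem IsAtom.norm_le {N : ℕ} {I : DyadicCube d} {a : ℝ≥0∞} (ha : a ≠ ∞)
    {g : EuclideanSpace ℝ (Fin d) → ℂ} (h : IsAtom N I a g) (x : EuclideanSpace ℝ (Fin d)) :
    ‖g x‖ ≤ a.toReal := by
  have h1 : ‖g x‖ₑ ≤ a := (h.size x).trans (mul_le_of_le_one_right zero_le (ker_le_one N I x))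
  rw [← toReal_enorm]
  exact ENNReal.toReal_mono ha h1

theorem ker_mul_ofReal_rho_pow (m n : ℕ) (I : DyadicCube d) (x : EuclideanSpace ℝ (Fin d)) :
    I.ker (m + n) x * ENNReal.ofReal (I.rho x ^ n) = I.ker m x := by
  have := I.rho_pos x
  unfold ker
  rw [← ENNReal.ofReal_mul (by positivity)]
  congr 1
  field_simp
  ring

/-- Pairing a mean-zero atom with a function that varies slowly at its scale. -/
theorem IsAtom.enorm_integral_mul_le {N : ℕ} {I : DyadicCube d} {a : ℝ≥0∞} (ha : a ≠ ∞)
    {g ψ : EuclideanSpace ℝ (Fin d) → ℂ} (h : IsAtom N I a ψ) (hN : 2 * d + 3 ≤ N)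
    (hg : Continuous g) {C : ℝ} (hC : ∀ x, ‖g x‖ ≤ C) {H : ℝ≥0∞}
    (hH : ∀ x, ‖g x - g I.corner‖ₑ ≤ H * ENNReal.ofReal (I.rho x ^ (d + 2))) :
    ‖∫ x, ψ x * g x‖ₑ ≤ a * H * (volume I.toSet * kerMass d) := by
  have hint := h.integrable ha (by omega)
  have hint2 : Integrable fun x => ψ x * g x :=
    hint.mul_bdd hg.aestronglyMeasurable (Eventually.of_forall hC)
  have h1 : ∫ x, ψ x * g x = ∫ x, ψ x * (g x - g I.corner) := by
    simp only [mul_sub]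
    rw [integral_sub hint2 (hint.mul_const _), integral_mul_const, h.mean, zero_mul, sub_zero]
  rw [h1]
  refine (enorm_integral_le_lintegral_enorm _).trans ?_
  rw [← lintegral_ker, ← lintegral_const_mul _ (I.measurable_ker _)]
  refine lintegral_mono fun x => ?_
  rw [enorm_mul]
  calc ‖ψ x‖ₑ * ‖g x - g I.corner‖ₑ
      ≤ (a * I.ker (d + 1 + (d + 2)) x) * (H * ENNReal.ofReal (I.rho x ^ (d + 2))) := by
        refine mul_le_mul' ((h.size x).trans (mul_le_mul_right (ker_anti (by omega) I x) _)) (hH x)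
    _ = a * H * (I.ker (d + 1 + (d + 2)) x * ENNReal.ofReal (I.rho x ^ (d + 2))) := by ring
    _ = _ := by rw [ker_mul_ofReal_rho_pow]

theorem side_eq_pow_mul {I J : DyadicCube d} (hk : I.k ≤ J.k) :
    J.side = 2 ^ (J.k - I.k).toNat * I.side := by
  simp only [side]
  rw [← zpow_natCast, ← zpow_add₀ (by norm_num)]
  congr 1; omega

theorem IsAtom.enorm_integral_mul_smooth_le {N : ℕ} {I J : DyadicCube d} {a b : ℝ≥0∞} (ha : a ≠ ∞)
    {g ψ : EuclideanSpace ℝ (Fin d) → ℂ} (h : IsAtom N I a ψ) (hN : 2 * d + 3 ≤ N)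
    (hg : Continuous g) {C : ℝ} (hC : ∀ x, ‖g x‖ ≤ C) (hs : SmoothAt (d + 1) J b g)
    (hk : I.k ≤ J.k) :
    ‖∫ x, ψ x * g x‖ₑ ≤ kerMass d * (a * b *
      (2⁻¹ ^ (J.k - I.k).toNat * (volume I.toSet * J.ker (d + 1) I.corner))) := by
  set i := (J.k - I.k).toNat
  have hside := side_eq_pow_mul hk
  refine (h.enorm_integral_mul_le ha hN hg hC
    (H := b * 2⁻¹ ^ i * J.ker (d + 1) I.corner) fun x => ?_).trans_eq (by ring)
  rw [enorm_sub_rev]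
  refine (hs I.corner x).trans ?_
  have hI := I.side_pos
  have hJ := J.side_pos
  have ht : ‖I.corner - x‖ / J.side ≤ 2⁻¹ ^ i * I.rho x := by
    rw [hside, norm_sub_rev]
    unfold rho
    rw [div_le_iff₀ (by positivity)]
    have : (2⁻¹ : ℝ) ^ i * (1 + ‖x - I.corner‖ / I.side) * (2 ^ i * I.side) =
        (2⁻¹ ^ i * 2 ^ i) * (I.side + ‖x - I.corner‖ / I.side * I.side) := by ring
    rw [this, ← mul_pow, div_mul_cancel₀ _ hI.ne']
    norm_num
    linarith
  have ht2 : 1 + ‖I.corner - x‖ / J.side ≤ I.rho x := by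
    unfold rho
    rw [norm_sub_rev]
    gcongr
    exact side_le_side hk
  have ht0 : 0 ≤ ‖I.corner - x‖ / J.side := by positivity
  have hr := I.rho_pos x
  have key : ENNReal.ofReal (‖I.corner - x‖ / J.side * (1 + ‖I.corner - x‖ / J.side) ^ (d + 1)) ≤
      2⁻¹ ^ i * ENNReal.ofReal (I.rho x ^ (d + 2)) := by
    have e : (2⁻¹ : ℝ≥0∞) ^ i = ENNReal.ofReal (2⁻¹ ^ i) := by
      rw [ENNReal.ofReal_pow (by norm_num), ENNReal.ofReal_inv_of_pos (by norm_num)]; simp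
    rw [e, ← ENNReal.ofReal_mul (by positivity)]
    refine ENNReal.ofReal_le_ofReal ?_
    calc _ ≤ (2⁻¹ ^ i * I.rho x) * I.rho x ^ (d + 1) := by gcongr
      _ = _ := by ring
  calc _ ≤ b * (2⁻¹ ^ i * ENNReal.ofReal (I.rho x ^ (d + 2))) * J.ker (d + 1) I.corner := by gcongr
    _ = _ := by ring

/-- The almost-orthogonality kernel. -/
def interaction (I J : DyadicCube d) : ℝ≥0∞ :=
  if I.k ≤ J.k then 2⁻¹ ^ (J.k - I.k).toNat * (volume I.toSet * J.ker (d + 1) I.corner)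
  else 2⁻¹ ^ (I.k - J.k).toNat * (volume J.toSet * I.ker (d + 1) J.corner)

theorem SmoothAt.conj {n : ℕ} {J : DyadicCube d} {a : ℝ≥0∞} {g : EuclideanSpace ℝ (Fin d) → ℂ}
    (h : SmoothAt n J a g) : SmoothAt n J a fun x => conj (g x) := fun x y => by
  rw [← map_sub, RCLike.enorm_conj]; exact h x y

theorem enorm_integral_mul_conj_le {N : ℕ} (hN : 2 * d + 3 ≤ N) {I J : DyadicCube d} {a b : ℝ≥0∞}
    (ha : a ≠ ∞) (hb : b ≠ ∞) {g h : EuclideanSpace ℝ (Fin d) → ℂ} (hg : IsAtom N I a g)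
    (hh : IsAtom N J b h) :
    ‖∫ x, g x * conj (h x)‖ₑ ≤ kerMass d * (a * b * interaction I J) := by
  unfold interaction
  split_ifs with hk
  · exact hg.enorm_integral_mul_smooth_le ha hN (Complex.continuous_conj.comp hh.continuous)
      (fun x => by rw [RCLike.norm_conj]; exact hh.norm_le hb x)
      (hh.smooth (d + 1) (by omega)).conj hk
  · have h1 : ∫ x, g x * conj (h x) = conj (∫ x, h x * conj (g x)) := by
      rw [← integral_conj]
      refine integral_congr_ae (Eventually.of_forall fun x => ?_)
      simp [mul_comm]
    rw [h1, RCLike.enorm_conj]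
    refine (hh.enorm_integral_mul_smooth_le hb hN (Complex.continuous_conj.comp hg.continuous)
      (fun x => by rw [Function.comp_apply, RCLike.norm_conj]; exact hg.norm_le ha x)
      (hg.smooth (d + 1) (by omega)).conj (not_le.1 hk).le).trans_eq (by ring)

theorem interaction_comm (I J : DyadicCube d) : interaction I J = interaction J I := by
  unfold interaction
  split_ifs with h1 h2 h2
  · have hk : I.k = J.k := le_antisymm h1 h2
    have hs : I.side = J.side := by simp [side, hk]
    rw [hk, volume_eq_of_k hk]
    unfold ker rho
    rw [hs, norm_sub_rev]
  · rfl
  · rfl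
  · omega

theorem tsum_interaction_le (I : DyadicCube d) :
    ∑' J, interaction I J ≤ 4 * kerConst d * volume I.toSet := by
  have hcov : (Set.univ : Set (DyadicCube d)) ⊆
      (⋃ i : ℕ, level (I.k - i)) ∪ ⋃ i : ℕ, level (I.k + i) := fun J _ => by
    rcases le_total J.k I.k with h | h
    · refine Or.inl (Set.mem_iUnion.2 ⟨(I.k - J.k).toNat, ?_⟩)
      simp only [level, Set.mem_ofPred_eq]; omega
    · refine Or.inr (Set.mem_iUnion.2 ⟨(J.k - I.k).toNat, ?_⟩)
      simp only [level, Set.mem_ofPred_eq]; omega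
  have hgeo : ∑' i : ℕ, (2⁻¹ : ℝ≥0∞) ^ i = 2 := by
    rw [ENNReal.tsum_geometric, ENNReal.one_sub_inv_two, inv_inv]
  have hlow : ∑' J : (⋃ i : ℕ, level (I.k - i) : Set (DyadicCube d)), interaction I J ≤
      2 * (kerConst d * volume I.toSet) := by
    refine (ENNReal.tsum_iUnion_le_tsum (fun J => interaction I J) _).trans ?_
    refine (ENNReal.tsum_le_tsum (g := fun i : ℕ => 2⁻¹ ^ i * (kerConst d * volume I.toSet))
      fun i => ?_).trans_eq (by rw [ENNReal.tsum_mul_right, hgeo])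
    refine le_trans (ENNReal.tsum_le_tsum (g := fun J : (level (I.k - i) : Set (DyadicCube d)) =>
      2⁻¹ ^ i * (volume J.1.toSet * I.ker (d + 1) J.1.corner)) fun J => ?_) ?_
    · have hJ : J.1.k = I.k - i := J.2
      rw [interaction_comm]
      unfold interaction
      rw [if_pos (by omega)]
      have : (I.k - J.1.k).toNat = i := by omega
      rw [this]
    · rw [ENNReal.tsum_mul_left]
      gcongr
      exact tsum_level_volume_mul_ker_le (by omega)
  have hhigh : ∑' J : (⋃ i : ℕ, level (I.k + i) : Set (DyadicCube d)), interaction I J ≤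
      2 * (kerConst d * volume I.toSet) := by
    refine (ENNReal.tsum_iUnion_le_tsum (fun J => interaction I J) _).trans ?_
    refine (ENNReal.tsum_le_tsum (g := fun i : ℕ => 2⁻¹ ^ i * (kerConst d * volume I.toSet))
      fun i => ?_).trans_eq (by rw [ENNReal.tsum_mul_right, hgeo])
    refine le_trans (ENNReal.tsum_le_tsum (g := fun J : (level (I.k + i) : Set (DyadicCube d)) =>
      2⁻¹ ^ i * volume I.toSet * J.1.ker (d + 1) I.corner) fun J => ?_) ?_
    · have hJ : J.1.k = I.k + i := J.2
      unfold interaction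
      rw [if_pos (by omega)]
      have : (J.1.k - I.k).toNat = i := by omega
      rw [this, mul_assoc]
    · rw [ENNReal.tsum_mul_left, mul_assoc, mul_comm (kerConst d)]
      gcongr
      exact tsum_level_ker_le _ _
  calc ∑' J, interaction I J = ∑' J : (Set.univ : Set (DyadicCube d)), interaction I J := by
        rw [tsum_univ]
    _ ≤ _ := ENNReal.tsum_mono_subtype (fun J => interaction I J) hcov
    _ ≤ _ := ENNReal.tsum_union_le (fun J => interaction I J) _ _
    _ ≤ _ := add_le_add hlow hhigh
    _ = _ := by ring

theorem mul_le_sq_add_sq (a b : ℝ≥0∞) : a * b ≤ a ^ 2 + b ^ 2 := by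
  rcases le_total a b with h | h
  · calc a * b ≤ b * b := by gcongr
      _ ≤ _ := by rw [← sq]; exact le_add_self
  · calc a * b ≤ a * a := by gcongr
      _ ≤ _ := by rw [← sq]; exact le_self_add

theorem sum_sum_interaction_le (s : Finset (DyadicCube d)) (α : DyadicCube d → ℝ≥0∞) :
    ∑ I ∈ s, ∑ J ∈ s, α I * α J * interaction I J ≤
      8 * kerConst d * ∑ I ∈ s, α I ^ 2 * volume I.toSet := by
  have h1 : ∀ I ∈ s, ∑ J ∈ s, α I ^ 2 * interaction I J ≤
      4 * kerConst d * (α I ^ 2 * volume I.toSet) := fun I _ => by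
    rw [← Finset.mul_sum]
    calc α I ^ 2 * ∑ J ∈ s, interaction I J ≤ α I ^ 2 * (4 * kerConst d * volume I.toSet) := by
          gcongr
          exact (ENNReal.sum_le_tsum s).trans (tsum_interaction_le I)
      _ = _ := by ring
  have h2 : ∑ I ∈ s, ∑ J ∈ s, α J ^ 2 * interaction I J =
      ∑ I ∈ s, ∑ J ∈ s, α I ^ 2 * interaction I J := by
    rw [Finset.sum_comm]
    simp only [interaction_comm]
  calc ∑ I ∈ s, ∑ J ∈ s, α I * α J * interaction I J
      ≤ ∑ I ∈ s, ∑ J ∈ s, (α I ^ 2 * interaction I J + α J ^ 2 * interaction I J) := by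
        refine Finset.sum_le_sum fun I _ => Finset.sum_le_sum fun J _ => ?_
        rw [← add_mul]
        exact mul_le_mul_left (mul_le_sq_add_sq _ _) _
    _ = 2 * ∑ I ∈ s, ∑ J ∈ s, α I ^ 2 * interaction I J := by
        simp only [Finset.sum_add_distrib]
        rw [h2, two_mul]
    _ ≤ 2 * ∑ I ∈ s, 4 * kerConst d * (α I ^ 2 * volume I.toSet) := by
        gcongr with I hI
        exact h1 I hI
    _ = _ := by rw [← Finset.mul_sum]; ring

theorem lintegral_enorm_sum_sq_le {N : ℕ} (hN : 2 * d + 3 ≤ N) {α : DyadicCube d → ℝ≥0∞}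
    (hα : ∀ I, α I ≠ ∞) {ψ : DyadicCube d → EuclideanSpace ℝ (Fin d) → ℂ}
    (hψ : ∀ I, IsAtom N I (α I) (ψ I)) (s : Finset (DyadicCube d)) :
    ∫⁻ x, ‖∑ I ∈ s, ψ I x‖ₑ ^ 2 ≤
      8 * kerMass d * kerConst d * ∑ I ∈ s, α I ^ 2 * volume I.toSet := by
  have hint : ∀ I J, Integrable fun x => ψ I x * conj (ψ J x) := fun I J =>
    ((hψ I).integrable (hα I) (by omega)).mul_bdd
      (Complex.continuous_conj.comp (hψ J).continuous).aestronglyMeasurable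
      (Eventually.of_forall fun x => by
        rw [RCLike.norm_conj]; exact (hψ J).norm_le (hα J) x)
  have hexp : ∀ x, ((‖∑ I ∈ s, ψ I x‖ ^ 2 : ℝ) : ℂ) = ∑ I ∈ s, ∑ J ∈ s, ψ I x * conj (ψ J x) :=
    fun x => by
      push_cast
      rw [← Complex.mul_conj', map_sum, Finset.sum_mul_sum]
  have hint1 : Integrable fun x => ((‖∑ I ∈ s, ψ I x‖ ^ 2 : ℝ) : ℂ) := by
    simp only [hexp]
    exact integrable_finsetSum _ fun I _ => integrable_finsetSum _ fun J _ => hint I J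
  have hint2 : Integrable fun x => ‖∑ I ∈ s, ψ I x‖ ^ 2 := by
    exact hint1.re
  have h1 : ∫⁻ x, ‖∑ I ∈ s, ψ I x‖ₑ ^ 2 = ‖∫ x, ((‖∑ I ∈ s, ψ I x‖ ^ 2 : ℝ) : ℂ)‖ₑ := by
    rw [integral_complex_ofReal, ← ofReal_norm, Complex.norm_real,
      Real.norm_of_nonneg (integral_nonneg fun x => by positivity),
      ofReal_integral_eq_lintegral_ofReal hint2 (Eventually.of_forall fun x => by positivity)]
    refine lintegral_congr fun x => ?_
    rw [ENNReal.ofReal_pow (norm_nonneg _), ofReal_norm]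
  rw [h1]
  simp only [hexp]
  rw [integral_finsetSum _ fun I _ => integrable_finsetSum _ fun J _ => hint I J]
  simp only [integral_finsetSum _ fun J _ => hint _ J]
  calc ‖∑ I ∈ s, ∑ J ∈ s, ∫ x, ψ I x * conj (ψ J x)‖ₑ
      ≤ ∑ I ∈ s, ∑ J ∈ s, ‖∫ x, ψ I x * conj (ψ J x)‖ₑ :=
        (enorm_sum_le _ _).trans (Finset.sum_le_sum fun I _ => enorm_sum_le _ _)
    _ ≤ ∑ I ∈ s, ∑ J ∈ s, kerMass d * (α I * α J * interaction I J) := by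
        gcongr with I _ J _
        exact enorm_integral_mul_conj_le hN (hα I) (hα J) (hψ I) (hψ J)
    _ = kerMass d * ∑ I ∈ s, ∑ J ∈ s, α I * α J * interaction I J := by
        simp only [Finset.mul_sum]
    _ ≤ kerMass d * (8 * kerConst d * ∑ I ∈ s, α I ^ 2 * volume I.toSet) := by
        gcongr
        exact sum_sum_interaction_le s α
    _ = _ := by ring

/-- A countable type is exhausted by a sequence of finite sets. -/
theorem exists_tendsto_finset (ι : Type*) [Countable ι] :
    ∃ s : ℕ → Finset ι, Tendsto s atTop atTop := by
  classical
  obtain ⟨e, he⟩ := exists_injective_nat ι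
  refine ⟨fun n => (Set.Finite.preimage he.injOn (Set.finite_Iio n)).toFinset,
    tendsto_atTop_finset_of_monotone (fun m n hmn I hI => ?_) fun I => ⟨e I + 1, ?_⟩⟩
  · simp only [Set.Finite.mem_toFinset, Set.mem_preimage, Set.mem_Iio] at hI ⊢
    omega
  · simp

/-- The sum of the atoms indexed by `𝓐`. -/
def psum (ψ : DyadicCube d → EuclideanSpace ℝ (Fin d) → ℂ) (𝓐 : Set (DyadicCube d))
    (x : EuclideanSpace ℝ (Fin d)) : ℂ := ∑' I, 𝓐.indicator (fun I => ψ I x) I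

/-- A family of atoms with summable size. -/
structure AtomFamily (N : ℕ) (α : DyadicCube d → ℝ≥0∞)
    (ψ : DyadicCube d → EuclideanSpace ℝ (Fin d) → ℂ) : Prop where
  atom : ∀ I, IsAtom N I (α I) (ψ I)
  summable : ∑' k : ℤ, ⨆ I ∈ (level k : Set (DyadicCube d)), α I ≠ ∞

namespace AtomFamily

variable {N : ℕ} {α : DyadicCube d → ℝ≥0∞} {ψ : DyadicCube d → EuclideanSpace ℝ (Fin d) → ℂ}

theorem ne_top (h : AtomFamily N α ψ) (I : DyadicCube d) : α I ≠ ∞ := by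
  refine ne_top_of_le_ne_top h.summable (le_trans ?_ (ENNReal.le_tsum I.k))
  exact le_iSup₂_of_le I rfl le_rfl

theorem tsum_mul_ker_le (α : DyadicCube d → ℝ≥0∞) (hN : d + 1 ≤ N)
    (x : EuclideanSpace ℝ (Fin d)) :
    ∑' I, α I * I.ker N x ≤
      (∑' k : ℤ, ⨆ I ∈ (level k : Set (DyadicCube d)), α I) * kerConst d := by
  have hcov : (Set.univ : Set (DyadicCube d)) ⊆ ⋃ k : ℤ, level k :=
    fun I _ => Set.mem_iUnion.2 ⟨I.k, rfl⟩
  rw [← tsum_univ]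
  refine (ENNReal.tsum_mono_subtype (fun I : DyadicCube d => α I * I.ker N x) hcov).trans ?_
  refine (ENNReal.tsum_iUnion_le_tsum (fun I : DyadicCube d => α I * I.ker N x) _).trans ?_
  rw [← ENNReal.tsum_mul_right]
  refine ENNReal.tsum_le_tsum fun k => ?_
  calc ∑' I : (level k : Set (DyadicCube d)), α I * I.1.ker N x
      ≤ ∑' I : (level k : Set (DyadicCube d)),
        (⨆ I ∈ (level k : Set (DyadicCube d)), α I) * I.1.ker (d + 1) x := by
        refine ENNReal.tsum_le_tsum fun I => mul_le_mul' ?_ (ker_anti hN _ _)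
        exact le_iSup₂ (f := fun (I : DyadicCube d) (_ : I ∈ level k) => α I) I.1 I.2
    _ ≤ _ := by
        rw [ENNReal.tsum_mul_left]
        gcongr
        exact tsum_level_ker_le k x

theorem tsum_ne_top (h : AtomFamily N α ψ) (hN : d + 1 ≤ N) (x : EuclideanSpace ℝ (Fin d)) :
    ∑' I, ‖ψ I x‖ₑ ≠ ∞ :=
  ne_top_of_le_ne_top (ENNReal.mul_ne_top h.summable (kerConst_ne_top d))
    ((ENNReal.tsum_le_tsum fun I => (h.atom I).size x).trans (tsum_mul_ker_le α hN x))

theorem summable_norm (h : AtomFamily N α ψ) (hN : d + 1 ≤ N) (x : EuclideanSpace ℝ (Fin d)) :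
    Summable fun I => ‖ψ I x‖ := by
  have := h.tsum_ne_top hN x
  simp only [← ofReal_norm] at this
  have h2 := ENNReal.summable_toReal this
  simpa [ENNReal.toReal_ofReal] using h2

theorem summable_indicator (h : AtomFamily N α ψ) (hN : d + 1 ≤ N) (𝓐 : Set (DyadicCube d))
    (x : EuclideanSpace ℝ (Fin d)) : Summable (𝓐.indicator fun I => ψ I x) :=
  (h.summable_norm hN x).of_norm.indicator 𝓐

theorem psum_union (h : AtomFamily N α ψ) (hN : d + 1 ≤ N) {𝓐 𝓑 : Set (DyadicCube d)}
    (hd : Disjoint 𝓐 𝓑) (x : EuclideanSpace ℝ (Fin d)) :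
    psum ψ (𝓐 ∪ 𝓑) x = psum ψ 𝓐 x + psum ψ 𝓑 x := by
  unfold psum
  rw [← (h.summable_indicator hN 𝓐 x).tsum_add (h.summable_indicator hN 𝓑 x)]
  refine tsum_congr fun I => ?_
  rw [Set.indicator_union_of_disjoint hd]

theorem enorm_psum_le_tsum (ψ : DyadicCube d → EuclideanSpace ℝ (Fin d) → ℂ)
    (𝓐 : Set (DyadicCube d)) (x : EuclideanSpace ℝ (Fin d)) :
    ‖psum ψ 𝓐 x‖ₑ ≤ ∑' I : 𝓐, ‖ψ I x‖ₑ := by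
  unfold psum
  rw [tsum_subtype 𝓐 (fun I => ‖ψ I x‖ₑ)]
  refine enorm_tsum_le_tsum_enorm.trans (ENNReal.tsum_le_tsum fun I => ?_)
  by_cases hI : I ∈ 𝓐 <;> simp [hI]

theorem enorm_psum_le (h : AtomFamily N α ψ) (𝓐 : Set (DyadicCube d))
    (x : EuclideanSpace ℝ (Fin d)) : ‖psum ψ 𝓐 x‖ₑ ≤ ∑' I : 𝓐, α I * I.1.ker N x :=
  (enorm_psum_le_tsum ψ 𝓐 x).trans (ENNReal.tsum_le_tsum fun I => (h.atom I).size x)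

theorem lintegral_psum_sq_le (h : AtomFamily N α ψ) (hN : 2 * d + 3 ≤ N)
    (𝓐 : Set (DyadicCube d)) :
    ∫⁻ x, ‖psum ψ 𝓐 x‖ₑ ^ 2 ≤
      8 * kerMass d * kerConst d * ∑' I : 𝓐, α I ^ 2 * volume I.1.toSet := by
  classical
  obtain ⟨s, hs⟩ := exists_tendsto_finset (DyadicCube d)
  have hlim : ∀ x, Tendsto (fun n => ‖∑ I ∈ (s n).filter (· ∈ 𝓐), ψ I x‖ₑ ^ 2) atTop
      (nhds (‖psum ψ 𝓐 x‖ₑ ^ 2)) := fun x => by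
    have h1 := (h.summable_indicator (by omega) 𝓐 x).hasSum.comp hs
    have h2 : ∀ n, ∑ I ∈ (s n).filter (· ∈ 𝓐), ψ I x =
        ∑ I ∈ s n, 𝓐.indicator (fun I => ψ I x) I := fun n => by
      rw [Finset.sum_filter]
      exact Finset.sum_congr rfl fun I _ => by simp [Set.indicator_apply]
    simp only [h2]
    exact ((ENNReal.continuous_pow 2).tendsto _).comp h1.enorm
  calc ∫⁻ x, ‖psum ψ 𝓐 x‖ₑ ^ 2
      = ∫⁻ x, liminf (fun n => ‖∑ I ∈ (s n).filter (· ∈ 𝓐), ψ I x‖ₑ ^ 2) atTop :=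
        lintegral_congr fun x => (hlim x).liminf_eq.symm
    _ ≤ liminf (fun n => ∫⁻ x, ‖∑ I ∈ (s n).filter (· ∈ 𝓐), ψ I x‖ₑ ^ 2) atTop := by
        refine lintegral_liminf_le fun n => ?_
        exact (continuous_finsetSum _ fun I _ => (h.atom I).continuous).enorm.measurable.pow_const 2
    _ ≤ _ := by
        refine (liminf_le_liminf (v := fun _ => 8 * kerMass d * kerConst d *
          ∑' I : 𝓐, α I ^ 2 * volume I.1.toSet) (Eventually.of_forall fun n => ?_)).trans_eq
          (liminf_const _)
        refine (lintegral_enorm_sum_sq_le hN h.ne_top h.atom _).trans ?_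
        gcongr
        rw [tsum_subtype 𝓐 (fun I : DyadicCube d => α I ^ 2 * volume I.toSet), Finset.sum_filter]
        refine le_trans (Finset.sum_le_sum fun I _ => ?_) (ENNReal.sum_le_tsum (s n))
        simp [Set.indicator_apply]

end AtomFamily

end

/-! ### Stopping cubes -/

section

open DyadicCube
open Filter hiding ker

variable {d : ℕ}

namespace DyadicCube

/-- The cubes with side length in `(2^a, 2^b]`. -/
def band (a b : ℤ) : Set (DyadicCube d) := {I | a < I.k ∧ I.k ≤ b}

theorem disjoint_band_level (a b : ℤ) : Disjoint (band a b : Set (DyadicCube d)) (level a) :=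
  Set.disjoint_left.2 fun I h1 h2 => by
    simp only [band, level, Set.mem_ofPred_eq] at h1 h2; omega

end DyadicCube

/-- `P` dominates its ancestors in the sense of the averages. -/
def IsGood (p₁ : ℝ) (α : DyadicCube d → ℝ≥0∞) (P : DyadicCube d) : Prop :=
  avgStar p₁ α P ≤ 2 * avg3 p₁ α P

/-- The stopping condition for subcubes `P` of `Q`. -/
def Stops (p₁ : ℝ) (α : DyadicCube d → ℝ≥0∞) (ψ : DyadicCube d → EuclideanSpace ℝ (Fin d) → ℂ)
    (Λ lam : ℝ≥0∞) (Q P : DyadicCube d) : Prop :=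
  P.toSet ⊆ Q.toSet ∧ P ≠ Q ∧ IsGood p₁ α P ∧
    (Λ * avgStar p₁ α Q < avgStar p₁ α P ∨
      ∃ y ∈ P.toSet, lam * avgStar p₁ α Q < ‖psum ψ (band P.k Q.k) y‖ₑ)

/-- The maximal stopping subcubes of `Q`. -/
def stopChildren (p₁ : ℝ) (α : DyadicCube d → ℝ≥0∞)
    (ψ : DyadicCube d → EuclideanSpace ℝ (Fin d) → ℂ) (Λ lam : ℝ≥0∞) (Q : DyadicCube d) :
    Set (DyadicCube d) := maximals {P | Stops p₁ α ψ Λ lam Q P}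

/-- `P ⊆ Q` is not contained in any stopping subcube of `Q`. -/
def Unstopped (p₁ : ℝ) (α : DyadicCube d → ℝ≥0∞)
    (ψ : DyadicCube d → EuclideanSpace ℝ (Fin d) → ℂ) (Λ lam : ℝ≥0∞) (Q P : DyadicCube d) : Prop :=
  P.toSet ⊆ Q.toSet ∧ ∀ R, Stops p₁ α ψ Λ lam Q R → ¬ P.toSet ⊆ R.toSet

/-- Exponents of decay for which the argument works. -/
def Admissible (d : ℕ) (p₁ : ℝ) (N : ℕ) : Prop := 2 * d + 4 + growth d p₁ ≤ N

section Finite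

variable {N : ℕ} {α : DyadicCube d → ℝ≥0∞} {ψ : DyadicCube d → EuclideanSpace ℝ (Fin d) → ℂ}
  {p₁ : ℝ}

theorem tsum_sq_le_sq_tsum {ι : Type*} (a : ι → ℝ≥0∞) : ∑' i, a i ^ 2 ≤ (∑' i, a i) ^ 2 := by
  rw [sq, ← ENNReal.tsum_mul_right]
  refine ENNReal.tsum_le_tsum fun i => ?_
  rw [sq]
  gcongr
  exact ENNReal.le_tsum i

theorem lsq_le (α : DyadicCube d → ℝ≥0∞) (Q : DyadicCube d) (x : EuclideanSpace ℝ (Fin d)) :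
    lsq α Q x ≤ ∑' k : ℤ, ⨆ I ∈ (level k : Set (DyadicCube d)), α I := by
  set s : ℤ → ℝ≥0∞ := fun k => ⨆ I ∈ (level k : Set (DyadicCube d)), α I
  have hinj : Function.Injective fun k : ℤ => cubeAt k x := fun k l h => congrArg DyadicCube.k h
  have h1 : ∑' I : {I : DyadicCube d | I.toSet ⊆ Q.toSet},
      I.1.toSet.indicator (fun _ => α I ^ 2) x ≤ (∑' k, s k) ^ 2 := by
    refine le_trans ?_ (tsum_sq_le_sq_tsum s)
    calc ∑' I : {I : DyadicCube d | I.toSet ⊆ Q.toSet}, I.1.toSet.indicator (fun _ => α I ^ 2) x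
        ≤ ∑' I : (Set.range fun k : ℤ => cubeAt k x), s I.1.k ^ 2 := by
          rw [tsum_subtype {I : DyadicCube d | I.toSet ⊆ Q.toSet}
            (fun I : DyadicCube d => I.toSet.indicator (fun _ => α I ^ 2) x),
            tsum_subtype (Set.range fun k : ℤ => cubeAt k x)
            (fun I : DyadicCube d => s I.k ^ 2)]
          refine ENNReal.tsum_le_tsum fun I => ?_
          by_cases hx : x ∈ I.toSet
          · rw [Set.indicator_of_mem (s := Set.range fun k : ℤ => cubeAt k x)
              ⟨I.k, mem_iff.1 hx⟩]
            refine (Set.indicator_le_self _ _ _).trans ?_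
            rw [Set.indicator_of_mem hx]
            gcongr
            exact le_iSup₂ (f := fun (J : DyadicCube d) (_ : J ∈ level I.k) => α J) I rfl
          · by_cases hI : I ∈ {I : DyadicCube d | I.toSet ⊆ Q.toSet}
            · rw [Set.indicator_of_mem hI, Set.indicator_of_notMem hx]; exact zero_le
            · rw [Set.indicator_of_notMem hI]; exact zero_le
      _ = ∑' k : ℤ, s k ^ 2 := by
          rw [tsum_range (fun I : DyadicCube d => s I.k ^ 2) hinj]
          rfl
  calc lsq α Q x ≤ ((∑' k, s k) ^ 2) ^ (1 / 2 : ℝ) := by unfold lsq; gcongr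
    _ = _ := sq_rpow_half _

theorem AtomFamily.avg3_ne_top (h : AtomFamily N α ψ) (hp₁ : 0 < p₁) (Q : DyadicCube d) : avg3 p₁ α Q ≠ ∞ := by
  unfold avg3
  refine (ENNReal.sum_lt_top.2 fun v _ => ?_).ne
  exact (avg_le_of_le hp₁ fun x _ => lsq_le α _ x).trans_lt h.summable.lt_top

theorem AtomFamily.avgStar_ne_top (h : AtomFamily N α ψ) (hp₁ : 0 < p₁) (Q : DyadicCube d) : avgStar p₁ α Q ≠ ∞ := by
  set s := ∑' k : ℤ, ⨆ I ∈ (level k : Set (DyadicCube d)), α I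
  set B : ℝ≥0∞ := ∑ _v : Fin d → Fin 3, s
  have hB : B ≠ ∞ := by simp [B, ENNReal.mul_eq_top, h.summable, s]
  have h1 : ∀ R, avg3 p₁ α R ≤ B := fun R =>
    Finset.sum_le_sum fun v _ => avg_le_of_le hp₁ fun x _ => lsq_le α _ x
  have h2 : avgStar p₁ α Q ≤ (∑' j : ℕ, 4⁻¹ ^ j) * B := by
    unfold avgStar
    rw [← ENNReal.tsum_mul_right]
    exact ENNReal.tsum_le_tsum fun j => by gcongr; exact h1 _
  refine ne_top_of_le_ne_top (ENNReal.mul_ne_top ?_ hB) h2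
  rw [ENNReal.tsum_geometric]
  refine ENNReal.inv_ne_top.2 (tsub_pos_of_lt ?_).ne'
  rw [ENNReal.inv_lt_one]; norm_num

end Finite

theorem exists_iterate_parent [NeZero d] {P Q : DyadicCube d} (hPQ : P.toSet ⊆ Q.toSet) (hne : P ≠ Q) :
    (P.anc 1).toSet ⊆ Q.toSet := by
  have hk := k_lt_of_ssubset hPQ hne
  refine subset_iff.2 ⟨by simp only [anc_k]; omega, ?_⟩
  unfold anc
  rw [up_up _ (by omega) (by omega), (subset_iff.1 hPQ).2]

/-- Induction from `Q` downwards along dyadic parents. -/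
theorem down_induction [NeZero d] {Q : DyadicCube d} {motive : DyadicCube d → Prop}
    (base : motive Q)
    (step : ∀ P : DyadicCube d, P.toSet ⊆ Q.toSet → P ≠ Q → motive (P.anc 1) → motive P)
    {P : DyadicCube d} (hP : P.toSet ⊆ Q.toSet) : motive P := by
  induction hn : (Q.k - P.k).toNat generalizing P with
  | zero =>
    have hk := k_le_of_subset hP
    rw [eq_of_subset_of_k hP (by omega)]; exact base
  | succ n ih =>
    have hne : P ≠ Q := by rintro rfl; simp at hn
    refine step P hP hne (ih (exists_iterate_parent hP hne) ?_)
    simp only [anc_k]; omega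

variable {N : ℕ} {α : DyadicCube d → ℝ≥0∞}
  {ψ : DyadicCube d → EuclideanSpace ℝ (Fin d) → ℂ} {p₁ : ℝ} {Λ lam : ℝ≥0∞} {Q P : DyadicCube d}

theorem Unstopped.mono (h : Unstopped p₁ α ψ Λ lam Q P) {R : DyadicCube d}
    (hPR : P.toSet ⊆ R.toSet) (hR : R.toSet ⊆ Q.toSet) : Unstopped p₁ α ψ Λ lam Q R :=
  ⟨hR, fun S hS hRS => h.2 S hS (hPR.trans hRS)⟩

theorem Unstopped.not_stops (h : Unstopped p₁ α ψ Λ lam Q P) : ¬ Stops p₁ α ψ Λ lam Q P :=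
  fun hs => h.2 P hs subset_rfl


theorem Unstopped.avgStar_le [NeZero d] (h : AtomFamily N α ψ) (hp₁ : 0 < p₁) (hΛ : 1 ≤ Λ)
    (hP : Unstopped p₁ α ψ Λ lam Q P) : avgStar p₁ α P ≤ Λ * avgStar p₁ α Q := by
  refine down_induction (Q := Q) (motive := fun P => Unstopped p₁ α ψ Λ lam Q P →
    avgStar p₁ α P ≤ Λ * avgStar p₁ α Q) (fun _ => le_mul_of_one_le_left zero_le hΛ) ?_ hP.1 hP
  · intro P hPQ hne ih hP
    by_cases hg : IsGood p₁ α P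
    · by_contra! hlt
      exact hP.not_stops ⟨hPQ, hne, hg, Or.inl hlt⟩
    · have h1 := avgStar_le_of_not_good (h.avg3_ne_top hp₁ P) hg
      have h2 := ih (hP.mono (P.subset_anc 1) (exists_iterate_parent hPQ hne))
      calc avgStar p₁ α P ≤ 2 * avgStar p₁ α P := le_mul_of_one_le_left zero_le (by norm_num)
        _ ≤ _ := h1.trans h2

theorem Unstopped.enorm_psum_add_le [NeZero d] (h : AtomFamily N α ψ) (hN : Admissible d p₁ N) (hp₁ : 0 < p₁)
    (hΛ : 1 ≤ Λ) (hP : Unstopped p₁ α ψ Λ lam Q P) {y : EuclideanSpace ℝ (Fin d)}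
    (hy : y ∈ P.toSet) :
    ‖psum ψ (band P.k Q.k) y‖ₑ + 2 * starConst d p₁ * avgStar p₁ α P ≤
      (lam + 2 * starConst d p₁ * Λ) * avgStar p₁ α Q := by
  unfold Admissible at hN
  refine down_induction (Q := Q) (motive := fun P => Unstopped p₁ α ψ Λ lam Q P → y ∈ P.toSet →
    ‖psum ψ (band P.k Q.k) y‖ₑ + 2 * starConst d p₁ * avgStar p₁ α P ≤
      (lam + 2 * starConst d p₁ * Λ) * avgStar p₁ α Q) ?_ ?_ hP.1 hP hy
  · intro _ _
    have : psum ψ (band Q.k Q.k) y = 0 := by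
      have : (band Q.k Q.k : Set (DyadicCube d)) = ∅ :=
        Set.eq_empty_of_forall_notMem fun I hI => not_lt.2 hI.2 hI.1
      simp [psum, this]
    rw [this, enorm_zero, zero_add, add_mul]
    refine le_trans ?_ le_add_self
    rw [mul_assoc _ Λ]
    gcongr
    exact le_mul_of_one_le_left zero_le hΛ
  · intro P hPQ hne ih hP hy
    by_cases hg : IsGood p₁ α P
    · rw [add_mul, mul_assoc _ Λ]
      refine add_le_add ?_ (mul_le_mul_right (hP.avgStar_le h hp₁ hΛ) _)
      by_contra! hlt
      exact hP.not_stops ⟨hPQ, hne, hg, Or.inr ⟨y, hy, hlt⟩⟩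
    · have h1 := avgStar_le_of_not_good (h.avg3_ne_top hp₁ P) hg
      have hpar := exists_iterate_parent hPQ hne
      have h2 := ih (hP.mono (P.subset_anc 1) hpar) (P.subset_anc 1 hy)
      have hk := k_le_of_subset hpar
      have hlevel := tsum_level_le hp₁ α (N := N) (by omega) (P.subset_anc 1 hy)
      have hsplit : psum ψ (band P.k Q.k) y =
          psum ψ (band (P.anc 1).k Q.k) y + psum ψ (level (P.anc 1).k) y := by
        rw [← h.psum_union (by omega)]
        · congr 1
          ext I
          simp only [anc_k] at hk ⊢
          simp only [band, level, Set.mem_union, Set.mem_ofPred_eq]; omega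
        · exact disjoint_band_level _ _
      set C := starConst d p₁
      calc ‖psum ψ (band P.k Q.k) y‖ₑ + 2 * C * avgStar p₁ α P
          ≤ (‖psum ψ (band (P.anc 1).k Q.k) y‖ₑ + C * avgStar p₁ α (P.anc 1)) +
              C * avgStar p₁ α (P.anc 1) := by
            refine add_le_add ?_ ?_
            · rw [hsplit]
              refine (enorm_add_le _ _).trans (add_le_add le_rfl ?_)
              exact (h.enorm_psum_le _ y).trans hlevel
            · rw [mul_comm (2 : ℝ≥0∞), mul_assoc]
              gcongr
        _ = ‖psum ψ (band (P.anc 1).k Q.k) y‖ₑ + 2 * C * avgStar p₁ α (P.anc 1) := by ring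
        _ ≤ _ := h2

/-- The constant in the bound for the oscillation of partial sums. -/
def oscConst (d N : ℕ) (p₁ : ℝ) : ℝ≥0∞ :=
  ENNReal.ofReal (d * (1 + d : ℝ) ^ N) * starConst d p₁

theorem oscConst_ne_top (d N : ℕ) (p₁ : ℝ) : oscConst d N p₁ ≠ ∞ :=
  ENNReal.mul_ne_top ENNReal.ofReal_ne_top (starConst_ne_top d p₁)

theorem AtomFamily.enorm_psum_sub_le [NeZero d] (h : AtomFamily N α ψ) (hN : Admissible d p₁ N) (hp₁ : 0 < p₁)
    {K : ℤ} {L : ℝ≥0∞} (hL : ∀ k, P.k < k → k ≤ K → avgStar p₁ α (P.up k) ≤ L)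
    {𝓐 : Set (DyadicCube d)} (hA : 𝓐 ⊆ band P.k K) {y z : EuclideanSpace ℝ (Fin d)}
    (hy : y ∈ P.toSet) (hz : z ∈ P.toSet) :
    ‖psum ψ 𝓐 y - psum ψ 𝓐 z‖ₑ ≤ oscConst d N p₁ * L := by
  unfold Admissible at hN
  have hN1 : d + 1 ≤ N := by omega
  have hsub : psum ψ 𝓐 y - psum ψ 𝓐 z = ∑' I, 𝓐.indicator (fun I => ψ I y - ψ I z) I := by
    unfold psum
    rw [← (h.summable_indicator hN1 𝓐 y).tsum_sub (h.summable_indicator hN1 𝓐 z)]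
    refine tsum_congr fun I => ?_
    by_cases hI : I ∈ 𝓐 <;> simp [hI]
  set D : ℝ≥0∞ := ENNReal.ofReal (d * (1 + d : ℝ) ^ N) with hD
  have hterm : ∀ i : ℕ, ∀ I ∈ 𝓐 ∩ level (P.k + 1 + i),
      ‖ψ I y - ψ I z‖ₑ ≤ D * 2⁻¹ ^ (i + 1) * (α I * I.ker N y) := by
    rintro i I ⟨hI, hIk⟩
    have hIk' : I.k = P.k + 1 + i := hIk
    refine ((h.atom I).smooth N le_rfl y z).trans ?_
    have hside : I.side = 2 ^ (i + 1) * P.side := by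
      rw [side_eq_pow_mul (I := P) (J := I) (by omega)]
      congr 2; omega
    have hP := P.side_pos
    have hI0 := I.side_pos
    have ht : ‖y - z‖ / I.side ≤ d * 2⁻¹ ^ (i + 1) := by
      rw [div_le_iff₀ hI0, hside]
      have := P.norm_sub_le hy hz
      calc _ ≤ d * P.side := this
        _ = d * ((2⁻¹ * 2) ^ (i + 1) * P.side) := by norm_num
        _ = _ := by rw [mul_pow]; ring
    have ht0 : 0 ≤ ‖y - z‖ / I.side := by positivity
    have ht1 : ‖y - z‖ / I.side ≤ d := ht.trans
      (mul_le_of_le_one_right (by positivity) (pow_le_one₀ (by norm_num) (by norm_num)))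
    have e : (2⁻¹ : ℝ≥0∞) ^ (i + 1) = ENNReal.ofReal (2⁻¹ ^ (i + 1)) := by
      rw [ENNReal.ofReal_pow (by norm_num), ENNReal.ofReal_inv_of_pos (by norm_num)]; simp
    have h1 : ENNReal.ofReal (‖y - z‖ / I.side * (1 + ‖y - z‖ / I.side) ^ N) ≤
        D * 2⁻¹ ^ (i + 1) := by
      rw [e, hD, ← ENNReal.ofReal_mul (by positivity)]
      refine ENNReal.ofReal_le_ofReal ?_
      calc _ ≤ (d * 2⁻¹ ^ (i + 1)) * (1 + d : ℝ) ^ N := by gcongr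
        _ = _ := by ring
    calc _ ≤ α I * (D * 2⁻¹ ^ (i + 1)) * I.ker N y := by gcongr
      _ = _ := by ring
  have hcov : 𝓐 ⊆ ⋃ i : ℕ, (𝓐 ∩ level (P.k + 1 + i)) := fun I hI => by
    have := (hA hI).1
    refine Set.mem_iUnion.2 ⟨(I.k - P.k - 1).toNat, hI, ?_⟩
    simp only [level, Set.mem_ofPred_eq]; omega
  rw [hsub]
  calc ‖∑' I, 𝓐.indicator (fun I => ψ I y - ψ I z) I‖ₑ
      ≤ ∑' I : 𝓐, ‖ψ I y - ψ I z‖ₑ := by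
        rw [tsum_subtype 𝓐 (fun I => ‖ψ I y - ψ I z‖ₑ)]
        refine enorm_tsum_le_tsum_enorm.trans (ENNReal.tsum_le_tsum fun I => ?_)
        by_cases hI : I ∈ 𝓐 <;> simp [hI]
    _ ≤ ∑' i : ℕ, ∑' I : (𝓐 ∩ level (P.k + 1 + i) : Set (DyadicCube d)), ‖ψ I y - ψ I z‖ₑ :=
        (ENNReal.tsum_mono_subtype (fun I => ‖ψ I y - ψ I z‖ₑ) hcov).trans
          (ENNReal.tsum_iUnion_le_tsum (fun I => ‖ψ I y - ψ I z‖ₑ) _)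
    _ ≤ ∑' i : ℕ, D * 2⁻¹ ^ (i + 1) * (starConst d p₁ * L) := by
        refine ENNReal.tsum_le_tsum fun i => ?_
        by_cases hi : P.k + 1 + i ≤ K
        · calc ∑' I : (𝓐 ∩ level (P.k + 1 + i) : Set (DyadicCube d)), ‖ψ I y - ψ I z‖ₑ
              ≤ ∑' I : (𝓐 ∩ level (P.k + 1 + i) : Set (DyadicCube d)),
                  D * 2⁻¹ ^ (i + 1) * (α I * I.1.ker N y) :=
                ENNReal.tsum_le_tsum fun I => hterm i I I.2
            _ ≤ D * 2⁻¹ ^ (i + 1) *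
                ∑' I : (level (P.k + 1 + i) : Set (DyadicCube d)), α I * I.1.ker N y := by
                rw [ENNReal.tsum_mul_left]
                gcongr
                exact ENNReal.tsum_mono_subtype (fun I : DyadicCube d => α I * I.ker N y)
                  Set.inter_subset_right
            _ ≤ _ := by
                gcongr
                refine (tsum_level_le hp₁ α (Q := P.up (P.k + 1 + i)) (N := N) (by omega)
                  (P.subset_up (by omega) hy)).trans ?_
                gcongr
                exact hL _ (by omega) hi
        · have : (𝓐 ∩ level (P.k + 1 + i) : Set (DyadicCube d)) = ∅ := by
            refine Set.eq_empty_of_forall_notMem fun I hI => hi ?_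
            have h1 := (hA hI.1).2
            have h2 : I.k = P.k + 1 + i := hI.2
            omega
          rw [this]
          simp
    _ = D * (∑' i : ℕ, 2⁻¹ ^ (i + 1)) * (starConst d p₁ * L) := by
        rw [ENNReal.tsum_mul_right, ENNReal.tsum_mul_left]
    _ = _ := by
        rw [ENNReal.tsum_geometric_add_one, ENNReal.one_sub_inv_two, inv_inv,
          ENNReal.inv_mul_cancel (by norm_num) (by norm_num), oscConst]
        ring

/-- On `Q` and off the stopping children, the sum over cubes up to the size of `Q` is bounded. -/
theorem AtomFamily.enorm_psum_le_of_notMem [NeZero d] (h : AtomFamily N α ψ) (hN : Admissible d p₁ N)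
    (hp₁ : 0 < p₁) (hΛ : 1 ≤ Λ) {x : EuclideanSpace ℝ (Fin d)} (hx : x ∈ Q.toSet)
    (hnot : ∀ P ∈ stopChildren p₁ α ψ Λ lam Q, x ∉ P.toSet) :
    ‖psum ψ {I | I.k ≤ Q.k} x‖ₑ ≤ (lam + 2 * starConst d p₁ * Λ) * avgStar p₁ α Q := by
  have hN1 : d + 1 ≤ N := by unfold Admissible at hN; omega
  have hbound : ∀ n : ℕ, ‖psum ψ (band (Q.k - n) Q.k) x‖ₑ ≤
      (lam + 2 * starConst d p₁ * Λ) * avgStar p₁ α Q := fun n => by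
    set P := cubeAt (Q.k - n) x with hPdef
    have hxP : x ∈ P.toSet := mem_cubeAt _ _
    have hPQ : P.toSet ⊆ Q.toSet := subset_of_mem hxP hx (by simp [P])
    have hun : Unstopped p₁ α ψ Λ lam Q P := by
      refine ⟨hPQ, fun R hR hPR => ?_⟩
      obtain ⟨R', hR', hsub⟩ := exists_maximals (𝓔 := {P | Stops p₁ α ψ Λ lam Q P}) (K := Q.k)
        (fun S hS => k_le_of_subset hS.1) hR
      exact hnot R' hR' (hsub (hPR hxP))
    exact le_self_add.trans (hun.enorm_psum_add_le h hN hp₁ hΛ hxP)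
  have hlim : Tendsto (fun n : ℕ => psum ψ (band (Q.k - n) Q.k) x) atTop
      (nhds (psum ψ {I | I.k ≤ Q.k} x)) := by
    unfold psum
    refine tendsto_tsum_of_dominated_convergence (h.summable_norm hN1 x) (fun I => ?_)
      (Eventually.of_forall fun n I => ?_)
    · refine tendsto_const_nhds.congr' ?_
      filter_upwards [eventually_ge_atTop (Q.k - I.k + 1).toNat] with n hn
      have : I ∈ (band (Q.k - n) Q.k : Set (DyadicCube d)) ↔ I ∈ {I : DyadicCube d | I.k ≤ Q.k} := by
        simp only [band, Set.mem_ofPred_eq]; omega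
      by_cases hI : I ∈ {I : DyadicCube d | I.k ≤ Q.k}
      · rw [Set.indicator_of_mem hI, Set.indicator_of_mem (this.2 hI)]
      · rw [Set.indicator_of_notMem hI, Set.indicator_of_notMem (fun h => hI (this.1 h))]
    · exact norm_indicator_le_norm_self _ _
  exact le_of_tendsto hlim.enorm (Eventually.of_forall hbound)

theorem Unstopped.of_mem_stopChildren [NeZero d] (hP : P ∈ stopChildren p₁ α ψ Λ lam Q) :
    Unstopped p₁ α ψ Λ lam Q (P.anc 1) := by
  refine ⟨exists_iterate_parent hP.1.1 hP.1.2.1, fun R hR hsub => ?_⟩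
  have h1 := hP.2 R hR ((P.subset_anc 1).trans hsub)
  have h2 := k_le_of_subset hsub
  rw [h1, anc_k] at h2
  omega

/-- On a stopping child `P` of `Q`, the sum over cubes between `P` and `Q` is bounded. -/
theorem AtomFamily.enorm_psum_band_le_of_mem [NeZero d] (h : AtomFamily N α ψ) (hN : Admissible d p₁ N)
    (hp₁ : 0 < p₁) (hΛ : 1 ≤ Λ) {x : EuclideanSpace ℝ (Fin d)}
    (hP : P ∈ stopChildren p₁ α ψ Λ lam Q) (hx : x ∈ P.toSet) :
    ‖psum ψ (band P.k Q.k) x‖ₑ ≤ (lam + 3 * starConst d p₁ * Λ) * avgStar p₁ α Q := by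
  have hun := Unstopped.of_mem_stopChildren hP
  have hk := k_le_of_subset hun.1
  have h1 := hun.enorm_psum_add_le h hN hp₁ hΛ (P.subset_anc 1 hx)
  have h2 := hun.avgStar_le h hp₁ hΛ
  unfold Admissible at hN
  have hlevel := tsum_level_le hp₁ α (N := N) (by omega) (P.subset_anc 1 hx)
  have hsplit : psum ψ (band P.k Q.k) x =
      psum ψ (band (P.anc 1).k Q.k) x + psum ψ (level (P.anc 1).k) x := by
    rw [← h.psum_union (by omega)]
    · congr 1
      ext I
      simp only [anc_k] at hk ⊢
      simp only [band, level, Set.mem_union, Set.mem_ofPred_eq]; omega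
    · exact disjoint_band_level _ _
  rw [hsplit]
  calc _ ≤ (lam + 2 * starConst d p₁ * Λ) * avgStar p₁ α Q +
        starConst d p₁ * (Λ * avgStar p₁ α Q) := by
        refine (enorm_add_le _ _).trans (add_le_add (le_self_add.trans h1) ?_)
        refine (h.enorm_psum_le _ x).trans (hlevel.trans ?_)
        gcongr
    _ = _ := by ring

end

/-! ### Exceptional cubes -/

section

open DyadicCube
open Filter hiding ker

variable {d : ℕ}

/-- The number of cubes near a given cube. -/
def nearCount (d : ℕ) : ℝ≥0∞ := (Fintype.card (Fin d → Fin 3) : ℝ≥0∞)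

theorem nearCount_ne_top (d : ℕ) : nearCount d ≠ ∞ := ENNReal.natCast_ne_top _

theorem one_le_nearCount (d : ℕ) : 1 ≤ nearCount d := by
  unfold nearCount
  exact_mod_cast Fintype.card_pos

theorem In3.of_subset [NeZero d] {I R Q : DyadicCube d} (hR : In3 R Q) (h : I.toSet ⊆ R.toSet) :
    In3 I Q := by
  obtain ⟨h1, h2⟩ := subset_iff.1 h
  refine ⟨h1.trans hR.1, ?_⟩
  rw [← up_up I h1 hR.1, h2]; exact hR.2

/-- The cubes in `3Q` on which the local square function has a large average. -/
def exceptional (p₁ : ℝ) (α : DyadicCube d → ℝ≥0∞) (μ : ℝ≥0∞) (Q : DyadicCube d) :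
    Set (DyadicCube d) :=
  {R | In3 R Q ∧ (μ * avgStar p₁ α Q) ^ p₁ * volume R.toSet ≤
    ∫⁻ x in R.toSet, lsq α (R.up Q.k) x ^ p₁}

/-- The cubes in `3Q` that lie in no exceptional cube. -/
def regular (p₁ : ℝ) (α : DyadicCube d → ℝ≥0∞) (μ : ℝ≥0∞) (Q : DyadicCube d) :
    Set (DyadicCube d) :=
  {I | In3 I Q ∧ ∀ R ∈ exceptional p₁ α μ Q, ¬ I.toSet ⊆ R.toSet}

/-- The cubes that lie in some exceptional cube. -/
def singular (p₁ : ℝ) (α : DyadicCube d → ℝ≥0∞) (μ : ℝ≥0∞) (Q : DyadicCube d) :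
    Set (DyadicCube d) :=
  {I | ∃ R ∈ exceptional p₁ α μ Q, I.toSet ⊆ R.toSet}

/-- The union of the threefold dilates of the maximal exceptional cubes. -/
def exceptionalSet (p₁ : ℝ) (α : DyadicCube d → ℝ≥0∞) (μ : ℝ≥0∞) (Q : DyadicCube d) :
    Set (EuclideanSpace ℝ (Fin d)) :=
  ⋃ R ∈ maximals (exceptional p₁ α μ Q), ⋃ v, (R.shift v).toSet

variable {N : ℕ} {α : DyadicCube d → ℝ≥0∞}
  {ψ : DyadicCube d → EuclideanSpace ℝ (Fin d) → ℂ} {p₁ : ℝ} {Λ lam μ : ℝ≥0∞} {Q P R : DyadicCube d}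

theorem avg_le_of_notMem_exceptional (hp₁ : 0 < p₁) (hR : In3 R Q)
    (hn : R ∉ exceptional p₁ α μ Q) : avg p₁ α R ≤ μ * avgStar p₁ α Q := by
  have h1 : ∫⁻ x in R.toSet, lsq α (R.up Q.k) x ^ p₁ <
      (μ * avgStar p₁ α Q) ^ p₁ * volume R.toSet := by
    by_contra! hle
    exact hn ⟨hR, hle⟩
  have h2 : avg p₁ α R ^ p₁ * volume R.toSet ≤ (μ * avgStar p₁ α Q) ^ p₁ * volume R.toSet := by
    rw [avg_rpow_mul_volume hp₁, lintegral_lsq_rpow hp₁]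
    refine le_trans (lintegral_mono fun x => ?_) h1.le
    gcongr
    exact lsq_mono α (R.subset_up hR.1) x
  rw [ENNReal.mul_le_mul_iff_left R.volume_ne_zero R.volume_ne_top] at h2
  exact (ENNReal.rpow_le_rpow_iff hp₁).1 h2

theorem avg_le_of_mem_maximals [NeZero d] (hp₁ : 0 < p₁) (hμ : 1 ≤ μ)
    (hR : R ∈ maximals (exceptional p₁ α μ Q)) :
    avg p₁ α R ≤ 2 ^ growth d p₁ * (μ * avgStar p₁ α Q) := by
  obtain ⟨hk, hnear⟩ := hR.1.1
  rcases eq_or_lt_of_le hk with hk' | hk'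
  · rw [← hk', up_self] at hnear
    refine (avg_le_avg3 p₁ α hnear).trans ((avg3_le_avgStar p₁ α Q).trans ?_)
    rw [← mul_assoc]
    exact le_mul_of_one_le_left zero_le (one_le_mul (one_le_pow₀ (by norm_num)) hμ)
  · have hin : In3 (R.anc 1) Q := by
      refine ⟨by simp only [anc_k]; omega, ?_⟩
      unfold anc
      rw [up_up _ (by omega) (by omega)]; exact hnear
    have hn : R.anc 1 ∉ exceptional p₁ α μ Q := fun hmem => by
      have := congrArg DyadicCube.k (hR.2 _ hmem (R.subset_anc 1))
      rw [anc_k] at this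
      omega
    have h1 := avg_le_of_subset hp₁ α (R.subset_anc 1)
    have h2 : ((R.anc 1).k - R.k).toNat = 1 := by simp
    rw [h2, one_mul] at h1
    exact h1.trans (mul_le_mul_right (avg_le_of_notMem_exceptional hp₁ hin hn) _)

theorem tsum_maximals_exceptional_le (hp₁ : 0 < p₁) (hB0 : avgStar p₁ α Q ≠ 0)
    (hBt : avgStar p₁ α Q ≠ ∞) :
    μ ^ p₁ * ∑' R : maximals (exceptional p₁ α μ Q), volume R.1.toSet ≤
      nearCount d * volume Q.toSet := by
  set B := avgStar p₁ α Q
  set M := maximals (exceptional p₁ α μ Q)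
  set G : EuclideanSpace ℝ (Fin d) → ℝ≥0∞ := fun x => ∑ v, lsq α (Q.shift v) x ^ p₁
  have hB0' : B ^ p₁ ≠ 0 := (ENNReal.rpow_pos (pos_iff_ne_zero.2 hB0) hBt).ne'
  have hBt' : B ^ p₁ ≠ ∞ := ENNReal.rpow_ne_top_of_nonneg hp₁.le hBt
  have h1 : ∀ R : M, (μ * B) ^ p₁ * volume R.1.toSet ≤ ∫⁻ x in R.1.toSet, G x := fun R => by
    refine R.2.1.2.trans (lintegral_mono fun x => ?_)
    obtain ⟨v, hv⟩ := near_iff.1 R.2.1.1.2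
    rw [hv]
    exact Finset.single_le_sum (f := fun v => lsq α (Q.shift v) x ^ p₁) (fun _ _ => zero_le)
      (Finset.mem_univ v)
  have h2 : ∑' R : M, ∫⁻ x in R.1.toSet, G x ≤ ∫⁻ x, G x := by
    rw [← lintegral_iUnion (fun R : M => R.1.measurableSet)]
    · exact setLIntegral_le_lintegral _ _
    · intro R S hne
      exact maximals_pairwiseDisjoint _ R.2 S.2 fun h => hne (Subtype.ext h)
  have h3 : ∫⁻ x, G x ≤ nearCount d * (B ^ p₁ * volume Q.toSet) := by
    rw [lintegral_finsetSum _ fun v _ => (measurable_lsq α _).pow_const p₁]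
    calc ∑ v, ∫⁻ x, lsq α (Q.shift v) x ^ p₁ ≤ ∑ _v : Fin d → Fin 3, B ^ p₁ * volume Q.toSet := by
          refine Finset.sum_le_sum fun v _ => ?_
          rw [← avg_rpow_mul_volume hp₁, volume_eq_of_k (shift_k Q v)]
          gcongr
          exact (avg_le_avg3 p₁ α (near_shift Q v)).trans (avg3_le_avgStar p₁ α Q)
      _ = _ := by rw [Finset.sum_const, nsmul_eq_mul, nearCount, Finset.card_univ]
  rw [← ENNReal.mul_le_mul_iff_right hB0' hBt']
  calc B ^ p₁ * (μ ^ p₁ * ∑' R : M, volume R.1.toSet)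
      = ∑' R : M, (μ * B) ^ p₁ * volume R.1.toSet := by
        rw [ENNReal.tsum_mul_left, ENNReal.mul_rpow_of_nonneg _ _ hp₁.le]; ring
    _ ≤ ∑' R : M, ∫⁻ x in R.1.toSet, G x := ENNReal.tsum_le_tsum h1
    _ ≤ _ := h2.trans h3
    _ = _ := by ring

theorem volume_exceptionalSet_le :
    volume (exceptionalSet p₁ α μ Q) ≤
      nearCount d * ∑' R : maximals (exceptional p₁ α μ Q), volume R.1.toSet := by
  unfold exceptionalSet
  refine (measure_biUnion_le _ (Set.to_countable _) _).trans ?_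
  rw [← ENNReal.tsum_mul_left]
  refine ENNReal.tsum_le_tsum fun R => ?_
  refine (measure_iUnion_le _).trans_eq ?_
  rw [tsum_fintype]
  simp only [volume_eq_of_k (shift_k R.1 _)]
  rw [Finset.sum_const, nsmul_eq_mul, nearCount, Finset.card_univ]

theorem exists_maximal_exceptional [NeZero d] (hR : R ∈ exceptional p₁ α μ Q) :
    ∃ R' ∈ maximals (exceptional p₁ α μ Q), R.toSet ⊆ R'.toSet :=
  exists_maximals (K := Q.k) (fun _ hS => hS.1.1) hR

theorem subset_exceptionalSet [NeZero d] {P' : DyadicCube d} (hR : R ∈ exceptional p₁ α μ Q)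
    (hnear : Near P' R) : P'.toSet ⊆ exceptionalSet p₁ α μ Q := by
  obtain ⟨R', hR', hsub⟩ := exists_maximal_exceptional hR
  obtain ⟨hk, hup⟩ := subset_iff.1 hsub
  have hk' : P'.k ≤ R'.k := hnear.1 ▸ hk
  have h1 := (hnear.up hk').symm
  rw [hup] at h1
  obtain ⟨v, hv⟩ := near_iff.1 h1
  refine (P'.subset_up hk').trans ?_
  rw [hv]
  exact Set.subset_biUnion_of_mem (u := fun R : DyadicCube d => ⋃ v, (R.shift v).toSet) hR' |>.trans'
    (Set.subset_iUnion (fun v => (R'.shift v).toSet) v)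

theorem avgStar_le_of_forall [NeZero d] {t : ℝ≥0∞} (hPQ : P.toSet ⊆ Q.toSet)
    (ht : ∀ P' : DyadicCube d, P.toSet ⊆ P'.toSet → P'.toSet ⊆ Q.toSet → P' ≠ Q →
      avg3 p₁ α P' ≤ t) :
    avgStar p₁ α P ≤ 2 * t + avgStar p₁ α Q := by
  refine down_induction (Q := Q) (motive := fun P => (∀ P' : DyadicCube d, P.toSet ⊆ P'.toSet →
    P'.toSet ⊆ Q.toSet → P' ≠ Q → avg3 p₁ α P' ≤ t) → avgStar p₁ α P ≤ 2 * t + avgStar p₁ α Q)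
    (fun _ => le_add_self) ?_ hPQ ht
  intro P hPQ hne ih ht
  have h1 := ih fun P' h => ht P' ((P.subset_anc 1).trans h)
  rw [avgStar_eq]
  calc avg3 p₁ α P + 4⁻¹ * avgStar p₁ α (P.anc 1)
      ≤ t + 4⁻¹ * (2 * t + avgStar p₁ α Q) := by
        gcongr
        exact ht P subset_rfl hPQ hne
    _ ≤ t + (t + avgStar p₁ α Q) := by
        gcongr
        rw [mul_add, ← mul_assoc]
        have h4 : (4⁻¹ : ℝ≥0∞) * 2 ≤ 1 := by
          rw [← ENNReal.div_eq_inv_mul]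
          exact ENNReal.div_le_of_le_mul (by norm_num)
        have h5 : (4⁻¹ : ℝ≥0∞) ≤ 1 := by rw [ENNReal.inv_le_one]; norm_num
        exact add_le_add (mul_le_of_le_one_left zero_le h4) (mul_le_of_le_one_left zero_le h5)
    _ = _ := by ring

theorem subset_exceptionalSet_of_lt [NeZero d] (hp₁ : 0 < p₁) (hPQ : P.toSet ⊆ Q.toSet)
    (hlt : (2 * (nearCount d * μ) + 1) * avgStar p₁ α Q < avgStar p₁ α P) :
    P.toSet ⊆ exceptionalSet p₁ α μ Q := by
  have h1 : ∃ P' : DyadicCube d, P.toSet ⊆ P'.toSet ∧ P'.toSet ⊆ Q.toSet ∧ P' ≠ Q ∧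
      nearCount d * (μ * avgStar p₁ α Q) < avg3 p₁ α P' := by
    by_contra! hcon
    refine absurd hlt (not_lt.2 ((avgStar_le_of_forall hPQ hcon).trans_eq ?_))
    ring
  obtain ⟨P', hP', hP'Q, hne, hbig⟩ := h1
  have h2 : ∃ v, μ * avgStar p₁ α Q < avg p₁ α (P'.shift v) := by
    by_contra! hcon
    refine absurd hbig (not_lt.2 ?_)
    refine (Finset.sum_le_sum fun v _ => hcon v).trans_eq ?_
    rw [Finset.sum_const, nsmul_eq_mul, nearCount, Finset.card_univ]
  obtain ⟨v, hv⟩ := h2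
  have hk := k_le_of_subset hP'Q
  have hin : In3 (P'.shift v) Q := by
    refine ⟨hk, ?_⟩
    have := (near_shift P' v).up hk
    rwa [(subset_iff.1 hP'Q).2] at this
  have hex : P'.shift v ∈ exceptional p₁ α μ Q := by
    by_contra hn
    exact absurd hv (not_lt.2 (avg_le_of_notMem_exceptional hp₁ hin hn))
  exact hP'.trans (subset_exceptionalSet hex (near_shift P' v))

theorem le_of_mem_regular [NeZero d] (hp₁ : 0 < p₁) {I : DyadicCube d} (hI : I ∈ regular p₁ α μ Q) :
    α I ≤ μ * avgStar p₁ α Q :=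
  (le_avg hp₁ α I).trans (avg_le_of_notMem_exceptional hp₁ hI.1 fun h => hI.2 I h subset_rfl)

theorem sum_sq_le_of_regular [NeZero d] (hp₁ : 0 < p₁) {x : EuclideanSpace ℝ (Fin d)}
    (s : Finset (DyadicCube d)) (hs : ∀ I ∈ s, I ∈ regular p₁ α μ Q ∧ x ∈ I.toSet) :
    ∑ I ∈ s, α I ^ 2 ≤ (μ * avgStar p₁ α Q) ^ 2 := by
  rcases s.eq_empty_or_nonempty with rfl | hne
  · simp
  obtain ⟨I₀, hI₀, hmin⟩ := s.exists_min_image (fun I => I.k) hne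
  obtain ⟨hreg, hx⟩ := hs I₀ hI₀
  have hnot : I₀ ∉ exceptional p₁ α μ Q := fun h => hreg.2 I₀ h subset_rfl
  have hlt : ∫⁻ x in I₀.toSet, lsq α (I₀.up Q.k) x ^ p₁ <
      (μ * avgStar p₁ α Q) ^ p₁ * volume I₀.toSet := by
    by_contra! hle
    exact hnot ⟨hreg.1, hle⟩
  have hsub : ∀ I ∈ s, I₀.toSet ⊆ I.toSet := fun I hI => subset_of_mem hx (hs I hI).2 (hmin I hI)
  have h1 : ∀ y ∈ I₀.toSet, (∑ I ∈ s, α I ^ 2) ^ (1 / 2 : ℝ) ≤ lsq α (I₀.up Q.k) y :=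
    fun y hy => finset_sum_le_lsq α fun I hI => ⟨by
      have hk := (hs I hI).1.1.1
      have := I.subset_up hk
      have he := (subset_iff.1 (hsub I hI)).2
      have e : I.up Q.k = I₀.up Q.k := by rw [← up_up I₀ (hmin I hI) hk, he]
      rwa [e] at this, hsub I hI hy⟩
  have h2 : ((∑ I ∈ s, α I ^ 2) ^ (1 / 2 : ℝ)) ^ p₁ * volume I₀.toSet ≤
      (μ * avgStar p₁ α Q) ^ p₁ * volume I₀.toSet := by
    refine le_trans ?_ hlt.le
    rw [← setLIntegral_const]
    exact setLIntegral_mono' I₀.measurableSet fun y hy => by gcongr; exact h1 y hy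
  rw [ENNReal.mul_le_mul_iff_left I₀.volume_ne_zero I₀.volume_ne_top,
    ENNReal.rpow_le_rpow_iff hp₁] at h2
  calc ∑ I ∈ s, α I ^ 2 = ((∑ I ∈ s, α I ^ 2) ^ (1 / 2 : ℝ)) ^ 2 := by
        rw [← ENNReal.rpow_natCast, ← ENNReal.rpow_mul]; norm_num
    _ ≤ _ := by gcongr

theorem tsum_regular_le [NeZero d] (hp₁ : 0 < p₁) :
    ∑' I : regular p₁ α μ Q, α I ^ 2 * volume I.1.toSet ≤
      nearCount d * ((μ * avgStar p₁ α Q) ^ 2 * volume Q.toSet) := by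
  classical
  set U : Set (EuclideanSpace ℝ (Fin d)) := ⋃ v, (Q.shift v).toSet
  have hU : MeasurableSet U := MeasurableSet.iUnion fun v => (Q.shift v).measurableSet
  have hIU : ∀ I ∈ regular p₁ α μ Q, I.toSet ⊆ U := fun I hI => by
    obtain ⟨v, hv⟩ := near_iff.1 hI.1.2
    refine (I.subset_up hI.1.1).trans ?_
    rw [hv]
    exact Set.subset_iUnion (fun v => (Q.shift v).toSet) v
  calc ∑' I : regular p₁ α μ Q, α I ^ 2 * volume I.1.toSet
      = ∑' I : regular p₁ α μ Q, ∫⁻ x, I.1.toSet.indicator (fun _ => α I ^ 2) x :=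
        tsum_congr fun I => (lintegral_indicator_const I.1.measurableSet _).symm
    _ = ∫⁻ x, ∑' I : regular p₁ α μ Q, I.1.toSet.indicator (fun _ => α I ^ 2) x := by
        rw [lintegral_tsum fun I : regular p₁ α μ Q =>
          (measurable_const.indicator I.1.measurableSet).aemeasurable]
    _ ≤ ∫⁻ x, U.indicator (fun _ => (μ * avgStar p₁ α Q) ^ 2) x := by
        refine lintegral_mono fun x => ?_
        by_cases hx : x ∈ U
        · simp only [Set.indicator_of_mem hx]
          rw [tsum_subtype (regular p₁ α μ Q)
            (fun I : DyadicCube d => I.toSet.indicator (fun _ => α I ^ 2) x),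
            ENNReal.tsum_eq_iSup_sum]
          refine iSup_le fun s => ?_
          have : ∑ I ∈ s, (regular p₁ α μ Q).indicator
              (fun I : DyadicCube d => I.toSet.indicator (fun _ => α I ^ 2) x) I =
              ∑ I ∈ s.filter (fun I => I ∈ regular p₁ α μ Q ∧ x ∈ I.toSet), α I ^ 2 := by
            rw [Finset.sum_filter]
            refine Finset.sum_congr rfl fun I _ => ?_
            by_cases h1 : I ∈ regular p₁ α μ Q <;> by_cases h2 : x ∈ I.toSet <;> simp [h1, h2]
          rw [this]
          exact sum_sq_le_of_regular hp₁ _ fun I hI => (Finset.mem_filter.1 hI).2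
        · have : ∑' I : regular p₁ α μ Q, I.1.toSet.indicator (fun _ => α I ^ 2) x = 0 :=
            ENNReal.tsum_eq_zero.2 fun I => Set.indicator_of_notMem (fun h => hx (hIU I I.2 h)) _
          rw [this]; exact zero_le
    _ = (μ * avgStar p₁ α Q) ^ 2 * volume U := lintegral_indicator_const hU _
    _ ≤ (μ * avgStar p₁ α Q) ^ 2 * (nearCount d * volume Q.toSet) := by
        gcongr
        refine (measure_iUnion_le _).trans_eq ?_
        rw [tsum_fintype]
        simp only [volume_eq_of_k (shift_k Q _)]
        rw [Finset.sum_const, nsmul_eq_mul, nearCount, Finset.card_univ]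
    _ = _ := by ring

/-- The constant in the bound for the singular part off the exceptional set. -/
def singConst (d : ℕ) (p₁ : ℝ) : ℝ≥0∞ :=
  2 * kerConst d * ENNReal.ofReal ((2 + d : ℝ) ^ (d + 1)) * 2 ^ growth d p₁

theorem singConst_ne_top (d : ℕ) (p₁ : ℝ) : singConst d p₁ ≠ ∞ :=
  ENNReal.mul_ne_top (ENNReal.mul_ne_top (ENNReal.mul_ne_top (by norm_num) (kerConst_ne_top d))
    ENNReal.ofReal_ne_top) (by simp)

theorem tsum_singular_le [NeZero d] (hN : Admissible d p₁ N) (hp₁ : 0 < p₁) (hμ : 1 ≤ μ)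
    {x : EuclideanSpace ℝ (Fin d)} (hx : x ∉ exceptionalSet p₁ α μ Q) :
    ∑' I : singular p₁ α μ Q, α I * I.1.ker N x ≤ singConst d p₁ * (μ * avgStar p₁ α Q) *
      ∑' R : maximals (exceptional p₁ α μ Q), R.1.ker (d + 1) x := by
  unfold Admissible at hN
  have hcov : singular p₁ α μ Q ⊆ ⋃ R : maximals (exceptional p₁ α μ Q),
      {I : DyadicCube d | I.toSet ⊆ R.1.toSet} := by
    rintro I ⟨R, hR, hIR⟩
    obtain ⟨R', hR', hsub⟩ := exists_maximal_exceptional hR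
    exact Set.mem_iUnion.2 ⟨⟨R', hR'⟩, hIR.trans hsub⟩
  refine (ENNReal.tsum_mono_subtype (fun I : DyadicCube d => α I * I.ker N x) hcov).trans ?_
  refine (ENNReal.tsum_iUnion_le_tsum (fun I : DyadicCube d => α I * I.ker N x) _).trans ?_
  rw [← ENNReal.tsum_mul_left]
  refine ENNReal.tsum_le_tsum fun R => ?_
  have hfar : ¬ Near R.1 (cubeAt R.1.k x) := fun hnear => by
    obtain ⟨v, hv⟩ := near_iff.1 hnear
    refine hx (Set.mem_biUnion R.2 (Set.mem_iUnion.2 ⟨v, ?_⟩))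
    rw [← hv]; exact mem_cubeAt _ _
  refine (tsum_subset_le hp₁ α (N := N) (by omega) hfar).trans ?_
  calc _ ≤ 2 * kerConst d * (ENNReal.ofReal ((2 + d : ℝ) ^ (d + 1)) *
        (2 ^ growth d p₁ * (μ * avgStar p₁ α Q) * R.1.ker (d + 1) x)) := by
        gcongr
        exact avg_le_of_mem_maximals hp₁ hμ R.2
    _ = _ := by unfold singConst; ring

end

/-! ### Tent functions -/

section

open DyadicCube
open Filter hiding ker

variable {d : ℕ}

namespace DyadicCube

/-- The center of a dyadic cube. -/
def center (P : DyadicCube d) : EuclideanSpace ℝ (Fin d) :=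
  WithLp.toLp 2 fun i => P.side * (P.m i + 1 / 2)

theorem ball_center_subset (P : DyadicCube d) : Metric.ball P.center (P.side / 2) ⊆ P.toSet := by
  intro x hx i
  have h1 : |x i - P.side * (P.m i + 1 / 2)| ≤ ‖x - P.center‖ := by
    simpa [center] using PiLp.norm_apply_le (x - P.center) i
  rw [mem_ball_iff_norm] at hx
  obtain ⟨h2, h3⟩ := abs_lt.1 (h1.trans_lt hx)
  constructor <;> linarith

/-- A tent function supported in `P`. -/
def tent (P : DyadicCube d) (x : EuclideanSpace ℝ (Fin d)) : ℝ :=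
  max 0 (1 - 4 * (‖x - P.center‖ / P.side))

theorem tent_nonneg (P : DyadicCube d) (x : EuclideanSpace ℝ (Fin d)) : 0 ≤ P.tent x :=
  le_max_left _ _

theorem tent_le_one (P : DyadicCube d) (x : EuclideanSpace ℝ (Fin d)) : P.tent x ≤ 1 := by
  have := P.side_pos
  refine max_le zero_le_one ?_
  have : 0 ≤ ‖x - P.center‖ / P.side := by positivity
  linarith

theorem continuous_tent (P : DyadicCube d) : Continuous P.tent := by
  unfold tent; fun_prop

theorem tent_eq_zero {P : DyadicCube d} {x : EuclideanSpace ℝ (Fin d)} (hx : x ∉ P.toSet) :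
    P.tent x = 0 := by
  have hs := P.side_pos
  have h1 : P.side / 2 ≤ ‖x - P.center‖ := by
    by_contra! hlt
    exact hx (P.ball_center_subset (mem_ball_iff_norm.2 hlt))
  refine max_eq_left ?_
  have : 1 / 2 ≤ ‖x - P.center‖ / P.side := by rw [le_div_iff₀ hs]; linarith
  linarith

theorem abs_tent_sub_le (P : DyadicCube d) (x y : EuclideanSpace ℝ (Fin d)) :
    |P.tent x - P.tent y| ≤ 4 * (‖x - y‖ / P.side) := by
  have hs := P.side_pos
  have h1 := abs_norm_sub_norm_le (x - P.center) (y - P.center)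
  rw [sub_sub_sub_cancel_right] at h1
  have h2 : |P.tent x - P.tent y| ≤
      |(1 - 4 * (‖x - P.center‖ / P.side)) - (1 - 4 * (‖y - P.center‖ / P.side))| := by
    unfold tent
    rw [max_comm 0, max_comm 0]
    exact abs_max_sub_max_le_abs _ _ _
  refine h2.trans ?_
  have e : (1 - 4 * (‖x - P.center‖ / P.side)) - (1 - 4 * (‖y - P.center‖ / P.side)) =
      -(4 / P.side * (‖x - P.center‖ - ‖y - P.center‖)) := by ring
  rw [e, abs_neg, abs_mul, abs_of_pos (by positivity)]
  calc _ ≤ 4 / P.side * ‖x - y‖ := by gcongr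
    _ = _ := by ring

theorem integrable_tent (P : DyadicCube d) : Integrable P.tent := by
  refine Integrable.mono' (g := P.toSet.indicator fun _ => (1 : ℝ))
    ((integrable_indicator_iff P.measurableSet).2 (integrableOn_const P.volume_ne_top))
    P.continuous_tent.aestronglyMeasurable (Eventually.of_forall fun x => ?_)
  rw [Real.norm_of_nonneg (P.tent_nonneg x)]
  by_cases hx : x ∈ P.toSet
  · rw [Set.indicator_of_mem hx]; exact P.tent_le_one x
  · rw [Set.indicator_of_notMem hx, tent_eq_zero hx]

/-- The normalized integral of the tent function. -/
def tentMass (d : ℕ) : ℝ≥0∞ :=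
  2⁻¹ * (ENNReal.ofReal (8⁻¹ ^ d) * volume (Metric.ball (0 : EuclideanSpace ℝ (Fin d)) 1))

theorem tentMass_ne_zero (d : ℕ) : tentMass d ≠ 0 := by
  have h := (Metric.measure_ball_pos volume (0 : EuclideanSpace ℝ (Fin d)) one_pos).ne'
  have h8 : ENNReal.ofReal ((8 : ℝ)⁻¹ ^ d) ≠ 0 := (ENNReal.ofReal_pos.2 (by positivity)).ne'
  exact mul_ne_zero (by simp) (mul_ne_zero h8 h)

theorem tentMass_mul_volume_le (P : DyadicCube d) :
    tentMass d * volume P.toSet ≤ ∫⁻ x, ENNReal.ofReal (P.tent x) := by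
  have hs := P.side_pos
  have h1 : volume (Metric.ball P.center (P.side / 8)) =
      ENNReal.ofReal (8⁻¹ ^ d) * volume (Metric.ball (0 : EuclideanSpace ℝ (Fin d)) 1) *
        volume P.toSet := by
    rw [Measure.addHaar_ball_of_pos _ _ (by positivity), finrank_euclideanSpace_fin, volume_eq,
      mul_right_comm, ← ENNReal.ofReal_mul (by positivity), ← mul_pow, div_eq_inv_mul]
  calc tentMass d * volume P.toSet = 2⁻¹ * volume (Metric.ball P.center (P.side / 8)) := by
        rw [h1, tentMass]; ring
    _ = ∫⁻ x in Metric.ball P.center (P.side / 8), 2⁻¹ := by rw [setLIntegral_const]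
    _ ≤ ∫⁻ x in Metric.ball P.center (P.side / 8), ENNReal.ofReal (P.tent x) := by
        refine setLIntegral_mono' measurableSet_ball fun x hx => ?_
        rw [mem_ball_iff_norm] at hx
        have h2 : ‖x - P.center‖ / P.side ≤ 1 / 8 := by rw [div_le_iff₀ hs]; linarith
        have h3 : (2 : ℝ)⁻¹ ≤ P.tent x := le_max_of_le_right (by linarith)
        refine le_trans ?_ (ENNReal.ofReal_le_ofReal h3)
        rw [ENNReal.ofReal_inv_of_pos (by norm_num)]; simp
    _ ≤ _ := setLIntegral_le_lintegral _ _

end DyadicCube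

/-- The smoothness constant of the tent function. -/
def tentConst (d : ℕ) : ℝ≥0∞ := 4 * ENNReal.ofReal ((1 + d : ℝ) ^ (d + 1))

theorem tentConst_ne_top (d : ℕ) : tentConst d ≠ ∞ :=
  ENNReal.mul_ne_top (by norm_num) ENNReal.ofReal_ne_top

theorem smoothAt_tent (P : DyadicCube d) :
    SmoothAt (d + 1) P (tentConst d) fun x => (P.tent x : ℂ) := by
  intro x y
  have hs := P.side_pos
  set t := ‖x - y‖ / P.side with ht
  have ht0 : 0 ≤ t := by positivity
  by_cases h0 : P.tent x = 0 ∧ P.tent y = 0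
  · simp [h0]
  have h1 : P.rho x ≤ (1 + d) * (1 + t) := by
    have hin : ∀ z ∈ P.toSet, P.rho z ≤ 1 + d := fun z hz => by
      have := (div_le_iff₀ hs).2 (P.norm_sub_le hz P.corner_mem)
      unfold rho; linarith
    by_cases hx : x ∈ P.toSet
    · exact (hin x hx).trans (le_mul_of_one_le_right (by positivity) (by linarith))
    · have hy : y ∈ P.toSet := by
        by_contra hy
        exact h0 ⟨tent_eq_zero hx, tent_eq_zero hy⟩
      have := P.rho_le_mul y x
      rw [norm_sub_rev y x] at this
      exact this.trans (mul_le_mul_of_nonneg_right (hin y hy) (by positivity))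
  have hr := P.rho_pos x
  have h2 : 1 ≤ ((1 + d : ℝ) ^ (d + 1) * (1 + t) ^ (d + 1)) * (P.rho x ^ (d + 1))⁻¹ := by
    rw [← mul_pow, ← div_eq_mul_inv, one_le_div (by positivity)]
    gcongr
  rw [← Complex.ofReal_sub, ← ofReal_norm, Complex.norm_real, Real.norm_eq_abs, tentConst]
  unfold ker
  have e4 : (4 : ℝ≥0∞) = ENNReal.ofReal 4 := by simp
  rw [e4, ← ENNReal.ofReal_mul (by positivity), ← ENNReal.ofReal_mul (by positivity),
    ← ENNReal.ofReal_mul (by positivity)]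
  refine ENNReal.ofReal_le_ofReal ((P.abs_tent_sub_le x y).trans ?_)
  rw [← ht]
  calc 4 * t ≤ 4 * t * (((1 + d : ℝ) ^ (d + 1) * (1 + t) ^ (d + 1)) * (P.rho x ^ (d + 1))⁻¹) :=
        le_mul_of_one_le_right (by positivity) h2
    _ = _ := by ring

section Psum

variable {N : ℕ} {α : DyadicCube d → ℝ≥0∞} {ψ : DyadicCube d → EuclideanSpace ℝ (Fin d) → ℂ}

theorem AtomFamily.exists_enorm_psum_le (h : AtomFamily N α ψ) (hN : d + 1 ≤ N) :
    ∃ C : ℝ, ∀ (𝓐 : Set (DyadicCube d)) (x : EuclideanSpace ℝ (Fin d)), ‖psum ψ 𝓐 x‖ ≤ C := by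
  set s := (∑' k : ℤ, ⨆ I ∈ (level k : Set (DyadicCube d)), α I) * kerConst d
  have hs : s ≠ ∞ := ENNReal.mul_ne_top h.summable (kerConst_ne_top d)
  refine ⟨s.toReal, fun 𝓐 x => ?_⟩
  rw [← toReal_enorm]
  refine ENNReal.toReal_mono hs ?_
  refine (h.enorm_psum_le 𝓐 x).trans (le_trans ?_ (tsum_mul_ker_le α hN x))
  exact ENNReal.tsum_comp_le_tsum_of_injective Subtype.val_injective fun I => α I * I.ker N x

theorem AtomFamily.measurable_psum (h : AtomFamily N α ψ) (hN : d + 1 ≤ N)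
    (𝓐 : Set (DyadicCube d)) : Measurable (psum ψ 𝓐) := by
  classical
  obtain ⟨s, hs⟩ := exists_tendsto_finset (DyadicCube d)
  refine measurable_of_tendsto_metrizable (f := fun n x => ∑ I ∈ s n, 𝓐.indicator (fun I => ψ I x) I)
    (fun n => Finset.measurable_fun_sum _ fun I _ => ?_) (tendsto_pi_nhds.2 fun x =>
      (h.summable_indicator hN 𝓐 x).hasSum.comp hs)
  by_cases hI : I ∈ 𝓐
  · simp only [Set.indicator_of_mem hI]; exact (h.atom I).continuous.measurable
  · simp only [Set.indicator_of_notMem hI]; exact measurable_const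

theorem AtomFamily.integrable_tent_mul_psum (h : AtomFamily N α ψ) (hN : d + 1 ≤ N)
    (P : DyadicCube d) (𝓐 : Set (DyadicCube d)) :
    Integrable fun x => (P.tent x : ℂ) * psum ψ 𝓐 x := by
  obtain ⟨C, hC⟩ := h.exists_enorm_psum_le hN
  exact P.integrable_tent.ofReal.mul_bdd (h.measurable_psum hN 𝓐).aestronglyMeasurable (Eventually.of_forall (hC 𝓐))

/-- Sums of small atoms have small averages against a tent. -/
theorem AtomFamily.enorm_integral_tent_mul_psum_le (h : AtomFamily N α ψ) (hN : 2 * d + 3 ≤ N)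
    {P : DyadicCube d} {𝓐 : Set (DyadicCube d)} {t : ℝ≥0∞}
    (hA : ∀ I ∈ 𝓐, I.k ≤ P.k ∧ α I ≤ t) :
    ‖∫ x, (P.tent x : ℂ) * psum ψ 𝓐 x‖ₑ ≤
      4 * kerMass d * kerConst d * tentConst d * t * volume P.toSet := by
  set F : DyadicCube d → EuclideanSpace ℝ (Fin d) → ℂ := fun I x =>
    (P.tent x : ℂ) * 𝓐.indicator (fun I => ψ I x) I with hF
  have htent : ∀ x, ‖(P.tent x : ℂ)‖ₑ ≤ P.toSet.indicator 1 x := fun x => by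
    by_cases hx : x ∈ P.toSet
    · rw [Set.indicator_of_mem hx, ← ofReal_norm, Complex.norm_real,
        Real.norm_of_nonneg (P.tent_nonneg x), Pi.one_apply, ENNReal.ofReal_le_one]
      exact P.tent_le_one x
    · rw [tent_eq_zero hx]; simp
  have hFm : ∀ I, Continuous (F I) := fun I => by
    refine (Complex.continuous_ofReal.comp P.continuous_tent).mul ?_
    by_cases hI : I ∈ 𝓐
    · simp only [Set.indicator_of_mem hI]; exact (h.atom I).continuous
    · simp only [Set.indicator_of_notMem hI]; exact continuous_const
  set S := (∑' k : ℤ, ⨆ I ∈ (level k : Set (DyadicCube d)), α I) * kerConst d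
  have hS : S ≠ ∞ := ENNReal.mul_ne_top h.summable (kerConst_ne_top d)
  have hfin : ∑' I, ∫⁻ x, ‖F I x‖ₑ ≠ ∞ := by
    rw [← lintegral_tsum fun I => (hFm I).enorm.measurable.aemeasurable]
    refine ne_top_of_le_ne_top (ENNReal.mul_ne_top hS P.volume_ne_top) ?_
    rw [← lintegral_indicator_const P.measurableSet]
    refine lintegral_mono fun x => ?_
    simp only [hF, enorm_mul]
    rw [ENNReal.tsum_mul_left]
    by_cases hx : x ∈ P.toSet
    · rw [Set.indicator_of_mem hx]
      have := htent x
      rw [Set.indicator_of_mem hx] at this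
      refine (mul_le_of_le_one_left zero_le this).trans ?_
      refine le_trans (ENNReal.tsum_le_tsum fun I => ?_) (tsum_mul_ker_le α (N := N) (by omega) x)
      refine le_trans ?_ ((h.atom I).size x)
      by_cases hI : I ∈ 𝓐 <;> simp [hI]
    · rw [tent_eq_zero hx]; simp
  have h1 : ∫ x, (P.tent x : ℂ) * psum ψ 𝓐 x = ∑' I, ∫ x, F I x := by
    rw [← integral_tsum (fun I => (hFm I).aestronglyMeasurable) hfin]
    refine integral_congr_ae (Eventually.of_forall fun x => ?_)
    simp only [psum, hF]
    rw [tsum_mul_left]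
  have h2 : ∀ I, ‖∫ x, F I x‖ₑ ≤ kerMass d * tentConst d * t * interaction I P := fun I => by
    by_cases hI : I ∈ 𝓐
    · have e : ∫ x, F I x = ∫ x, ψ I x * (P.tent x : ℂ) :=
        integral_congr_ae (Eventually.of_forall fun x => by simp [hF, hI, mul_comm])
      rw [e]
      refine ((h.atom I).enorm_integral_mul_smooth_le (h.ne_top I) hN
        (Complex.continuous_ofReal.comp P.continuous_tent) (C := 1) (fun x => ?_)
        (smoothAt_tent P) (hA I hI).1).trans ?_
      · rw [Function.comp_apply, Complex.norm_real, Real.norm_of_nonneg (P.tent_nonneg x)]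
        exact P.tent_le_one x
      · unfold interaction
        rw [if_pos (hA I hI).1]
        calc _ ≤ kerMass d * (t * tentConst d * (2⁻¹ ^ (P.k - I.k).toNat *
              (volume I.toSet * P.ker (d + 1) I.corner))) := by
              gcongr
              exact (hA I hI).2
          _ = _ := by ring
    · simp [hF, hI]
  rw [h1]
  refine enorm_tsum_le_tsum_enorm.trans ((ENNReal.tsum_le_tsum h2).trans ?_)
  rw [ENNReal.tsum_mul_left]
  simp only [interaction_comm _ P]
  calc _ ≤ kerMass d * tentConst d * t * (4 * kerConst d * volume P.toSet) := by
        gcongr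
        exact tsum_interaction_le P
    _ = _ := by ring

end Psum

end

/-! ### The measure of the stopping children -/

section

open DyadicCube
open Filter hiding ker

variable {d : ℕ} {N : ℕ} {α : DyadicCube d → ℝ≥0∞}
  {ψ : DyadicCube d → EuclideanSpace ℝ (Fin d) → ℂ} {p₁ : ℝ} {Λ lam μ ν : ℝ≥0∞} {Q P : DyadicCube d}

theorem avgStar_up_le_of_mem_stopChildren [NeZero d] (h : AtomFamily N α ψ) (hp₁ : 0 < p₁) (hΛ : 1 ≤ Λ)
    (hP : P ∈ stopChildren p₁ α ψ Λ lam Q) {k : ℤ} (hk : P.k < k) (hkQ : k ≤ Q.k) :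
    avgStar p₁ α (P.up k) ≤ Λ * avgStar p₁ α Q := by
  have hun := Unstopped.of_mem_stopChildren hP
  have e : P.up k = (P.anc 1).up k := by
    unfold anc; rw [up_up _ (by omega) (by omega)]
  have hk' : (P.anc 1).k ≤ k := by simp only [anc_k]; omega
  rw [e]
  refine (hun.mono ((P.anc 1).subset_up hk') (subset_iff.2 ⟨hkQ, ?_⟩)).avgStar_le h hp₁ hΛ
  rw [up_up _ hk' hkQ]
  exact (subset_iff.1 hun.1).2

/-- On a stopping child whose average is not large, the regular part of the sum is large at
points where the singular part is controlled. -/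
theorem AtomFamily.mul_avgStar_le_of_mem_stopChildren [NeZero d] (h : AtomFamily N α ψ)
    (hN : Admissible d p₁ N) (hp₁ : 0 < p₁) (hΛ : 1 ≤ Λ) (hP : P ∈ stopChildren p₁ α ψ Λ lam Q)
    (hle : avgStar p₁ α P ≤ Λ * avgStar p₁ α Q) {x : EuclideanSpace ℝ (Fin d)} (hx : x ∈ P.toSet)
    (hsing : ∑' I : singular p₁ α μ Q, α I * I.1.ker N x ≤ ν * avgStar p₁ α Q) :
    lam * avgStar p₁ α Q ≤ (oscConst d N p₁ * Λ + starConst d p₁ + ν) * avgStar p₁ α Q +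
      ‖psum ψ (regular p₁ α μ Q ∩ band P.k Q.k) x‖ₑ := by
  have hN' := hN
  unfold Admissible at hN'
  set B := avgStar p₁ α Q
  obtain ⟨y, hy, hlt⟩ : ∃ y ∈ P.toSet, lam * B < ‖psum ψ (band P.k Q.k) y‖ₑ :=
    hP.1.2.2.2.resolve_left (not_lt.2 hle)
  have hosc := h.enorm_psum_sub_le hN hp₁ (P := P) (K := Q.k) (L := Λ * B)
    (fun k hk hkQ => avgStar_up_le_of_mem_stopChildren h hp₁ hΛ hP hk hkQ)
    (𝓐 := band P.k Q.k) subset_rfl hy hx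
  have hsplit : psum ψ (band P.k Q.k) x = psum ψ (farCubes Q ∩ band P.k Q.k) x +
      psum ψ (singular p₁ α μ Q ∩ band P.k Q.k) x +
      psum ψ (regular p₁ α μ Q ∩ band P.k Q.k) x := by
    rw [← h.psum_union (by omega), ← h.psum_union (by omega)]
    · congr 1
      ext I
      simp only [Set.mem_union, Set.mem_inter_iff]
      refine ⟨fun hI => ?_, by tauto⟩
      by_cases h1 : In3 I Q
      · by_cases h2 : I ∈ singular p₁ α μ Q
        · exact Or.inl (Or.inr ⟨h2, hI⟩)
        · exact Or.inr ⟨⟨h1, fun R hR hsub => h2 ⟨R, hR, hsub⟩⟩, hI⟩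
      · exact Or.inl (Or.inl ⟨⟨hI.2, h1⟩, hI⟩)
    · refine Set.disjoint_left.2 ?_
      rintro I (⟨h1, -⟩ | ⟨⟨R, hR, hsub⟩, -⟩) ⟨h3, -⟩
      · exact h1.2 h3.1
      · exact h3.2 R hR hsub
    · refine Set.disjoint_left.2 ?_
      rintro I ⟨h1, -⟩ ⟨⟨R, hR, hsub⟩, -⟩
      exact h1.2 (In3.of_subset hR.1 hsub)
  have hfar : ‖psum ψ (farCubes Q ∩ band P.k Q.k) x‖ₑ ≤ starConst d p₁ * B := by
    refine (h.enorm_psum_le _ x).trans (le_trans ?_ (tsum_farCubes_le hp₁ α (N := N) (by omega)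
      (hP.1.1 hx)))
    exact ENNReal.tsum_mono_subtype (fun I : DyadicCube d => α I * I.ker N x) Set.inter_subset_left
  have hsing' : ‖psum ψ (singular p₁ α μ Q ∩ band P.k Q.k) x‖ₑ ≤ ν * B := by
    refine (h.enorm_psum_le _ x).trans (le_trans ?_ hsing)
    exact ENNReal.tsum_mono_subtype (fun I : DyadicCube d => α I * I.ker N x) Set.inter_subset_left
  calc lam * B ≤ ‖psum ψ (band P.k Q.k) y‖ₑ := hlt.le
    _ = ‖(psum ψ (band P.k Q.k) y - psum ψ (band P.k Q.k) x) + psum ψ (band P.k Q.k) x‖ₑ := by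
        rw [sub_add_cancel]
    _ ≤ oscConst d N p₁ * (Λ * B) + (starConst d p₁ * B + ν * B +
        ‖psum ψ (regular p₁ α μ Q ∩ band P.k Q.k) x‖ₑ) := by
        refine (enorm_add_le _ _).trans (add_le_add hosc ?_)
        rw [hsplit]
        refine (enorm_add_le _ _).trans (add_le_add ?_ le_rfl)
        exact (enorm_add_le _ _).trans (add_le_add hfar hsing')
    _ = _ := by ring

theorem AtomFamily.tentMass_mul_enorm_psum_le [NeZero d] (h : AtomFamily N α ψ) (hN : Admissible d p₁ N)
    (hp₁ : 0 < p₁) (hΛ : 1 ≤ Λ) (hP : P ∈ stopChildren p₁ α ψ Λ lam Q)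
    {x : EuclideanSpace ℝ (Fin d)} (hx : x ∈ P.toSet) :
    tentMass d * ‖psum ψ (regular p₁ α μ Q ∩ band P.k Q.k) x‖ₑ * volume P.toSet ≤
      (∫⁻ z in P.toSet, ‖psum ψ (regular p₁ α μ Q) z‖ₑ) +
      (4 * kerMass d * kerConst d * tentConst d * μ + oscConst d N p₁ * Λ) * avgStar p₁ α Q *
        volume P.toSet := by
  have hN' := hN
  unfold Admissible at hN'
  have hN1 : d + 1 ≤ N := by omega
  set B := avgStar p₁ α Q
  set reg := regular p₁ α μ Q
  set low := reg ∩ {I : DyadicCube d | I.k ≤ P.k} with hlow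
  set w := psum ψ (reg ∩ band P.k Q.k) with hw
  have hsplit : ∀ z, psum ψ reg z = w z + psum ψ low z := fun z => by
    rw [hw, hlow, ← h.psum_union hN1]
    · congr 1
      ext I
      simp only [Set.mem_union, Set.mem_inter_iff, band, Set.mem_ofPred_eq]
      refine ⟨fun hI => ?_, by tauto⟩
      have := hI.1.1
      by_cases hk : I.k ≤ P.k
      · exact Or.inr ⟨hI, hk⟩
      · exact Or.inl ⟨hI, by omega, this⟩
    · refine Set.disjoint_left.2 ?_
      rintro I ⟨-, h1⟩ ⟨-, h2⟩
      exact absurd h1.1 (not_lt.2 h2)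
  have htent : ∀ z ∈ P.toSet, ‖(P.tent z : ℂ)‖ₑ ≤ 1 := fun z _ => by
    rw [← ofReal_norm, Complex.norm_real, Real.norm_of_nonneg (P.tent_nonneg z),
      ENNReal.ofReal_le_one]
    exact P.tent_le_one z
  have hosc : ∀ z ∈ P.toSet, ‖w x - w z‖ₑ ≤ oscConst d N p₁ * (Λ * B) := fun z hz =>
    h.enorm_psum_sub_le hN hp₁ (P := P) (K := Q.k) (L := Λ * B)
      (fun k hk hkQ => avgStar_up_le_of_mem_stopChildren h hp₁ hΛ hP hk hkQ)
      Set.inter_subset_right hx hz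
  have hint := h.integrable_tent_mul_psum hN1 P
  have htint : Integrable fun z => (P.tent z : ℂ) * w x := P.integrable_tent.ofReal.mul_const _
  have h1 : (∫ z, (P.tent z : ℂ) * w x) =
      (∫ z, (P.tent z : ℂ) * ((w x - w z) + psum ψ reg z)) - ∫ z, (P.tent z : ℂ) * psum ψ low z := by
    rw [← integral_sub _ (hint low)]
    · refine integral_congr_ae (Eventually.of_forall fun z => ?_)
      simp only [hsplit z]; ring
    · have : (fun z => (P.tent z : ℂ) * ((w x - w z) + psum ψ reg z)) =
          fun z => (P.tent z : ℂ) * w x - (P.tent z : ℂ) * w z + (P.tent z : ℂ) * psum ψ reg z := by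
        funext z; ring
      rw [this]
      exact (htint.sub (hint _)).add (hint _)
  have h2 : ‖∫ z, (P.tent z : ℂ) * w x‖ₑ = (∫⁻ z, ENNReal.ofReal (P.tent z)) * ‖w x‖ₑ := by
    rw [integral_mul_const, enorm_mul, integral_complex_ofReal, ← ofReal_norm, Complex.norm_real,
      Real.norm_of_nonneg (integral_nonneg P.tent_nonneg),
      ofReal_integral_eq_lintegral_ofReal P.integrable_tent (Eventually.of_forall P.tent_nonneg)]
  have h3 : ‖∫ z, (P.tent z : ℂ) * ((w x - w z) + psum ψ reg z)‖ₑ ≤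
      oscConst d N p₁ * (Λ * B) * volume P.toSet + ∫⁻ z in P.toSet, ‖psum ψ reg z‖ₑ := by
    refine (enorm_integral_le_lintegral_enorm _).trans ?_
    rw [← setLIntegral_const, ← lintegral_add_left measurable_const,
      ← lintegral_indicator P.measurableSet]
    refine lintegral_mono fun z => ?_
    by_cases hz : z ∈ P.toSet
    · rw [Set.indicator_of_mem hz, enorm_mul]
      refine (mul_le_of_le_one_left zero_le (htent z hz)).trans ?_
      exact (enorm_add_le _ _).trans (add_le_add (hosc z hz) le_rfl)
    · rw [Set.indicator_of_notMem hz, tent_eq_zero hz]; simp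
  have h4 := h.enorm_integral_tent_mul_psum_le (by omega) (P := P) (𝓐 := low) (t := μ * B)
    fun I hI => ⟨hI.2, le_of_mem_regular hp₁ hI.1⟩
  calc tentMass d * ‖w x‖ₑ * volume P.toSet = tentMass d * volume P.toSet * ‖w x‖ₑ := by ring
    _ ≤ (∫⁻ z, ENNReal.ofReal (P.tent z)) * ‖w x‖ₑ := by gcongr; exact P.tentMass_mul_volume_le
    _ = ‖∫ z, (P.tent z : ℂ) * w x‖ₑ := h2.symm
    _ ≤ (oscConst d N p₁ * (Λ * B) * volume P.toSet + ∫⁻ z in P.toSet, ‖psum ψ reg z‖ₑ) +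
        4 * kerMass d * kerConst d * tentConst d * (μ * B) * volume P.toSet := by
        rw [h1]
        exact enorm_sub_le.trans (add_le_add h3 h4)
    _ = _ := by ring

theorem sq_mul_le_lintegral_sq {X : Type*} [MeasurableSpace X] {m : Measure X} {g : X → ℝ≥0∞}
    (hg : Measurable g) {c : ℝ≥0∞} (hc : c ≠ ∞) {s : Set X} (hs : m s ≠ ∞)
    (h : c * m s ≤ ∫⁻ x in s, g x ∂m) : c ^ 2 * m s ≤ ∫⁻ x in s, g x ^ 2 ∂m := by
  have h1 : ∀ a : ℝ≥0∞, 2 * c * a ≤ a ^ 2 + c ^ 2 := fun a => by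
    rcases eq_or_ne a ∞ with rfl | ha
    · simp
    · lift a to ℝ≥0 using ha
      lift c to ℝ≥0 using hc
      norm_cast
      rw [← NNReal.coe_le_coe]
      push_cast
      nlinarith [sq_nonneg ((a : ℝ) - c)]
  have h2 : c ^ 2 * m s + c ^ 2 * m s ≤ (∫⁻ x in s, g x ^ 2 ∂m) + c ^ 2 * m s := by
    calc c ^ 2 * m s + c ^ 2 * m s = 2 * c * (c * m s) := by ring
      _ ≤ 2 * c * ∫⁻ x in s, g x ∂m := by gcongr
      _ = ∫⁻ x in s, 2 * c * g x ∂m := (lintegral_const_mul _ hg).symm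
      _ ≤ ∫⁻ x in s, (g x ^ 2 + c ^ 2) ∂m := lintegral_mono fun x => h1 _
      _ = _ := by rw [lintegral_add_right _ measurable_const, setLIntegral_const]
  exact (ENNReal.add_le_add_iff_right
    (ENNReal.mul_ne_top (ENNReal.pow_ne_top hc) hs)).1 h2

/-- The set where the singular part of the sum may be large. -/
def singularSet (p₁ : ℝ) (α : DyadicCube d → ℝ≥0∞) (μ ν : ℝ≥0∞) (Q : DyadicCube d) :
    Set (EuclideanSpace ℝ (Fin d)) :=
  {x | ν * avgStar p₁ α Q ≤ singConst d p₁ * (μ * avgStar p₁ α Q) *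
    ∑' R : maximals (exceptional p₁ α μ Q), R.1.ker (d + 1) x}

theorem mul_volume_singularSet_le (hB0 : avgStar p₁ α Q ≠ 0) (hBt : avgStar p₁ α Q ≠ ∞) :
    ν * volume (singularSet p₁ α μ ν Q) ≤ singConst d p₁ * kerMass d * μ *
      ∑' R : maximals (exceptional p₁ α μ Q), volume R.1.toSet := by
  set B := avgStar p₁ α Q
  have hm : Measurable fun x => ∑' R : maximals (exceptional p₁ α μ Q), R.1.ker (d + 1) x :=
    Measurable.tsum fun R => R.1.measurable_ker _
  have h1 := mul_meas_ge_le_lintegral (μ := volume)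
    (hm.const_mul (singConst d p₁ * (μ * B))) (ν * B)
  rw [lintegral_const_mul _ hm, lintegral_tsum fun R => (R.1.measurable_ker _).aemeasurable] at h1
  simp only [lintegral_ker] at h1
  rw [ENNReal.tsum_mul_right] at h1
  rw [← ENNReal.mul_le_mul_iff_right hB0 hBt]
  calc B * (ν * volume (singularSet p₁ α μ ν Q)) = ν * B * volume (singularSet p₁ α μ ν Q) := by ring
    _ ≤ _ := h1
    _ = _ := by ring

/-- With suitable constants, the stopping children occupy at most half of a cube. -/
theorem exists_two_mul_tsum_stopChildren_le [NeZero d] (hN : Admissible d p₁ N) (hp₁ : 0 < p₁) :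
    ∃ Λ lam : ℝ≥0∞, 1 ≤ Λ ∧ Λ ≠ ∞ ∧ lam ≠ ∞ ∧
      ∀ (α : DyadicCube d → ℝ≥0∞) (ψ : DyadicCube d → EuclideanSpace ℝ (Fin d) → ℂ),
        AtomFamily N α ψ → ∀ Q, avgStar p₁ α Q ≠ 0 →
          2 * ∑' P : stopChildren p₁ α ψ Λ lam Q, volume P.1.toSet ≤ volume Q.toSet := by
  have hN' := hN
  unfold Admissible at hN'
  set n := nearCount d with hn
  have hn1 : 1 ≤ n := one_le_nearCount d
  have hnt : n ≠ ∞ := nearCount_ne_top d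
  set μ : ℝ≥0∞ := (6 * n ^ 2) ^ (1 / p₁) with hμdef
  have hμ6 : μ ^ p₁ = 6 * n ^ 2 := by
    rw [hμdef, ← ENNReal.rpow_mul, one_div, inv_mul_cancel₀ hp₁.ne', ENNReal.rpow_one]
  have hμ1 : 1 ≤ μ := ENNReal.one_le_rpow (one_le_mul (by norm_num) (one_le_pow₀ hn1)) (by positivity)
  have hμt : μ ≠ ∞ := ENNReal.rpow_ne_top_of_nonneg (by positivity)
    (ENNReal.mul_ne_top (by norm_num) (ENNReal.pow_ne_top hnt))
  set X : ℝ≥0∞ := singConst d p₁ * kerMass d * μ * n with hX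
  have hXt : X ≠ ∞ := ENNReal.mul_ne_top (ENNReal.mul_ne_top (ENNReal.mul_ne_top
    (singConst_ne_top d p₁) (kerMass_ne_top d)) hμt) hnt
  set ν : ℝ≥0∞ := 6 * (X + 1) with hν
  have hνt : ν ≠ ∞ := ENNReal.mul_ne_top (by norm_num) (by simp [hXt])
  set W : ℝ≥0∞ := 8 * kerMass d * kerConst d * (n * μ ^ 2) with hW
  have hWt : W ≠ ∞ := ENNReal.mul_ne_top (ENNReal.mul_ne_top (ENNReal.mul_ne_top (by norm_num)
    (kerMass_ne_top d)) (kerConst_ne_top d)) (ENNReal.mul_ne_top hnt (ENNReal.pow_ne_top hμt))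
  set κ : ℝ≥0∞ := 6 * (W + 1) with hκ
  have hκt : κ ≠ ∞ := ENNReal.mul_ne_top (by norm_num) (by simp [hWt])
  set Λ : ℝ≥0∞ := 2 * (n * μ) + 1 with hΛdef
  have hΛt : Λ ≠ ∞ := by
    rw [hΛdef]
    exact ENNReal.add_ne_top.2 ⟨ENNReal.mul_ne_top (by norm_num) (ENNReal.mul_ne_top hnt hμt),
      by norm_num⟩
  have hΛ1 : 1 ≤ Λ := le_add_self
  set U : ℝ≥0∞ := 4 * kerMass d * kerConst d * tentConst d * μ + oscConst d N p₁ * Λ with hU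
  have hUt : U ≠ ∞ := ENNReal.add_ne_top.2 ⟨ENNReal.mul_ne_top (ENNReal.mul_ne_top
    (ENNReal.mul_ne_top (ENNReal.mul_ne_top (by norm_num) (kerMass_ne_top d)) (kerConst_ne_top d))
    (tentConst_ne_top d)) hμt, ENNReal.mul_ne_top (oscConst_ne_top d N p₁) hΛt⟩
  set V : ℝ≥0∞ := oscConst d N p₁ * Λ + starConst d p₁ + ν with hV
  have hVt : V ≠ ∞ := ENNReal.add_ne_top.2 ⟨ENNReal.add_ne_top.2
    ⟨ENNReal.mul_ne_top (oscConst_ne_top d N p₁) hΛt, starConst_ne_top d p₁⟩, hνt⟩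
  have ht0 := tentMass_ne_zero d
  have htt : tentMass d ≠ ∞ := ENNReal.mul_ne_top (by simp)
    (ENNReal.mul_ne_top ENNReal.ofReal_ne_top measure_ball_lt_top.ne)
  refine ⟨Λ, V + (tentMass d)⁻¹ * (U + κ), hΛ1, hΛt, ENNReal.add_ne_top.2 ⟨hVt,
    ENNReal.mul_ne_top (ENNReal.inv_ne_top.2 ht0) (ENNReal.add_ne_top.2 ⟨hUt, hκt⟩)⟩, ?_⟩
  intro α ψ h Q hB0
  set B := avgStar p₁ α Q with hB
  have hBt : B ≠ ∞ := h.avgStar_ne_top hp₁ Q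
  set lam := V + (tentMass d)⁻¹ * (U + κ) with hlam
  set 𝓒 := stopChildren p₁ α ψ Λ lam Q with h𝓒
  set m := ∑' R : maximals (exceptional p₁ α μ Q), volume R.1.toSet with hm
  have hmle : 6 * (n * m) ≤ volume Q.toSet := by
    have h1 := tsum_maximals_exceptional_le (Q := Q) (μ := μ) hp₁ hB0 hBt
    rw [hμ6] at h1
    rw [← ENNReal.mul_le_mul_iff_right (one_pos.trans_le hn1).ne' hnt]
    calc n * (6 * (n * m)) = 6 * n ^ 2 * m := by ring
      _ ≤ _ := h1
  have hmle' : m ≤ volume Q.toSet := by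
    refine le_trans ?_ hmle
    rw [← mul_assoc]
    exact le_mul_of_one_le_left zero_le (one_le_mul (by norm_num) hn1)
  set E := exceptionalSet p₁ α μ Q
  set Z := singularSet p₁ α μ ν Q
  have hE : 6 * volume E ≤ volume Q.toSet :=
    le_trans (mul_le_mul_right volume_exceptionalSet_le _) hmle
  have hZ : 6 * volume Z ≤ volume Q.toSet := by
    have h1 := mul_volume_singularSet_le (μ := μ) (ν := ν) hB0 hBt
    have hX0 : X + 1 ≠ 0 := by simp
    have hX1 : X + 1 ≠ ∞ := by simp [hXt]
    rw [← ENNReal.mul_le_mul_iff_right hX0 hX1]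
    calc (X + 1) * (6 * volume Z) = ν * volume Z := by rw [hν]; ring
      _ ≤ singConst d p₁ * kerMass d * μ * m := h1
      _ ≤ singConst d p₁ * kerMass d * μ * (n * volume Q.toSet) := by
          gcongr
          exact hmle'.trans (le_mul_of_one_le_left zero_le hn1)
      _ = X * volume Q.toSet := by rw [hX]; ring
      _ ≤ _ := by gcongr; exact le_self_add
  set F := psum ψ (regular p₁ α μ Q) with hF
  have hFm : Measurable fun x => ‖F x‖ₑ := (h.measurable_psum (by omega) _).enorm
  have hFsq : ∫⁻ x, ‖F x‖ₑ ^ 2 ≤ W * (B ^ 2 * volume Q.toSet) := by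
    refine (h.lintegral_psum_sq_le (by omega) _).trans ?_
    calc _ ≤ 8 * kerMass d * kerConst d * (n * ((μ * B) ^ 2 * volume Q.toSet)) := by
          gcongr
          exact tsum_regular_le hp₁
      _ = _ := by rw [hW]; ring
  have hchild : ∀ P ∈ 𝓒, ¬ P.toSet ⊆ E ∪ Z →
      κ ^ 2 * B ^ 2 * volume P.toSet ≤ ∫⁻ x in P.toSet, ‖F x‖ₑ ^ 2 := by
    intro P hP hPEZ
    obtain ⟨x, hxP, hx⟩ := Set.not_subset.1 hPEZ
    simp only [Set.mem_union, not_or] at hx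
    have hle : avgStar p₁ α P ≤ Λ * B := by
      by_contra! hlt
      exact hx.1 (subset_exceptionalSet_of_lt hp₁ hP.1.1 hlt hxP)
    have hsing : ∑' I : singular p₁ α μ Q, α I * I.1.ker N x ≤ ν * B :=
      (tsum_singular_le hN hp₁ hμ1 hx.1).trans (not_le.1 hx.2).le
    have h1 := h.mul_avgStar_le_of_mem_stopChildren hN hp₁ hΛ1 hP hle hxP hsing
    have h2 := h.tentMass_mul_enorm_psum_le (μ := μ) hN hp₁ hΛ1 hP hxP
    set w := ‖psum ψ (regular p₁ α μ Q ∩ band P.k Q.k) x‖ₑ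
    have h3 : (U + κ) * B ≤ tentMass d * w := by
      have h4 : (tentMass d)⁻¹ * (U + κ) * B ≤ w := by
        rw [hlam, add_mul] at h1
        exact (ENNReal.add_le_add_iff_left (ENNReal.mul_ne_top hVt hBt)).1 h1
      calc (U + κ) * B = tentMass d * (tentMass d)⁻¹ * (U + κ) * B := by
            rw [ENNReal.mul_inv_cancel ht0 htt, one_mul]
        _ = tentMass d * ((tentMass d)⁻¹ * (U + κ) * B) := by ring
        _ ≤ _ := by gcongr
    have h5 : κ * B * volume P.toSet ≤ ∫⁻ z in P.toSet, ‖F z‖ₑ := by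
      have h6 : U * B * volume P.toSet + κ * B * volume P.toSet ≤
          U * B * volume P.toSet + ∫⁻ z in P.toSet, ‖F z‖ₑ := by
        calc _ = (U + κ) * B * volume P.toSet := by ring
          _ ≤ tentMass d * w * volume P.toSet := by gcongr
          _ ≤ _ := h2
          _ = _ := by rw [add_comm]
      exact (ENNReal.add_le_add_iff_left (ENNReal.mul_ne_top (ENNReal.mul_ne_top hUt hBt)
        P.volume_ne_top)).1 h6
    rw [← mul_pow]
    exact sq_mul_le_lintegral_sq hFm (ENNReal.mul_ne_top hκt hBt) P.volume_ne_top h5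
  have hdisj : 𝓒.PairwiseDisjoint toSet := maximals_pairwiseDisjoint _
  set 𝓒₁ := {P ∈ 𝓒 | P.toSet ⊆ E ∪ Z} with h𝓒₁
  set 𝓒₂ := {P ∈ 𝓒 | ¬ P.toSet ⊆ E ∪ Z} with h𝓒₂
  have hdisj' : ∀ 𝓓 ⊆ 𝓒, Pairwise (Function.onFun Disjoint fun P : 𝓓 => P.1.toSet) :=
    fun 𝓓 hD P R hne => hdisj (hD P.2) (hD R.2) fun he => hne (Subtype.ext he)
  have hs1 : ∑' P : 𝓒₁, volume P.1.toSet ≤ volume E + volume Z := by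
    rw [← measure_iUnion (hdisj' 𝓒₁ fun _ hP => hP.1) fun P => P.1.measurableSet]
    exact (measure_mono (Set.iUnion_subset fun P => P.2.2)).trans (measure_union_le _ _)
  have hs2 : 6 * ∑' P : 𝓒₂, volume P.1.toSet ≤ volume Q.toSet := by
    have h1 : κ ^ 2 * B ^ 2 * ∑' P : 𝓒₂, volume P.1.toSet ≤ W * (B ^ 2 * volume Q.toSet) := by
      rw [← ENNReal.tsum_mul_left]
      refine (ENNReal.tsum_le_tsum fun P : 𝓒₂ => hchild P.1 P.2.1 P.2.2).trans ?_
      rw [← lintegral_iUnion (fun P : 𝓒₂ => P.1.measurableSet) (hdisj' 𝓒₂ fun _ hP => hP.1)]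
      exact (setLIntegral_le_lintegral _ _).trans hFsq
    have hW0 : (W + 1) * B ^ 2 ≠ 0 := mul_ne_zero (by simp) (pow_ne_zero _ hB0)
    have hW1 : (W + 1) * B ^ 2 ≠ ∞ := ENNReal.mul_ne_top (by simp [hWt]) (ENNReal.pow_ne_top hBt)
    have hκ1 : 1 ≤ κ := one_le_mul (by norm_num) le_add_self
    rw [← ENNReal.mul_le_mul_iff_right hW0 hW1]
    calc (W + 1) * B ^ 2 * (6 * ∑' P : 𝓒₂, volume P.1.toSet)
        = κ * B ^ 2 * ∑' P : 𝓒₂, volume P.1.toSet := by rw [hκ]; ring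
      _ ≤ κ ^ 2 * B ^ 2 * ∑' P : 𝓒₂, volume P.1.toSet := by
          gcongr
          exact le_self_pow₀ hκ1 (by norm_num)
      _ ≤ W * (B ^ 2 * volume Q.toSet) := h1
      _ ≤ (W + 1) * B ^ 2 * volume Q.toSet := by
          rw [← mul_assoc]
          gcongr
          exact le_self_add
  have hs : ∑' P : 𝓒, volume P.1.toSet ≤
      (∑' P : 𝓒₁, volume P.1.toSet) + ∑' P : 𝓒₂, volume P.1.toSet := by
    refine le_trans (ENNReal.tsum_mono_subtype (fun P : DyadicCube d => volume P.toSet)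
      (t := 𝓒₁ ∪ 𝓒₂) fun P hP => ?_) (ENNReal.tsum_union_le (fun P : DyadicCube d =>
        volume P.toSet) _ _)
    by_cases hPEZ : P.toSet ⊆ E ∪ Z
    · exact Or.inl ⟨hP, hPEZ⟩
    · exact Or.inr ⟨hP, hPEZ⟩
  have h3 : (3 : ℝ≥0∞) ≠ 0 := by norm_num
  have h3' : (3 : ℝ≥0∞) ≠ ∞ := by norm_num
  rw [← ENNReal.mul_le_mul_iff_right h3 h3']
  calc 3 * (2 * ∑' P : 𝓒, volume P.1.toSet)
      ≤ 3 * (2 * ((volume E + volume Z) + ∑' P : 𝓒₂, volume P.1.toSet)) := by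
        gcongr
        exact hs.trans (add_le_add hs1 le_rfl)
    _ = 6 * volume E + 6 * volume Z + 6 * ∑' P : 𝓒₂, volume P.1.toSet := by ring
    _ ≤ volume Q.toSet + volume Q.toSet + volume Q.toSet := by gcongr
    _ = _ := by ring

end

/-! ### Trees of stopping cubes -/

section

open DyadicCube
open Filter hiding ker

variable {d : ℕ}

theorem isCarleson_of_pairwiseDisjoint {𝓕 : Set (DyadicCube d)}
    {E : DyadicCube d → Set (EuclideanSpace ℝ (Fin d))}
    (hE : ∀ Q ∈ 𝓕, MeasurableSet (E Q) ∧ E Q ⊆ Q.toSet ∧ volume Q.toSet ≤ 2 * volume (E Q))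
    (hd : 𝓕.PairwiseDisjoint E) : IsCarleson 2 𝓕 := fun R => by
  calc ∑' Q : {Q | Q ∈ 𝓕 ∧ Q.toSet ⊆ R.toSet}, volume Q.1.toSet
      ≤ ∑' Q : {Q | Q ∈ 𝓕 ∧ Q.toSet ⊆ R.toSet}, 2 * volume (E Q) :=
        ENNReal.tsum_le_tsum fun Q => (hE Q.1 Q.2.1).2.2
    _ = 2 * volume (⋃ Q : {Q | Q ∈ 𝓕 ∧ Q.toSet ⊆ R.toSet}, E Q) := by
        rw [ENNReal.tsum_mul_left, measure_iUnion]
        · exact fun P Q hne => hd P.2.1 Q.2.1 fun he => hne (Subtype.ext he)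
        · exact fun Q => (hE Q.1 Q.2.1).1
    _ ≤ 2 * volume R.toSet := by
        gcongr
        exact Set.iUnion_subset fun Q => (hE Q.1 Q.2.1).2.1.trans Q.2.2

theorem IsThin.isCarleson {𝓕 : Set (DyadicCube d)} (h : IsThin 𝓕) : IsCarleson 2 𝓕 := by
  obtain ⟨E, hE, hd⟩ := h.isSparse
  exact isCarleson_of_pairwiseDisjoint (fun Q hQ => ⟨(hE Q hQ).1, (hE Q hQ).2.1, (hE Q hQ).2.2.le⟩) hd

theorem IsCarleson.union {Λ₁ Λ₂ : ℝ≥0∞} {𝓕 𝓖 : Set (DyadicCube d)} (h₁ : IsCarleson Λ₁ 𝓕)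
    (h₂ : IsCarleson Λ₂ 𝓖) : IsCarleson (Λ₁ + Λ₂) (𝓕 ∪ 𝓖) := fun R => by
  rw [add_mul]
  refine le_trans ?_ (add_le_add (h₁ R) (h₂ R))
  refine le_trans (ENNReal.tsum_mono_subtype (fun Q : DyadicCube d => volume Q.toSet)
    (t := {Q | Q ∈ 𝓕 ∧ Q.toSet ⊆ R.toSet} ∪ {Q | Q ∈ 𝓖 ∧ Q.toSet ⊆ R.toSet}) ?_)
    (ENNReal.tsum_union_le (fun Q : DyadicCube d => volume Q.toSet) _ _)
  rintro Q ⟨hQ | hQ, hR⟩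
  · exact Or.inl ⟨hQ, hR⟩
  · exact Or.inr ⟨hQ, hR⟩

theorem isCarleson_originCubes [NeZero d] : IsCarleson 4 (originCubes : Set (DyadicCube d)) := by
  have h := (isThin_originCubes_class (d := d) 0).isCarleson.union
    (isThin_originCubes_class (d := d) 1).isCarleson
  have e : {Q : DyadicCube d | Q ∈ originCubes ∧ Q.k % 2 = ((0 : Fin 2) : ℕ)} ∪
      {Q : DyadicCube d | Q ∈ originCubes ∧ Q.k % 2 = ((1 : Fin 2) : ℕ)} = originCubes := by
    ext Q
    simp only [Set.mem_union, Set.mem_ofPred_eq, Fin.val_zero, Fin.val_one]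
    constructor
    · rintro (h | h) <;> exact h.1
    · intro hQ
      rcases Int.emod_two_eq_zero_or_one Q.k with h | h
      · exact Or.inl ⟨hQ, by simpa using h⟩
      · exact Or.inr ⟨hQ, by simpa using h⟩
  rw [e] at h
  norm_num at h
  exact h

/-- The family of all cubes near some member of `𝓢`. -/
def nearFamily (𝓢 : Set (DyadicCube d)) : Set (DyadicCube d) := {P | ∃ Q ∈ 𝓢, ∃ v, P = Q.shift v}

theorem IsCarleson.nearFamily [NeZero d] {Λ : ℝ≥0∞} {𝓢 : Set (DyadicCube d)} (h : IsCarleson Λ 𝓢) :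
    IsCarleson (nearCount d ^ 2 * Λ) (nearFamily 𝓢) := fun R => by
  have hcov : {P | P ∈ SparseSquare.nearFamily 𝓢 ∧ P.toSet ⊆ R.toSet} ⊆
      ⋃ v, (fun Q : DyadicCube d => Q.shift v) '' ⋃ u, {Q | Q ∈ 𝓢 ∧ Q.toSet ⊆ (R.shift u).toSet} := by
    rintro P ⟨⟨Q, hQ, v, rfl⟩, hsub⟩
    obtain ⟨hk, hup⟩ := subset_iff.1 hsub
    have h1 := (near_shift Q v).symm.up hk
    rw [hup] at h1
    obtain ⟨u, hu⟩ := near_iff.1 h1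
    exact Set.mem_iUnion.2 ⟨v, Q, Set.mem_iUnion.2 ⟨u, hQ, subset_iff.2 ⟨hk, hu⟩⟩, rfl⟩
  refine (ENNReal.tsum_mono_subtype (fun Q : DyadicCube d => volume Q.toSet) hcov).trans ?_
  refine (ENNReal.tsum_iUnion_le_tsum (fun Q : DyadicCube d => volume Q.toSet) _).trans ?_
  have hv : ∀ v, ∑' P : ((fun Q : DyadicCube d => Q.shift v) ''
      ⋃ u, {Q | Q ∈ 𝓢 ∧ Q.toSet ⊆ (R.shift u).toSet} : Set (DyadicCube d)), volume P.1.toSet ≤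
        nearCount d * (Λ * volume R.toSet) := fun v => by
    rw [tsum_image (fun Q : DyadicCube d => volume Q.toSet) (shift_left_injective v).injOn]
    simp only [volume_eq_of_k (shift_k _ v)]
    refine (ENNReal.tsum_iUnion_le_tsum (fun Q : DyadicCube d => volume Q.toSet) _).trans ?_
    rw [tsum_fintype]
    refine (Finset.sum_le_sum fun u _ => (h (R.shift u)).trans_eq
      (by rw [volume_eq_of_k (shift_k R u)])).trans_eq ?_
    rw [Finset.sum_const, nsmul_eq_mul, nearCount, Finset.card_univ]
  rw [tsum_fintype]
  refine (Finset.sum_le_sum fun v _ => hv v).trans_eq ?_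
  rw [Finset.sum_const, nsmul_eq_mul, nearCount, Finset.card_univ]
  ring

/-- Each cube is assigned disjoint strict subcubes occupying at most half of it. -/
structure IsHalving (ch : DyadicCube d → Set (DyadicCube d)) : Prop where
  subset : ∀ {Q P}, P ∈ ch Q → P.toSet ⊆ Q.toSet
  ne : ∀ {Q P}, P ∈ ch Q → P ≠ Q
  disjoint : ∀ Q, (ch Q).PairwiseDisjoint toSet
  volume_le : ∀ Q, 2 * ∑' P : ch Q, volume P.1.toSet ≤ volume Q.toSet

/-- `P` is an iterated child of `Q`. -/
def Descends (ch : DyadicCube d → Set (DyadicCube d)) : DyadicCube d → DyadicCube d → Prop :=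
  Relation.ReflTransGen fun Q P => P ∈ ch Q

/-- The `n`-fold iterated children of `Q` cover this set. -/
def deep (ch : DyadicCube d → Set (DyadicCube d)) :
    ℕ → DyadicCube d → Set (EuclideanSpace ℝ (Fin d))
  | 0, Q => Q.toSet
  | n + 1, Q => ⋃ P ∈ ch Q, deep ch n P

/-- The maximal cubes that do not touch the origin. -/
def roots : Set (DyadicCube d) := {R | R ∉ originCubes ∧ R.anc 1 ∈ originCubes}

/-- The iterated children of the maximal cubes that do not touch the origin. -/
def tree (ch : DyadicCube d → Set (DyadicCube d)) : Set (DyadicCube d) :=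
  {P | ∃ R ∈ roots, Descends ch R P}

theorem eq_of_mem_roots {R R' : DyadicCube d} (hR : R ∈ roots) (hR' : R' ∈ roots)
    {x : EuclideanSpace ℝ (Fin d)} (hx : x ∈ R.toSet) (hx' : x ∈ R'.toSet) : R = R' := by
  wlog hle : R.k ≤ R'.k generalizing R R'
  · exact (this hR' hR hx' hx (not_le.1 hle).le).symm
  rcases hle.eq_or_lt with hk | hk
  · exact eq_of_mem_of_k hx hx' hk
  · have h1 := up_mem_originCubes hR.2 (k := R'.k) (by simp only [anc_k]; omega)
    rw [up_eq_of_mem (R.subset_anc 1 hx) hx' (by simp only [anc_k]; omega)] at h1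
    exact absurd h1 hR'.1

theorem exists_mem_roots {x : EuclideanSpace ℝ (Fin d)} (hx : x ≠ 0) :
    ∃ R ∈ roots, x ∈ R.toSet := by
  obtain ⟨i, hi⟩ : ∃ i, x i ≠ 0 := by
    by_contra! h
    exact hx (by ext i; simpa using h i)
  obtain ⟨n, hn⟩ := exists_pow_lt_of_lt_one (abs_pos.2 hi) (by norm_num : (2⁻¹ : ℝ) < 1)
  have hlow : cubeAt (-n : ℤ) x ∉ originCubes := fun h => by
    obtain ⟨h1, h2⟩ := mem_cubeAt (-n : ℤ) x i
    have hs : (cubeAt (-n : ℤ) x).side = 2⁻¹ ^ n := by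
      simp [side]
    rw [hs] at h1 h2
    rcases h i with h0 | h0 <;> rw [h0] at h1 h2 <;> push_cast at h1 h2
    · rw [abs_of_nonneg (by linarith)] at hn; linarith
    · have : x i < 0 := by linarith
      rw [abs_of_neg this] at hn; linarith
  obtain ⟨K, hK⟩ := exists_up_mem_originCubes (cubeAt (-n : ℤ) x)
  obtain ⟨k, hk, hmax⟩ := Int.exists_greatest_of_bdd
    (P := fun k => -(n : ℤ) ≤ k ∧ cubeAt k x ∉ originCubes)
    ⟨K, fun k hk => by
      by_contra! hlt
      refine hk.2 ?_
      rw [← cubeAt_up x hk.1]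
      exact hK k hlt.le⟩ ⟨-n, le_rfl, hlow⟩
  refine ⟨cubeAt k x, ⟨hk.2, ?_⟩, mem_cubeAt k x⟩
  by_contra h1
  unfold anc at h1
  rw [cubeAt_up x (by simp)] at h1
  have := hmax _ ⟨by have := hk.1; simp only [cubeAt_k]; omega, h1⟩
  simp only [cubeAt_k] at this
  omega

namespace IsHalving

variable {ch : DyadicCube d → Set (DyadicCube d)}

theorem subset_of_descends (h : IsHalving ch) {Q P : DyadicCube d} (hP : Descends ch Q P) :
    P.toSet ⊆ Q.toSet := by
  induction hP with
  | refl => exact subset_rfl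
  | tail _ hlast ih => exact (h.subset hlast).trans ih

theorem volume_deep_le (h : IsHalving ch) (n : ℕ) (Q : DyadicCube d) :
    volume (deep ch n Q) ≤ 2⁻¹ ^ n * volume Q.toSet := by
  induction n generalizing Q with
  | zero => simp [deep]
  | succ n ih =>
    refine (measure_biUnion_le _ (Set.to_countable _) _).trans ?_
    refine (ENNReal.tsum_le_tsum fun P : ch Q => ih P.1).trans ?_
    rw [ENNReal.tsum_mul_left, pow_succ, mul_assoc]
    gcongr
    calc ∑' P : ch Q, volume P.1.toSet = 2⁻¹ * (2 * ∑' P : ch Q, volume P.1.toSet) := by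
          rw [← mul_assoc, ENNReal.inv_mul_cancel (by norm_num) (by norm_num), one_mul]
      _ ≤ _ := by gcongr; exact h.volume_le Q

theorem ae_exists_notMem_deep (h : IsHalving ch) :
    ∀ᵐ x : EuclideanSpace ℝ (Fin d), ∀ Q, ∃ n, x ∉ deep ch n Q := by
  rw [ae_all_iff]
  intro Q
  have h0 : volume (⋂ n, deep ch n Q) = 0 := by
    have h1 : ∀ n : ℕ, volume (⋂ n, deep ch n Q) ≤ 2⁻¹ ^ n * volume Q.toSet := fun n =>
      (measure_mono (Set.iInter_subset _ n)).trans (h.volume_deep_le n Q)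
    have h2 : Tendsto (fun n : ℕ => (2⁻¹ : ℝ≥0∞) ^ n * volume Q.toSet) atTop (nhds 0) := by
      have := ENNReal.Tendsto.mul_const (b := volume Q.toSet)
        (ENNReal.tendsto_pow_atTop_nhds_zero_of_lt_one (r := 2⁻¹)
          (by rw [ENNReal.inv_lt_one]; norm_num)) (Or.inr Q.volume_ne_top)
      rwa [zero_mul] at this
    exact le_antisymm (ge_of_tendsto' h2 h1) zero_le
  filter_upwards [measure_eq_zero_iff_ae_notMem.1 h0] with x hx
  simpa using hx

theorem total (h : IsHalving ch) {R P Q : DyadicCube d} (hP : Descends ch R P)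
    (hQ : Descends ch R Q) {x : EuclideanSpace ℝ (Fin d)} (hxP : x ∈ P.toSet) (hxQ : x ∈ Q.toSet) :
    Descends ch P Q ∨ Descends ch Q P := by
  have key : ∀ {P}, Descends ch R P → x ∈ P.toSet →
      Relation.ReflTransGen (fun Q P => P ∈ ch Q ∧ x ∈ P.toSet) R P := by
    intro P hP
    induction hP with
    | refl => exact fun _ => .refl
    | tail _ hlast ih => exact fun hx => (ih (h.subset hlast hx)).tail ⟨hlast, hx⟩
  have hun : Relator.RightUnique (fun Q P : DyadicCube d => P ∈ ch Q ∧ x ∈ P.toSet) := by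
    rintro Q P P' ⟨h1, h2⟩ ⟨h3, h4⟩
    by_contra hne
    exact Set.disjoint_left.1 (h.disjoint Q h1 h3 hne) h2 h4
  exact (Relation.ReflTransGen.total_of_right_unique hun (key hP hxP) (key hQ hxQ)).imp
    (Relation.ReflTransGen.mono (fun _ _ h => h.1) _ _) (Relation.ReflTransGen.mono (fun _ _ h => h.1) _ _)

theorem isCarleson_tree (h : IsHalving ch) : IsCarleson 2 (tree ch) := by
  refine isCarleson_of_pairwiseDisjoint (E := fun Q => Q.toSet \ ⋃ P ∈ ch Q, P.toSet)
    (fun Q _ => ⟨Q.measurableSet.diff (measurableSet_biUnion_toSet _), Set.sdiff_subset, ?_⟩) ?_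
  · set U := ⋃ P ∈ ch Q, P.toSet
    have h1 : volume Q.toSet ≤ volume (Q.toSet \ U) + volume U :=
      (measure_mono (by rw [Set.sdiff_union_self]; exact Set.subset_union_left)).trans
        (measure_union_le _ _)
    have h2 : 2 * volume U ≤ volume Q.toSet :=
      (mul_le_mul_right (measure_biUnion_le _ (Set.to_countable _) _) 2).trans (h.volume_le Q)
    refine (ENNReal.add_le_add_iff_right Q.volume_ne_top).1 ?_
    calc volume Q.toSet + volume Q.toSet
        ≤ (volume (Q.toSet \ U) + volume U) + (volume (Q.toSet \ U) + volume U) :=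
          add_le_add h1 h1
      _ = 2 * volume (Q.toSet \ U) + 2 * volume U := by ring
      _ ≤ _ := by gcongr
  · rintro P ⟨R, hR, hP⟩ Q ⟨R', hR', hQ⟩ hne
    refine Set.disjoint_left.2 fun x hxP hxQ => ?_
    obtain rfl := eq_of_mem_roots hR hR' (h.subset_of_descends hP hxP.1)
      (h.subset_of_descends hQ hxQ.1)
    have key : ∀ {P Q : DyadicCube d}, Descends ch P Q → P ≠ Q → x ∈ Q.toSet →
        x ∈ ⋃ P' ∈ ch P, P'.toSet := fun hPQ hne hx => by
      rcases hPQ.cases_head with he | ⟨P', hP', hrest⟩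
      · exact absurd he hne
      · exact Set.mem_biUnion hP' (h.subset_of_descends hrest hx)
    rcases h.total hP hQ hxP.1 hxQ.1 with h1 | h1
    · exact hxP.2 (key h1 hne hxQ.1)
    · exact hxQ.2 (key h1 hne.symm hxP.1)

end IsHalving

end

/-! ### Pointwise sparse domination -/

section

open DyadicCube
open Filter hiding ker

variable {d : ℕ} {N : ℕ} {α : DyadicCube d → ℝ≥0∞}
  {ψ : DyadicCube d → EuclideanSpace ℝ (Fin d) → ℂ} {p₁ : ℝ} {Λ lam : ℝ≥0∞} {Q P : DyadicCube d}

theorem avgStar_ne_zero [NeZero d] (hp₁ : 0 < p₁) {I : DyadicCube d} (hI : α I ≠ 0) (Q : DyadicCube d) :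
    avgStar p₁ α Q ≠ 0 := by
  obtain ⟨j, hj⟩ := exists_in3_anc I Q
  intro h0
  have h1 : (4⁻¹ : ℝ≥0∞) ^ j * avg3 p₁ α (Q.anc j) = 0 := ENNReal.tsum_eq_zero.1 h0 j
  have h2 : avg3 p₁ α (Q.anc j) = 0 := (mul_eq_zero.1 h1).resolve_left (by simp)
  have h3 := le_avg3_of_in3 hp₁ α hj
  rw [h2, mul_zero] at h3
  exact hI (le_antisymm h3 zero_le)

theorem isHalving_stopChildren
    (h : ∀ Q, 2 * ∑' P : stopChildren p₁ α ψ Λ lam Q, volume P.1.toSet ≤ volume Q.toSet) :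
    IsHalving (stopChildren p₁ α ψ Λ lam) :=
  ⟨fun hP => hP.1.1, fun hP => hP.1.2.1, fun _ => maximals_pairwiseDisjoint _, h⟩

theorem AtomFamily.exists_finset_descends [NeZero d] (h : AtomFamily N α ψ) (hN : Admissible d p₁ N)
    (hp₁ : 0 < p₁) (hΛ : 1 ≤ Λ) (hch : IsHalving (stopChildren p₁ α ψ Λ lam)) (n : ℕ)
    {x : EuclideanSpace ℝ (Fin d)} (hx : x ∈ Q.toSet)
    (hdeep : x ∉ deep (stopChildren p₁ α ψ Λ lam) n Q) :
    ∃ s : Finset (DyadicCube d), Q ∈ s ∧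
      (∀ P ∈ s, Descends (stopChildren p₁ α ψ Λ lam) Q P ∧ x ∈ P.toSet) ∧
      ‖psum ψ {I | I.k ≤ Q.k} x‖ₑ ≤
        (lam + 3 * starConst d p₁ * Λ) * ∑ P ∈ s, avgStar p₁ α P := by
  classical
  have hN1 : d + 1 ≤ N := by unfold Admissible at hN; omega
  induction n generalizing Q with
  | zero => exact absurd hx hdeep
  | succ n ih =>
    by_cases hP : ∃ P ∈ stopChildren p₁ α ψ Λ lam Q, x ∈ P.toSet
    · obtain ⟨P, hP, hxP⟩ := hP
      have hdeep' : x ∉ deep (stopChildren p₁ α ψ Λ lam) n P := fun hmem =>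
        hdeep (Set.mem_biUnion hP hmem)
      obtain ⟨s, -, hs, hle⟩ := ih hxP hdeep'
      have hk := k_lt_of_ssubset (hch.subset hP) (hch.ne hP)
      have hQs : Q ∉ s := fun hmem => by
        have := k_le_of_subset (hch.subset_of_descends (hs Q hmem).1)
        omega
      refine ⟨insert Q s, Finset.mem_insert_self _ _, fun R hR => ?_, ?_⟩
      · rcases Finset.mem_insert.1 hR with rfl | hR
        · exact ⟨.refl, hx⟩
        · exact ⟨.head hP (hs R hR).1, (hs R hR).2⟩
      · have hsplit : psum ψ {I | I.k ≤ Q.k} x =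
            psum ψ (band P.k Q.k) x + psum ψ {I | I.k ≤ P.k} x := by
          rw [← h.psum_union hN1]
          · congr 1
            ext I
            simp only [band, Set.mem_union, Set.mem_ofPred_eq]; omega
          · refine Set.disjoint_left.2 fun I h1 h2 => ?_
            simp only [band, Set.mem_ofPred_eq] at h1 h2; omega
        rw [hsplit, Finset.sum_insert hQs, mul_add]
        exact (enorm_add_le _ _).trans
          (add_le_add (h.enorm_psum_band_le_of_mem hN hp₁ hΛ hP hxP) hle)
    · push Not at hP
      refine ⟨{Q}, Finset.mem_singleton_self _, fun R hR => ?_, ?_⟩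
      · rw [Finset.mem_singleton.1 hR]; exact ⟨.refl, hx⟩
      · rw [Finset.sum_singleton]
        refine (h.enorm_psum_le_of_notMem hN hp₁ hΛ hx hP).trans ?_
        gcongr
        norm_num

theorem isGood_of_descends (hP : Descends (stopChildren p₁ α ψ Λ lam) Q P) (hne : P ≠ Q) :
    IsGood p₁ α P := by
  rcases hP.cases_tail with he | ⟨R, -, hR⟩
  · exact absurd he hne
  · exact hR.1.2.2.1

theorem finset_sum_le_sparseSum {𝓕 : Set (DyadicCube d)} (c : DyadicCube d → ℝ≥0∞)
    {x : EuclideanSpace ℝ (Fin d)} (s : Finset (DyadicCube d)) (hs : ∀ Q ∈ s, Q ∈ 𝓕 ∧ x ∈ Q.toSet) :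
    ∑ Q ∈ s, c Q ≤ sparseSum 𝓕 c x := by
  unfold sparseSum
  rw [tsum_subtype 𝓕 (fun Q : DyadicCube d => Q.toSet.indicator (fun _ => c Q) x)]
  refine le_trans (Finset.sum_le_sum fun Q hQ => ?_) (ENNReal.sum_le_tsum s)
  rw [Set.indicator_of_mem (hs Q hQ).1, Set.indicator_of_mem (hs Q hQ).2]

theorem tsum_le_sparseSum [NeZero d] {𝓕 : Set (DyadicCube d)} (c : DyadicCube d → ℝ≥0∞)
    {x : EuclideanSpace ℝ (Fin d)} {ι : Type*} {e : ι → DyadicCube d} (he : Function.Injective e)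
    (hs : ∀ i, e i ∈ 𝓕 ∧ x ∈ (e i).toSet) : ∑' i, c (e i) ≤ sparseSum 𝓕 c x := by
  classical
  rw [ENNReal.tsum_eq_iSup_sum]
  refine iSup_le fun t => ?_
  rw [← Finset.sum_image (f := c) he.injOn]
  refine finset_sum_le_sparseSum c _ fun Q hQ => ?_
  obtain ⟨i, -, rfl⟩ := Finset.mem_image.1 hQ
  exact hs i

theorem tsum_avgStar_anc_le (p₁ : ℝ) (α : DyadicCube d → ℝ≥0∞) (Q : DyadicCube d) :
    ∑' i : ℕ, avgStar p₁ α (Q.anc (i + 1)) ≤ 2 * ∑' i : ℕ, avg3 p₁ α (Q.anc (i + 1)) := by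
  unfold avgStar
  rw [ENNReal.tsum_comm]
  have h1 : ∀ j : ℕ, ∑' i : ℕ, 4⁻¹ ^ j * avg3 p₁ α ((Q.anc (i + 1)).anc j) ≤
      2⁻¹ ^ j * ∑' i : ℕ, avg3 p₁ α (Q.anc (i + 1)) := fun j => by
    rw [ENNReal.tsum_mul_left]
    refine mul_le_mul' (pow_le_pow_left' (by norm_num) j) ?_
    · simp only [anc_anc]
      have hinj : Function.Injective fun i : ℕ => i + j := fun a b hab => by simpa using hab
      refine le_trans (le_of_eq (tsum_congr fun i => ?_))
        (ENNReal.tsum_comp_le_tsum_of_injective hinj fun i => avg3 p₁ α (Q.anc (i + 1)))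
      rw [add_right_comm]
  refine (ENNReal.tsum_le_tsum h1).trans_eq ?_
  rw [ENNReal.tsum_mul_right, ENNReal.tsum_geometric, ENNReal.one_sub_inv_two, inv_inv]

theorem AtomFamily.enorm_psum_large_le [NeZero d] (h : AtomFamily N α ψ) (hN : Admissible d p₁ N)
    (hp₁ : 0 < p₁) {x : EuclideanSpace ℝ (Fin d)} (hx : x ∈ Q.toSet) :
    ‖psum ψ {I | Q.k < I.k} x‖ₑ ≤
      starConst d p₁ * ∑' i : ℕ, avgStar p₁ α (Q.anc (i + 1)) := by
  unfold Admissible at hN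
  have hcov : {I : DyadicCube d | Q.k < I.k} ⊆ ⋃ i : ℕ, level (Q.anc (i + 1)).k := fun I hI => by
    simp only [Set.mem_ofPred_eq] at hI
    refine Set.mem_iUnion.2 ⟨(I.k - Q.k - 1).toNat, ?_⟩
    simp only [level, Set.mem_ofPred_eq, anc_k]; omega
  refine (h.enorm_psum_le _ x).trans ?_
  refine (ENNReal.tsum_mono_subtype (fun I : DyadicCube d => α I * I.ker N x) hcov).trans ?_
  refine (ENNReal.tsum_iUnion_le_tsum (fun I : DyadicCube d => α I * I.ker N x) _).trans ?_
  rw [← ENNReal.tsum_mul_left]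
  exact ENNReal.tsum_le_tsum fun i => tsum_level_le hp₁ α (N := N) (by omega)
    (Q.subset_anc _ hx)

/-- The constant in the pointwise sparse bound. -/
def sparseConst (d : ℕ) (p₁ : ℝ) (Λ lam : ℝ≥0∞) : ℝ≥0∞ :=
  (lam + 3 * starConst d p₁ * Λ) * 4 + 2 * starConst d p₁

theorem sparseConst_ne_top (hΛ : Λ ≠ ∞) (hlam : lam ≠ ∞) : sparseConst d p₁ Λ lam ≠ ∞ := by
  have := starConst_ne_top d p₁
  refine ENNReal.add_ne_top.2 ⟨ENNReal.mul_ne_top (ENNReal.add_ne_top.2 ⟨hlam, ?_⟩) (by norm_num),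
    ENNReal.mul_ne_top (by norm_num) this⟩
  exact ENNReal.mul_ne_top (ENNReal.mul_ne_top (by norm_num) this) hΛ

/-- Pointwise domination of the full sum by a sparse sum of averages. -/
theorem AtomFamily.ae_enorm_psum_univ_le [NeZero d] (h : AtomFamily N α ψ) (hN : Admissible d p₁ N)
    (hp₁ : 0 < p₁) (hΛ : 1 ≤ Λ) (hch : IsHalving (stopChildren p₁ α ψ Λ lam)) :
    ∀ᵐ x, ‖psum ψ Set.univ x‖ₑ ≤ sparseConst d p₁ Λ lam *
      sparseSum (originCubes ∪ tree (stopChildren p₁ α ψ Λ lam)) (avg3 p₁ α) x := by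
  classical
  have hN1 : d + 1 ≤ N := by unfold Admissible at hN; omega
  have h0 : ∀ᵐ x : EuclideanSpace ℝ (Fin d), x ≠ 0 := by
    have : Nontrivial (EuclideanSpace ℝ (Fin d)) :=
      Module.nontrivial_of_finrank_pos (R := ℝ) (by
        rw [finrank_euclideanSpace_fin]; exact NeZero.pos d)
    exact compl_mem_ae_iff.2 (measure_singleton 0)
  filter_upwards [h0, hch.ae_exists_notMem_deep] with x hx0 hdeep
  obtain ⟨R, hR, hxR⟩ := exists_mem_roots hx0
  obtain ⟨n, hn⟩ := hdeep R
  obtain ⟨s, hRs, hs, hle⟩ := h.exists_finset_descends hN hp₁ hΛ hch n hxR hn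
  set 𝓢 := originCubes ∪ tree (stopChildren p₁ α ψ Λ lam)
  set S := sparseSum 𝓢 (avg3 p₁ α) x
  have hanc : ∑' i : ℕ, avg3 p₁ α (R.anc (i + 1)) ≤ S := by
    refine tsum_le_sparseSum (avg3 p₁ α) (e := fun i : ℕ => R.anc (i + 1)) (fun i j hij => ?_)
      fun i => ⟨Or.inl ?_, R.subset_anc _ hxR⟩
    · have := congrArg DyadicCube.k hij
      simp only [anc_k] at this
      omega
    · have := up_mem_originCubes hR.2 (k := R.k + (i + 1 : ℕ)) (by simp only [anc_k]; push_cast; omega)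
      unfold anc at this ⊢
      rwa [up_up _ (by omega) (by push_cast; omega)] at this
  have hsum : ∑ P ∈ s, avg3 p₁ α P ≤ S :=
    finset_sum_le_sparseSum _ s fun P hP => ⟨Or.inr ⟨R, hR, (hs P hP).1⟩, (hs P hP).2⟩
  have hstar : ∑ P ∈ s, avgStar p₁ α P ≤ 4 * S := by
    rw [← Finset.add_sum_erase s _ hRs]
    have h1 : ∑ P ∈ s.erase R, avgStar p₁ α P ≤ 2 * S := by
      refine le_trans ?_ (mul_le_mul_right hsum 2)
      rw [Finset.mul_sum]
      refine le_trans (Finset.sum_le_sum fun P hP => ?_)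
        (Finset.sum_le_sum_of_subset (Finset.erase_subset R s))
      obtain ⟨hne, hPs⟩ := Finset.mem_erase.1 hP
      exact isGood_of_descends (hs P hPs).1 hne
    have h2 : avgStar p₁ α R ≤ 2 * S := by
      rw [avgStar_eq]
      have h3 : avg3 p₁ α R ≤ S := le_trans (Finset.single_le_sum (f := avg3 p₁ α)
        (fun _ _ => zero_le) hRs) hsum
      have h4 : avgStar p₁ α (R.anc 1) ≤ 2 * S :=
        ((ENNReal.le_tsum (f := fun i : ℕ => avgStar p₁ α (R.anc (i + 1))) 0).trans
          (tsum_avgStar_anc_le p₁ α R)).trans (mul_le_mul_right hanc 2)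
      calc _ ≤ S + 4⁻¹ * (2 * S) := by gcongr
        _ ≤ S + S := by
          gcongr
          rw [← mul_assoc]
          refine mul_le_of_le_one_left zero_le ?_
          rw [← ENNReal.div_eq_inv_mul]
          exact ENNReal.div_le_of_le_mul (by norm_num)
        _ = _ := by ring
    calc _ ≤ 2 * S + 2 * S := add_le_add h2 h1
      _ = _ := by ring
  have hsplit : psum ψ Set.univ x = psum ψ {I | I.k ≤ R.k} x + psum ψ {I | R.k < I.k} x := by
    rw [← h.psum_union hN1]
    · congr 1
      ext I
      simp only [Set.mem_union, Set.mem_univ, Set.mem_ofPred_eq, true_iff]; omega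
    · refine Set.disjoint_left.2 fun I h1 h2 => ?_
      simp only [Set.mem_ofPred_eq] at h1 h2; omega
  rw [hsplit]
  refine (enorm_add_le _ _).trans ?_
  calc _ ≤ (lam + 3 * starConst d p₁ * Λ) * (4 * S) + starConst d p₁ * (2 * S) := by
        refine add_le_add (hle.trans (mul_le_mul_right hstar _)) ?_
        refine (h.enorm_psum_large_le hN hp₁ hxR).trans (mul_le_mul_right ?_ _)
        exact (tsum_avgStar_anc_le p₁ α R).trans (mul_le_mul_right hanc 2)
    _ = _ := by unfold sparseConst; ring

/-- Sparse domination of sums of atoms. -/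
theorem exists_carleson_ae_enorm_psum_le [NeZero d] (hN : Admissible d p₁ N) (hp₁ : 0 < p₁) :
    ∃ C : ℝ≥0∞, C ≠ ∞ ∧ ∀ (α : DyadicCube d → ℝ≥0∞)
      (ψ : DyadicCube d → EuclideanSpace ℝ (Fin d) → ℂ), AtomFamily N α ψ →
      ∃ 𝓢 : Set (DyadicCube d), IsCarleson 6 𝓢 ∧
        ∀ᵐ x, ‖psum ψ Set.univ x‖ₑ ≤ C * sparseSum 𝓢 (avg3 p₁ α) x := by
  obtain ⟨Λ, lam, hΛ1, hΛ, hlam, hmain⟩ := exists_two_mul_tsum_stopChildren_le (d := d) hN hp₁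
  refine ⟨sparseConst d p₁ Λ lam, sparseConst_ne_top hΛ hlam, fun α ψ h => ?_⟩
  by_cases h0 : ∀ I, α I = 0
  · refine ⟨∅, fun R => ?_, Eventually.of_forall fun x => ?_⟩
    · have : ∑' Q : {Q : DyadicCube d | Q ∈ (∅ : Set (DyadicCube d)) ∧ Q.toSet ⊆ R.toSet},
          volume Q.1.toSet = 0 := ENNReal.tsum_eq_zero.2 fun Q => Q.2.1.elim
      rw [this]; exact zero_le
    · refine le_trans (h.enorm_psum_le _ x) ?_
      simp [h0]
  · push Not at h0
    obtain ⟨I, hI⟩ := h0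
    have hch := isHalving_stopChildren fun Q => hmain α ψ h Q (avgStar_ne_zero hp₁ hI Q)
    refine ⟨_, ?_, h.ae_enorm_psum_univ_le hN hp₁ hΛ1 hch⟩
    have := isCarleson_originCubes.union hch.isCarleson_tree
    norm_num at this
    exact this

end

/-! ### The weighted sparse bound -/

section

open DyadicCube
open Filter hiding ker

variable {d : ℕ}

theorem relDist_le_of_near {Q R : DyadicCube d} (h : Near Q R) {x : EuclideanSpace ℝ (Fin d)}
    (hx : x ∈ Q.toSet) : R.relDist x ≤ 1 + 2 * d := by
  have hs := R.side_pos
  have h1 : R.side = Q.side := by simp [side, h.1]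
  have h2 : Metric.infDist x R.toSet ≤ 2 * d * R.side := by
    rw [h1]
    refine (Metric.infDist_le_dist_of_mem R.corner_mem).trans ?_
    rw [dist_eq_norm]
    exact norm_sub_le_of_near h hx R.corner_mem
  have := (div_le_iff₀ hs).2 h2
  unfold relDist; linarith

theorem one_le_relDist (R : DyadicCube d) (x : EuclideanSpace ℝ (Fin d)) : 1 ≤ R.relDist x := by
  have := R.side_pos
  have h2 : 0 ≤ Metric.infDist x R.toSet / R.side := div_nonneg Metric.infDist_nonneg this.le
  unfold relDist; linarith

theorem weightOn_le_of_near (M : ℕ) {r : ℝ} (hr : 0 < r) {w : EuclideanSpace ℝ (Fin d) → ℝ}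
    (hw : ∀ x, 0 < w x) {Q R : DyadicCube d} (h : Near Q R) :
    weightOn r (fun x => ENNReal.ofReal (w x)) Q ≤
      ENNReal.ofReal ((1 + 2 * d) ^ M) ^ (1 / r) * (weightAverage M r w R * volume R.toSet) := by
  unfold weightOn weightAverage
  rw [volume_eq_of_k h.1, ← mul_assoc, ← ENNReal.mul_rpow_of_nonneg _ _ (by positivity)]
  gcongr
  rw [← mul_div_assoc]
  gcongr
  rw [← lintegral_const_mul' _ _ ENNReal.ofReal_ne_top]
  refine le_trans (setLIntegral_mono' Q.measurableSet fun x hx => ?_) (setLIntegral_le_lintegral _ _)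
  have h1 := one_le_relDist R x
  have h2 := relDist_le_of_near h hx
  have hwr := Real.rpow_nonneg (hw x).le r
  rw [ENNReal.ofReal_rpow_of_pos (hw x), ← ENNReal.ofReal_mul (by positivity)]
  refine ENNReal.ofReal_le_ofReal ?_
  unfold tail
  have h3 : 1 ≤ (1 + 2 * d : ℝ) ^ M * (R.relDist x ^ M)⁻¹ := by
    have : 0 < R.relDist x := by linarith
    rw [← div_eq_mul_inv, one_le_div (by positivity)]
    gcongr
  calc w x ^ r ≤ w x ^ r * ((1 + 2 * d : ℝ) ^ M * (R.relDist x ^ M)⁻¹) :=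
        le_mul_of_one_le_right hwr h3
    _ = _ := by ring

/-- The weighted sparse bound for sums of atoms. -/
theorem exists_sparse_lintegral_le [NeZero d] {N : ℕ} {p p₁ ε : ℝ} (hN : Admissible d p₁ N)
    (hp : 0 < p) (hp₁ : 0 < p₁) (hε : 0 < ε ∨ (ε = 0 ∧ p ≤ 1)) (M : ℕ) :
    ∃ C : ℝ≥0∞, C ≠ ∞ ∧ ∀ (α : DyadicCube d → ℝ≥0∞)
      (ψ : DyadicCube d → EuclideanSpace ℝ (Fin d) → ℂ), AtomFamily N α ψ →
      ∀ w : EuclideanSpace ℝ (Fin d) → ℝ, (∀ x, 0 < w x) → AEMeasurable w →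
        ∃ S : Set (DyadicCube d), IsSparse S ∧
          ∫⁻ x, ‖psum ψ Set.univ x‖ₑ ^ p * ENNReal.ofReal (w x) ≤
            C * ∑' Q : S, avg p₁ α Q ^ p * weightAverage M (1 + ε) w Q * volume Q.1.toSet := by
  obtain ⟨C₁, hC₁, hmain⟩ := exists_carleson_ae_enorm_psum_le (d := d) hN hp₁
  obtain ⟨C₂, hC₂, hweight⟩ := exists_lintegral_sparseSum_rpow_le (d := d) hp hε (Λ := 6) (by norm_num)
  have hΛ : nearCount d ^ 2 * 6 ≠ ∞ :=
    ENNReal.mul_ne_top (ENNReal.pow_ne_top (nearCount_ne_top d)) (by norm_num)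
  obtain ⟨K, hK⟩ := exists_thin_cover (d := d) hΛ
  have hε0 : 0 ≤ ε := by rcases hε with h | ⟨h, -⟩ <;> linarith
  have hr : 0 < 1 + ε := by linarith
  set n := nearCount d
  have hn : n ≠ ∞ := nearCount_ne_top d
  set c₃ := ENNReal.ofReal ((1 + 2 * d : ℝ) ^ M) ^ (1 / (1 + ε))
  have hc₃ : c₃ ≠ ∞ := ENNReal.rpow_ne_top_of_nonneg (by positivity) ENNReal.ofReal_ne_top
  set m : ℝ≥0∞ := (Fintype.card (Fin K ⊕ Fin 2) : ℝ≥0∞)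
  refine ⟨C₁ ^ p * C₂ * n ^ p * c₃ * n * m, ?_, fun α ψ h w hw hwm => ?_⟩
  · exact ENNReal.mul_ne_top (ENNReal.mul_ne_top (ENNReal.mul_ne_top (ENNReal.mul_ne_top
      (ENNReal.mul_ne_top (ENNReal.rpow_ne_top_of_nonneg hp.le hC₁) hC₂)
      (ENNReal.rpow_ne_top_of_nonneg hp.le hn)) hc₃) hn) (ENNReal.natCast_ne_top _)
  obtain ⟨𝓢, h𝓢, hdom⟩ := hmain α ψ h
  obtain ⟨G, hthin, -, hcov⟩ := hK _ h𝓢.nearFamily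
  set g : DyadicCube d → ℝ≥0∞ := fun R =>
    avg p₁ α R ^ p * weightAverage M (1 + ε) w R * volume R.toSet with hg
  set W : EuclideanSpace ℝ (Fin d) → ℝ≥0∞ := fun x => ENNReal.ofReal (w x)
  have hWm : AEMeasurable W := hwm.ennreal_ofReal
  have hterm : ∀ Q : DyadicCube d, avg3 p₁ α Q ^ p * weightOn (1 + ε) W Q ≤
      n ^ p * c₃ * ∑ v, g (Q.shift v) := fun Q => by
    have h1 : avg3 p₁ α Q ^ p ≤ n ^ p * ∑ v, avg p₁ α (Q.shift v) ^ p :=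
      sum_rpow_le_card Finset.univ (fun v => avg p₁ α (Q.shift v)) hp
    calc _ ≤ (n ^ p * ∑ v, avg p₁ α (Q.shift v) ^ p) * weightOn (1 + ε) W Q := by gcongr
      _ = n ^ p * ∑ v, avg p₁ α (Q.shift v) ^ p * weightOn (1 + ε) W Q := by
          rw [mul_assoc, Finset.sum_mul]
      _ ≤ n ^ p * ∑ v, avg p₁ α (Q.shift v) ^ p *
          (c₃ * (weightAverage M (1 + ε) w (Q.shift v) * volume (Q.shift v).toSet)) := by
          gcongr with v
          exact weightOn_le_of_near M hr hw (near_shift Q v)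
      _ = _ := by
          rw [mul_assoc, Finset.mul_sum, Finset.mul_sum, Finset.mul_sum]
          refine Finset.sum_congr rfl fun v _ => ?_
          rw [hg]; ring
  have hnear : ∑' Q : 𝓢, ∑ v, g (Q.1.shift v) ≤ n * ∑' R : nearFamily 𝓢, g R := by
    rw [Summable.tsum_finsetSum fun v _ => ENNReal.summable]
    have hv : ∀ v, ∑' Q : 𝓢, g (Q.1.shift v) ≤ ∑' R : nearFamily 𝓢, g R := fun v =>
      ENNReal.tsum_comp_le_tsum_of_injective
        (f := fun Q : 𝓢 => (⟨Q.1.shift v, Q, Q.2, v, rfl⟩ : nearFamily 𝓢))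
        (fun Q R hQR => Subtype.ext (shift_left_injective v (congrArg Subtype.val hQR)))
        fun R => g R
    refine (Finset.sum_le_sum fun v _ => hv v).trans_eq ?_
    rw [Finset.sum_const, nsmul_eq_mul, Finset.card_univ]
    rfl
  obtain ⟨i, -, hi⟩ := Finset.exists_max_image Finset.univ (fun i => ∑' R : G i, g R)
    ⟨Sum.inr 0, Finset.mem_univ _⟩
  have hpig : ∑' R : nearFamily 𝓢, g R ≤ m * ∑' R : G i, g R := by
    refine (ENNReal.tsum_mono_subtype g (t := ⋃ i, G i) fun R hR => Set.mem_iUnion.2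
      (hcov R hR)).trans ?_
    refine (ENNReal.tsum_iUnion_le_tsum g _).trans ?_
    rw [tsum_fintype]
    refine (Finset.sum_le_sum fun j _ => hi j (Finset.mem_univ j)).trans_eq ?_
    rw [Finset.sum_const, nsmul_eq_mul, Finset.card_univ]
  refine ⟨G i, (hthin i).isSparse, ?_⟩
  calc ∫⁻ x, ‖psum ψ Set.univ x‖ₑ ^ p * W x
      ≤ ∫⁻ x, C₁ ^ p * (sparseSum 𝓢 (avg3 p₁ α) x ^ p * W x) := by
        refine lintegral_mono_ae (hdom.mono fun x hx => ?_)
        rw [← mul_assoc, ← ENNReal.mul_rpow_of_nonneg _ _ hp.le]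
        gcongr
    _ = C₁ ^ p * ∫⁻ x, sparseSum 𝓢 (avg3 p₁ α) x ^ p * W x :=
        lintegral_const_mul' _ _ (ENNReal.rpow_ne_top_of_nonneg hp.le hC₁)
    _ ≤ C₁ ^ p * (C₂ * ∑' Q : 𝓢, avg3 p₁ α Q ^ p * weightOn (1 + ε) W Q) := by
        gcongr
        exact hweight 𝓢 h𝓢 _ W hWm
    _ ≤ C₁ ^ p * (C₂ * (n ^ p * c₃ * (n * (m * ∑' R : G i, g R)))) := by
        gcongr
        refine (ENNReal.tsum_le_tsum fun Q : 𝓢 => hterm Q).trans ?_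
        rw [ENNReal.tsum_mul_left]
        gcongr
        exact hnear.trans (mul_le_mul_right hpig _)
    _ = _ := by ring

end

/-! ### Lacunary families -/

section

open DyadicCube
open Filter hiding ker

variable {d : ℕ}

theorem rho_le_relDist (I : DyadicCube d) (x : EuclideanSpace ℝ (Fin d)) :
    I.rho x ≤ (1 + d) * I.relDist x := by
  have hs := I.side_pos
  have h1 : ‖x - I.corner‖ - d * I.side ≤ Metric.infDist x I.toSet := by
    refine (Metric.le_infDist I.nonempty).2 fun y hy => ?_
    have h2 := I.norm_sub_le hy I.corner_mem
    have h3 : ‖x - I.corner‖ ≤ ‖x - y‖ + ‖y - I.corner‖ := by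
      have := norm_add_le (x - y) (y - I.corner)
      rwa [sub_add_sub_cancel] at this
    rw [dist_eq_norm]; linarith
  have h2 : ‖x - I.corner‖ / I.side ≤ d + Metric.infDist x I.toSet / I.side := by
    rw [div_le_iff₀ hs, add_mul, div_mul_cancel₀ _ hs.ne']; linarith
  have h3 : 0 ≤ Metric.infDist x I.toSet / I.side := div_nonneg Metric.infDist_nonneg hs.le
  unfold rho relDist
  have hd : (0 : ℝ) ≤ d := Nat.cast_nonneg d
  nlinarith

namespace DyadicCube

/-- The `L²` normalization `|I|^{-1/2}`. -/
def norm2 (I : DyadicCube d) : ℝ≥0∞ := ENNReal.ofReal (Real.sqrt (volume.real I.toSet))⁻¹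

theorem norm2_ne_top (I : DyadicCube d) : I.norm2 ≠ ∞ := ENNReal.ofReal_ne_top

theorem norm2_sq (I : DyadicCube d) : I.norm2 ^ 2 = (volume I.toSet)⁻¹ := by
  have h0 : 0 < volume.real I.toSet := ENNReal.toReal_pos I.volume_ne_zero I.volume_ne_top
  unfold norm2
  rw [← ENNReal.ofReal_pow (by positivity), inv_pow, Real.sq_sqrt h0.le,
    ENNReal.ofReal_inv_of_pos h0, measureReal_def, ENNReal.ofReal_toReal I.volume_ne_top]

end DyadicCube

/-- A real constant turning lacunary families into atoms. -/
def lacunaryConst (d N : ℕ) (A : ℝ) : ℝ := (|A| + 1) * (1 + d) ^ N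

theorem lacunaryConst_pos (d N : ℕ) (A : ℝ) : 0 < lacunaryConst d N A := by
  unfold lacunaryConst; positivity

theorem IsLacunary.norm_iteratedFDeriv_le {N : ℕ} {A : ℝ} {𝓘 : Set (DyadicCube d)}
    {φ : DyadicCube d → 𝓢(EuclideanSpace ℝ (Fin d), ℂ)} (h : IsLacunary N A 𝓘 φ)
    {I : DyadicCube d} (hI : I ∈ 𝓘) {j : ℕ} (hj : j ≤ 10) (x : EuclideanSpace ℝ (Fin d)) :
    ‖iteratedFDeriv ℝ j (φ I) x‖ ≤ lacunaryConst d N A * (Real.sqrt (volume.real I.toSet))⁻¹ *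
      (I.side ^ j)⁻¹ * (I.rho x ^ N)⁻¹ := by
  have hs := I.side_pos
  have hr := I.rho_pos x
  have hrel : 0 < I.relDist x := one_pos.trans_le (one_le_relDist I x)
  have h1 : (I.relDist x ^ N)⁻¹ ≤ (1 + d : ℝ) ^ N * (I.rho x ^ N)⁻¹ :=
    inv_pow_le_inv_pow hrel hr (by rw [mul_comm]; exact rho_le_relDist I x) N
  refine ((h I hI).1 j hj x).trans ?_
  calc A * (Real.sqrt (volume.real I.toSet))⁻¹ * (I.side ^ j)⁻¹ * (I.relDist x ^ N)⁻¹
      ≤ (|A| + 1) * (Real.sqrt (volume.real I.toSet))⁻¹ * (I.side ^ j)⁻¹ *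
        ((1 + d : ℝ) ^ N * (I.rho x ^ N)⁻¹) := by
        gcongr
        linarith [le_abs_self A]
    _ = _ := by unfold lacunaryConst; ring

/-- Members of lacunary families are atoms. -/
theorem IsLacunary.isAtom {N : ℕ} {A : ℝ} {𝓘 : Set (DyadicCube d)}
    {φ : DyadicCube d → 𝓢(EuclideanSpace ℝ (Fin d), ℂ)} (h : IsLacunary N A 𝓘 φ)
    {I : DyadicCube d} (hI : I ∈ 𝓘) :
    IsAtom N I (ENNReal.ofReal (lacunaryConst d N A) * I.norm2) (φ I) := by
  have hs := I.side_pos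
  have hL := lacunaryConst_pos d N A
  set V := (Real.sqrt (volume.real I.toSet))⁻¹ with hV
  have hV0 : 0 ≤ V := by positivity
  have e : ENNReal.ofReal (lacunaryConst d N A) * I.norm2 =
      ENNReal.ofReal (lacunaryConst d N A * V) := by
    rw [norm2, ENNReal.ofReal_mul hL.le]
  rw [e]
  refine ⟨(φ I).continuous, fun x => ?_, fun n hn x y => ?_, (h I hI).2⟩
  · have h1 := h.norm_iteratedFDeriv_le hI (Nat.zero_le 10) x
    rw [norm_iteratedFDeriv_zero, pow_zero, inv_one, mul_one] at h1
    rw [← ofReal_norm, ker, ← ENNReal.ofReal_mul (by positivity)]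
    exact ENNReal.ofReal_le_ofReal h1
  · set t := ‖x - y‖ / I.side with ht
    have ht0 : 0 ≤ t := by positivity
    have hr := I.rho_pos x
    have hbound : ∀ z ∈ segment ℝ x y, ‖fderiv ℝ (φ I) z‖ ≤
        lacunaryConst d N A * V * I.side⁻¹ * ((1 + t) ^ n * (I.rho x ^ n)⁻¹) := fun z hz => by
      have h1 := h.norm_iteratedFDeriv_le hI (by norm_num : 1 ≤ 10) z
      rw [norm_iteratedFDeriv_one, pow_one] at h1
      have hrz := I.rho_pos z
      have h2 : I.rho x ≤ I.rho z * (1 + t) := by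
        refine rho_le_of_norm_le ?_
        rw [ht, div_mul_cancel₀ _ hs.ne', norm_sub_rev]
        have := segment_subset_closedBall_left x y hz
        rw [mem_closedBall_iff_norm, dist_eq_norm] at this
        rwa [norm_sub_rev]
      refine h1.trans ?_
      gcongr
      calc (I.rho z ^ N)⁻¹ ≤ (I.rho z ^ n)⁻¹ := by
            gcongr
            exact I.one_le_rho z
        _ ≤ _ := inv_pow_le_inv_pow hrz hr h2 n
    have h3 := (convex_segment x y).norm_image_sub_le_of_norm_fderiv_le
      (fun z _ => (φ I).differentiable z) hbound (right_mem_segment ℝ x y)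
      (left_mem_segment ℝ x y)
    rw [← ofReal_norm, ker, ← ENNReal.ofReal_mul (by positivity),
      ← ENNReal.ofReal_mul (by positivity)]
    refine ENNReal.ofReal_le_ofReal (h3.trans_eq ?_)
    rw [ht]; ring

theorem IsAtom.mono {N : ℕ} {I : DyadicCube d} {a b : ℝ≥0∞} {g : EuclideanSpace ℝ (Fin d) → ℂ}
    (h : IsAtom N I a g) (hab : a ≤ b) : IsAtom N I b g :=
  ⟨h.continuous, fun x => (h.size x).trans (by gcongr), fun n hn x y =>
    (h.smooth n hn x y).trans (by gcongr), h.mean⟩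

theorem IsAtom.const_mul {N : ℕ} {I : DyadicCube d} {a : ℝ≥0∞} {g : EuclideanSpace ℝ (Fin d) → ℂ}
    (h : IsAtom N I a g) (c : ℂ) : IsAtom N I (‖c‖ₑ * a) fun x => c * g x := by
  refine ⟨continuous_const.mul h.continuous, fun x => ?_, fun n hn x y => ?_, ?_⟩
  · rw [enorm_mul, mul_assoc]
    gcongr
    exact h.size x
  · rw [← mul_sub, enorm_mul, mul_assoc, mul_assoc, ← mul_assoc a]
    gcongr
    exact h.smooth n hn x y
  · rw [integral_const_mul, h.mean, mul_zero]

theorem isAtom_zero (N : ℕ) (I : DyadicCube d) : IsAtom N I 0 fun _ => 0 :=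
  ⟨continuous_const, fun x => by simp, fun n _ x y => by simp, by simp⟩

theorem exists_lipschitz_bound (f : 𝓢(EuclideanSpace ℝ (Fin d), ℂ)) :
    ∃ L : ℝ, 0 ≤ L ∧ (∀ x, ‖f x‖ ≤ L) ∧ ∀ x y, ‖f x - f y‖ ≤ L * ‖x - y‖ := by
  obtain ⟨C₀, hC₀, h0⟩ := f.decay 0 0
  obtain ⟨C₁, hC₁, h1⟩ := f.decay 0 1
  refine ⟨max C₀ C₁, le_max_of_le_left hC₀.le, fun x => ?_, fun x y => ?_⟩
  · have := h0 x
    rw [pow_zero, one_mul, norm_iteratedFDeriv_zero] at this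
    exact le_max_of_le_left this
  · refine convex_univ.norm_image_sub_le_of_norm_fderiv_le (fun z _ => f.differentiable z)
      (fun z _ => ?_) (Set.mem_univ y) (Set.mem_univ x)
    have := h1 z
    rw [pow_zero, one_mul, norm_iteratedFDeriv_one] at this
    exact le_max_of_le_right this

theorem IsLacunary.enorm_pairing_le_small {N : ℕ} (hN : 2 * d + 3 ≤ N) {A : ℝ}
    {𝓘 : Set (DyadicCube d)} {φ : DyadicCube d → 𝓢(EuclideanSpace ℝ (Fin d), ℂ)}
    (h : IsLacunary N A 𝓘 φ) {f : 𝓢(EuclideanSpace ℝ (Fin d), ℂ)} {L : ℝ} (hL0 : 0 ≤ L)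
    (hL : ∀ x, ‖f x‖ ≤ L) (hL' : ∀ x y, ‖f x - f y‖ ≤ L * ‖x - y‖) {I : DyadicCube d}
    (hI : I ∈ 𝓘) :
    ‖pairing f (φ I)‖ₑ * I.norm2 ≤
      ENNReal.ofReal (lacunaryConst d N A) * ENNReal.ofReal L * kerMass d * ENNReal.ofReal I.side := by
  have hs := I.side_pos
  have e : pairing f (φ I) = conj (∫ x, φ I x * conj (f x)) := by
    unfold pairing
    rw [← integral_conj]
    refine integral_congr_ae (Eventually.of_forall fun x => ?_)
    simp [mul_comm]
  have h1 := (h.isAtom hI).enorm_integral_mul_le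
    (ENNReal.mul_ne_top ENNReal.ofReal_ne_top I.norm2_ne_top) hN
    (g := fun x => conj (f x)) (Complex.continuous_conj.comp f.continuous) (C := L)
    (fun x => by rw [RCLike.norm_conj]; exact hL x) (H := ENNReal.ofReal L * ENNReal.ofReal I.side)
    fun x => by
      have hr := I.one_le_rho x
      rw [← map_sub, RCLike.enorm_conj, ← ofReal_norm, ← ENNReal.ofReal_mul hL0,
        ← ENNReal.ofReal_mul (by positivity)]
      refine ENNReal.ofReal_le_ofReal ((hL' x I.corner).trans ?_)
      rw [mul_assoc]
      gcongr
      calc ‖x - I.corner‖ ≤ I.side * I.rho x := by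
            unfold rho
            rw [mul_add, mul_div_cancel₀ _ hs.ne']; linarith
        _ ≤ I.side * I.rho x ^ (d + 2) := by
            gcongr
            exact le_self_pow₀ hr (by omega)
  rw [e, RCLike.enorm_conj]
  calc _ ≤ (ENNReal.ofReal (lacunaryConst d N A) * I.norm2 *
        (ENNReal.ofReal L * ENNReal.ofReal I.side) * (volume I.toSet * kerMass d)) * I.norm2 := by
        gcongr
    _ = ENNReal.ofReal (lacunaryConst d N A) * ENNReal.ofReal L * kerMass d * ENNReal.ofReal I.side *
        (volume I.toSet * I.norm2 ^ 2) := by ring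
    _ = _ := by
        rw [norm2_sq, ENNReal.mul_inv_cancel I.volume_ne_zero I.volume_ne_top, mul_one]

theorem IsLacunary.enorm_pairing_le_large {N : ℕ} {A : ℝ}
    {𝓘 : Set (DyadicCube d)} {φ : DyadicCube d → 𝓢(EuclideanSpace ℝ (Fin d), ℂ)}
    (h : IsLacunary N A 𝓘 φ) (f : 𝓢(EuclideanSpace ℝ (Fin d), ℂ)) {I : DyadicCube d}
    (hI : I ∈ 𝓘) :
    ‖pairing f (φ I)‖ₑ * I.norm2 ≤
      ENNReal.ofReal (lacunaryConst d N A) * (∫⁻ x, ‖f x‖ₑ) * (volume I.toSet)⁻¹ := by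
  have h1 : ‖pairing f (φ I)‖ₑ ≤
      (∫⁻ x, ‖f x‖ₑ) * (ENNReal.ofReal (lacunaryConst d N A) * I.norm2) := by
    unfold pairing
    refine (enorm_integral_le_lintegral_enorm _).trans ?_
    rw [← lintegral_mul_const _ f.continuous.enorm.measurable]
    refine lintegral_mono fun x => ?_
    rw [enorm_mul, RCLike.enorm_conj]
    gcongr
    exact ((h.isAtom hI).size x).trans (mul_le_of_le_one_right zero_le (ker_le_one N I x))
  calc _ ≤ (∫⁻ x, ‖f x‖ₑ) * (ENNReal.ofReal (lacunaryConst d N A) * I.norm2) * I.norm2 := by gcongr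
    _ = ENNReal.ofReal (lacunaryConst d N A) * (∫⁻ x, ‖f x‖ₑ) * I.norm2 ^ 2 := by ring
    _ = _ := by rw [norm2_sq]

/-- The normalized coefficients of `f` with respect to a lacunary family. -/
def coefficient (𝓘 : Set (DyadicCube d)) (φ : DyadicCube d → 𝓢(EuclideanSpace ℝ (Fin d), ℂ))
    (f : 𝓢(EuclideanSpace ℝ (Fin d), ℂ)) : DyadicCube d → ℝ≥0∞ :=
  𝓘.indicator fun I => ‖pairing f (φ I)‖ₑ * I.norm2

theorem tsum_int_two_zpow_le (a b : ℝ≥0∞) (g : ℤ → ℝ≥0∞)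
    (h1 : ∀ n : ℕ, g n ≤ a * 2⁻¹ ^ n) (h2 : ∀ n : ℕ, g (-(n + 1 : ℤ)) ≤ b * 2⁻¹ ^ n) :
    ∑' k, g k ≤ 2 * (a + b) := by
  have hgeo : ∑' i : ℕ, (2⁻¹ : ℝ≥0∞) ^ i = 2 := by
    rw [ENNReal.tsum_geometric, ENNReal.one_sub_inv_two, inv_inv]
  rw [tsum_of_nat_of_neg_add_one ENNReal.summable ENNReal.summable]
  calc _ ≤ (∑' n : ℕ, a * 2⁻¹ ^ n) + ∑' n : ℕ, b * 2⁻¹ ^ n :=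
        add_le_add (ENNReal.tsum_le_tsum h1) (ENNReal.tsum_le_tsum h2)
    _ = _ := by rw [ENNReal.tsum_mul_left, ENNReal.tsum_mul_left, hgeo]; ring

theorem IsLacunary.tsum_iSup_coefficient_ne_top [NeZero d] {N : ℕ} (hN : 2 * d + 3 ≤ N) {A : ℝ}
    {𝓘 : Set (DyadicCube d)} {φ : DyadicCube d → 𝓢(EuclideanSpace ℝ (Fin d), ℂ)}
    (h : IsLacunary N A 𝓘 φ) (f : 𝓢(EuclideanSpace ℝ (Fin d), ℂ)) :
    ∑' k : ℤ, ⨆ I ∈ (level k : Set (DyadicCube d)), coefficient 𝓘 φ f I ≠ ∞ := by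
  obtain ⟨L, hL0, hL, hL'⟩ := exists_lipschitz_bound f
  set a := ENNReal.ofReal (lacunaryConst d N A) * (∫⁻ x, ‖f x‖ₑ)
  set b := ENNReal.ofReal (lacunaryConst d N A) * ENNReal.ofReal L * kerMass d
  have ha : a ≠ ∞ := ENNReal.mul_ne_top ENNReal.ofReal_ne_top f.integrable.2.ne
  have hb : b ≠ ∞ := ENNReal.mul_ne_top (ENNReal.mul_ne_top ENNReal.ofReal_ne_top
    ENNReal.ofReal_ne_top) (kerMass_ne_top d)
  have e2 : ENNReal.ofReal 2⁻¹ = 2⁻¹ := by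
    rw [ENNReal.ofReal_inv_of_pos (by norm_num)]; simp
  refine ne_top_of_le_ne_top (ENNReal.mul_ne_top (by norm_num) (ENNReal.add_ne_top.2 ⟨ha, hb⟩))
    (tsum_int_two_zpow_le a b _ (fun n => ?_) fun n => ?_)
  · refine iSup₂_le fun I hI => ?_
    have hk : I.k = n := hI
    by_cases hmem : I ∈ 𝓘
    · rw [coefficient, Set.indicator_of_mem hmem]
      refine (h.enorm_pairing_le_large f hmem).trans ?_
      gcongr
      have h1 : I.side = 2 ^ n := by rw [side, hk, zpow_natCast]
      rw [volume_eq, h1, ← ENNReal.ofReal_inv_of_pos (by positivity), ← e2,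
        ← ENNReal.ofReal_pow (by norm_num), inv_pow]
      refine ENNReal.ofReal_le_ofReal ?_
      gcongr
      exact le_self_pow₀ (one_le_pow₀ (by norm_num)) (NeZero.ne d)
    · rw [coefficient, Set.indicator_of_notMem hmem]; exact zero_le
  · refine iSup₂_le fun I hI => ?_
    have hk : I.k = -(n + 1 : ℤ) := hI
    by_cases hmem : I ∈ 𝓘
    · rw [coefficient, Set.indicator_of_mem hmem]
      refine (h.enorm_pairing_le_small hN hL0 hL hL' hmem).trans ?_
      gcongr
      have h1 : I.side ≤ 2⁻¹ ^ n := by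
        rw [side, hk, zpow_neg, inv_pow, ← zpow_natCast]
        gcongr
        · norm_num
        · omega
      rw [← e2, ← ENNReal.ofReal_pow (by norm_num)]
      exact ENNReal.ofReal_le_ofReal h1
    · rw [coefficient, Set.indicator_of_notMem hmem]; exact zero_le

/-- The normalized summands. -/
def summand (c : ℝ) (𝓘 : Set (DyadicCube d))
    (φ₁ φ₂ : DyadicCube d → 𝓢(EuclideanSpace ℝ (Fin d), ℂ))
    (f : 𝓢(EuclideanSpace ℝ (Fin d), ℂ)) : DyadicCube d → EuclideanSpace ℝ (Fin d) → ℂ :=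
  𝓘.indicator fun I x => (c⁻¹ : ℝ) * pairing f (φ₁ I) * φ₂ I x

theorem IsLacunary.atomFamily [NeZero d] {N : ℕ} (hN : 2 * d + 3 ≤ N) {A : ℝ}
    {𝓘 : Set (DyadicCube d)} {φ₁ φ₂ : DyadicCube d → 𝓢(EuclideanSpace ℝ (Fin d), ℂ)}
    (h₁ : IsLacunary N A 𝓘 φ₁) (h₂ : IsLacunary N A 𝓘 φ₂)
    (f : 𝓢(EuclideanSpace ℝ (Fin d), ℂ)) :
    AtomFamily N (coefficient 𝓘 φ₁ f) (summand (lacunaryConst d N A) 𝓘 φ₁ φ₂ f) := by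
  refine ⟨fun I => ?_, h₁.tsum_iSup_coefficient_ne_top hN f⟩
  have hL := lacunaryConst_pos d N A
  by_cases hI : I ∈ 𝓘
  · rw [coefficient, summand, Set.indicator_of_mem hI, Set.indicator_of_mem hI]
    refine ((h₂.isAtom hI).const_mul _).mono ?_
    rw [enorm_mul, ← ofReal_norm, Complex.norm_real, Real.norm_of_nonneg (by positivity)]
    have e : ENNReal.ofReal (lacunaryConst d N A)⁻¹ * ENNReal.ofReal (lacunaryConst d N A) = 1 := by
      rw [← ENNReal.ofReal_mul (by positivity), inv_mul_cancel₀ hL.ne', ENNReal.ofReal_one]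
    calc _ = (ENNReal.ofReal (lacunaryConst d N A)⁻¹ * ENNReal.ofReal (lacunaryConst d N A)) *
          (‖pairing f (φ₁ I)‖ₑ * I.norm2) := by ring
      _ ≤ _ := by rw [e, one_mul]
  · rw [coefficient, summand, Set.indicator_of_notMem hI, Set.indicator_of_notMem hI]
    exact isAtom_zero N I

theorem localSquare_eq_lsq (𝓘 : Set (DyadicCube d))
    (φ : DyadicCube d → 𝓢(EuclideanSpace ℝ (Fin d), ℂ)) (f : 𝓢(EuclideanSpace ℝ (Fin d), ℂ))
    (Q : DyadicCube d) (x : EuclideanSpace ℝ (Fin d)) :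
    localSquare 𝓘 φ f Q x = lsq (coefficient 𝓘 φ f) Q x := by
  unfold localSquare lsq
  congr 1
  have h1 : ∀ (P : DyadicCube d → Prop) (g : DyadicCube d → ℝ≥0∞),
      ∑' I : {I // P I}, g I = ∑' I, {I | P I}.indicator g I := fun P g => tsum_subtype {I | P I} g
  rw [h1 (fun I => I ∈ 𝓘 ∧ I.toSet ⊆ Q.toSet) (fun I : DyadicCube d =>
    I.toSet.indicator (fun _ => ‖pairing f (φ I)‖ₑ ^ 2 / volume I.toSet) x),
    tsum_subtype {I : DyadicCube d | I.toSet ⊆ Q.toSet} (fun I : DyadicCube d =>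
    I.toSet.indicator (fun _ => coefficient 𝓘 φ f I ^ 2) x)]
  classical
  refine tsum_congr fun I => ?_
  simp only [Set.indicator_apply, Set.mem_ofPred_eq, coefficient]
  by_cases hI : I ∈ 𝓘 <;> simp [hI, mul_pow, norm2_sq, div_eq_mul_inv]

theorem squareAverage_eq_avg {p₁ : ℝ} (hp₁ : 0 < p₁) (𝓘 : Set (DyadicCube d))
    (φ : DyadicCube d → 𝓢(EuclideanSpace ℝ (Fin d), ℂ)) (f : 𝓢(EuclideanSpace ℝ (Fin d), ℂ))
    (Q : DyadicCube d) : squareAverage p₁ 𝓘 φ f Q = avg p₁ (coefficient 𝓘 φ f) Q := by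
  unfold squareAverage avg
  rw [eLpNorm_eq_lintegral_rpow_enorm_toReal (by simpa using hp₁) ENNReal.ofReal_ne_top,
    ENNReal.toReal_ofReal hp₁.le, ENNReal.div_rpow_of_nonneg _ _ (by positivity)]
  simp only [localSquare_eq_lsq, enorm_eq_self]

theorem hasSum_summand {c : ℝ} (hc : c ≠ 0) {N : ℕ} {α : DyadicCube d → ℝ≥0∞}
    {𝓘 : Set (DyadicCube d)} {φ₁ φ₂ : DyadicCube d → 𝓢(EuclideanSpace ℝ (Fin d), ℂ)}
    {f : 𝓢(EuclideanSpace ℝ (Fin d), ℂ)} (h : AtomFamily N α (summand c 𝓘 φ₁ φ₂ f))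
    (hN : d + 1 ≤ N) (x : EuclideanSpace ℝ (Fin d)) :
    HasSum (fun I : 𝓘 => pairing f (φ₁ I) * φ₂ I x)
      (c * psum (summand c 𝓘 φ₁ φ₂ f) Set.univ x) := by
  have h1 := (h.summable_indicator hN Set.univ x).hasSum.mul_left (c : ℂ)
  have h2 : (fun I => (c : ℂ) * (Set.univ.indicator (fun I => summand c 𝓘 φ₁ φ₂ f I x) I)) =
      𝓘.indicator fun I => pairing f (φ₁ I) * φ₂ I x := by
    funext I
    have hc' : (c : ℂ) ≠ 0 := by exact_mod_cast hc
    by_cases hI : I ∈ 𝓘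
    · simp [summand, hI]
      field_simp
    · simp [summand, hI]
  rw [h2] at h1
  exact (hasSum_subtype_iff_indicator (f := fun I => pairing f (φ₁ I) * φ₂ I x)).2 h1

end

end SparseSquare

end

theorem theorem6 (d : ℕ) (hd : 1 ≤ d) (p p₁ ε : ℝ) (hp : 0 < p) (hp₁ : 0 < p₁)
    (hε : 0 < ε ∨ (ε = 0 ∧ p ≤ 1)) (M : ℕ) :
    ∃ N : ℕ, ∀ A : ℝ, ∃ C : ℝ≥0,
      ∀ (𝓘 : Set (SparseSquare.DyadicCube d))
        (φ₁ φ₂ : SparseSquare.DyadicCube d → 𝓢(EuclideanSpace ℝ (Fin d), ℂ)),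
        SparseSquare.IsLacunary N A 𝓘 φ₁ → SparseSquare.IsLacunary N A 𝓘 φ₂ →
      ∀ w : EuclideanSpace ℝ (Fin d) → ℝ, (∀ x, 0 < w x) → LocallyIntegrable w volume →
      ∀ f : 𝓢(EuclideanSpace ℝ (Fin d), ℂ),
        (∀ x, Summable fun I : 𝓘 => SparseSquare.pairing f (φ₁ I) * φ₂ I x) ∧
        ∃ S : Set (SparseSquare.DyadicCube d), SparseSquare.IsSparse S ∧
          eLpNorm (fun x => (∑' I : 𝓘, SparseSquare.pairing f (φ₁ I) * φ₂ I x) *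
              ((w x ^ (1 / p) : ℝ) : ℂ)) (ENNReal.ofReal p) volume ^ p ≤
            C * ∑' Q : S, SparseSquare.squareAverage p₁ 𝓘 φ₁ f Q ^ p *
              SparseSquare.weightAverage M (1 + ε) w Q * volume (Q : SparseSquare.DyadicCube d).toSet := by
  have : NeZero d := ⟨by omega⟩
  set N := 2 * d + 4 + SparseSquare.growth d p₁ with hNdef
  have hN : SparseSquare.Admissible d p₁ N := le_rfl
  obtain ⟨C, hC, hmain⟩ := SparseSquare.exists_sparse_lintegral_le hN hp hp₁ hε M
  refine ⟨N, fun A => ?_⟩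
  set L := SparseSquare.lacunaryConst d N A
  have hL : 0 < L := SparseSquare.lacunaryConst_pos d N A
  have hLC : ENNReal.ofReal L ^ p * C ≠ ∞ :=
    ENNReal.mul_ne_top (ENNReal.rpow_ne_top_of_nonneg hp.le ENNReal.ofReal_ne_top) hC
  refine ⟨(ENNReal.ofReal L ^ p * C).toNNReal, fun 𝓘 φ₁ φ₂ h₁ h₂ w hw hwint f => ?_⟩
  have hfam := h₁.atomFamily (by omega) h₂ f
  have hsum := SparseSquare.hasSum_summand hL.ne' hfam (by omega)
  refine ⟨fun x => (hsum x).summable, ?_⟩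
  obtain ⟨S, hS, hle⟩ := hmain _ _ hfam w hw hwint.aestronglyMeasurable.aemeasurable
  refine ⟨S, hS, ?_⟩
  rw [ENNReal.coe_toNNReal hLC]
  simp only [SparseSquare.squareAverage_eq_avg hp₁, (hsum _).tsum_eq]
  rw [eLpNorm_eq_lintegral_rpow_enorm_toReal (by simpa using hp) ENNReal.ofReal_ne_top,
    ENNReal.toReal_ofReal hp.le, ← ENNReal.rpow_mul, one_div_mul_cancel hp.ne', ENNReal.rpow_one]
  refine le_trans ?_ ((mul_le_mul_right hle (ENNReal.ofReal L ^ p)).trans_eq (by rw [mul_assoc]))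
  rw [← lintegral_const_mul' _ _ (ENNReal.rpow_ne_top_of_nonneg hp.le ENNReal.ofReal_ne_top)]
  refine lintegral_mono fun x => le_of_eq ?_
  have hwx := hw x
  have e : ENNReal.ofReal (w x ^ (1 / p)) ^ p = ENNReal.ofReal (w x) := by
    rw [ENNReal.ofReal_rpow_of_nonneg (by positivity) hp.le, ← Real.rpow_mul hwx.le,
      one_div_mul_cancel hp.ne', Real.rpow_one]
  rw [enorm_mul, enorm_mul, ENNReal.mul_rpow_of_nonneg _ _ hp.le, ENNReal.mul_rpow_of_nonneg _ _ hp.le,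
    ← ofReal_norm ((w x ^ (1 / p) : ℝ) : ℂ), ← ofReal_norm (L : ℂ), Complex.norm_real, Complex.norm_real,
    Real.norm_of_nonneg (by positivity), Real.norm_of_nonneg (by positivity), e, mul_assoc]
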